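/- Let $\mathbb{F}_q$ denote the finite field with $q$ elements. A *Steinhaus random multiplicative function* over $\mathbb{F}_q[t]$ is a random function $f$ on the monic polynomials of $\mathbb{F}_q[t]$ such that the values $f(P)$, for $P$ monic irreducible, are independent random variables uniformly distributed on the unit circle $\{z\in\mathbb{C}:|z|=1\}$, and such that $f(1)=1$ and $f(P_1^{a_1}\cdots P_r^{a_r})=f(P_1)^{a_1}\cdots f(P_r)^{a_r}$ for all distinct monic irreducible $P_1,\dots,P_r$ and all integers $a_1,\dots,a_r\ge 1$. Let $\mathcal{CN}(0,1)$ be the standard complex normal distribution, that is, the law of $U+iV$ with $U,V$ independent real normal random variables of mean $0$ and variance $1/2$. **Theorem.** Let $q\ge 3$ be a prime power, let $N\ge 1$ be an integer, and let $Z\in\mathbb{F}_q[t]$ be monic with $\deg Z\le N-1$. Put $$\mathcal{A}=\{P+Z : P\in\mathbb{F}_q[t] \text{ monic irreducible},\ \deg P=N\}.$$ If $f$ is a Steinhaus random multiplicative function over $\mathbb{F}_q[t]$, then $$\frac{1}{\sqrt{|\mathcal{A}|}}\sum_{F\in\mathcal{A}} f(F)\ \xrightarrow{\ d\ }\ \mathcal{CN}(0,1)\qquad\text{as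 } N\to\infty,$$ where $q$ and $Z$ may vary arbitrarily with $N$. Explicitly: for every sequence $(q_n,N_n,Z_n,f_n)_{n}$ of such data with $N_n\to\infty$ (where $f_n$ is a Steinhaus random multiplicative function over $\mathbb{F}_{q_n}[t]$, possibly on a probability space depending on $n$), the corresponding normalized sums converge in distribution to $\mathcal{CN}(0,1)$ as $n\to\infty$. -/

import Mathlib

open MeasureTheory ProbabilityTheory Polynomial Filter

/-- The monic irreducible polynomials ("primes") of `F[t]`. -/
abbrev MonicIrred (F : Type*) [Field F] : Type _ :=
  {P : F[X] // P.Monic ∧ Irreducible P}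

/-- The uniform probability distribution on the unit circle `{z : ℂ | ‖z‖ = 1}`:
the law of `exp (2 π i θ)` with `θ` uniform on `(0, 1]`. -/
noncomputable def uniformCircle : Measure ℂ :=
  (volume.restrict (Set.Ioc (0 : ℝ) 1)).map
    (fun θ : ℝ => Complex.exp (2 * Real.pi * θ * Complex.I))

/-- The standard complex normal distribution `CN(0,1)`: the law of `U + i V` with `U`, `V`
independent real normal variables of mean `0` and variance `1/2`. -/
noncomputable def stdComplexNormal : Measure ℂ :=
  ((gaussianReal 0 (1 / 2)).prod (gaussianReal 0 (1 / 2))).map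
    (fun p : ℝ × ℝ => (p.1 : ℂ) + (p.2 : ℂ) * Complex.I)

instance isProbabilityMeasure_stdComplexNormal : IsProbabilityMeasure stdComplexNormal :=
  Measure.isProbabilityMeasure_map (Measurable.aemeasurable (by fun_prop))

/-- `f` is a Steinhaus random multiplicative function over `F[t]`: the values at the monic
irreducible polynomials are independent and uniform on the unit circle, and
`f (P₁ ^ a₁ ⋯ P_r ^ a_r) = f P₁ ^ a₁ ⋯ f P_r ^ a_r` for distinct monic irreducible `P₁, …, P_r`
(so `f 1 = 1`, by the empty product). Only the values of `f` at monic polynomials are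
constrained; the others play no role. -/
structure IsSteinhaus {F : Type*} [Field F] {Ω : Type*} [MeasurableSpace Ω]
    (f : F[X] → Ω → ℂ) (μ : Measure Ω) : Prop where
  measurable : ∀ P : MonicIrred F, Measurable (f P.1)
  uniform : ∀ P : MonicIrred F, μ.map (f P.1) = uniformCircle
  indep : iIndepFun (fun P : MonicIrred F => f P.1) μ
  map_prod_pow : ∀ (s : Finset (MonicIrred F)) (a : MonicIrred F → ℕ) (ω : Ω),
    f (∏ P ∈ s, P.1 ^ a P) ω = ∏ P ∈ s, f P.1 ω ^ a P

/-- The set `{P + Z : P monic irreducible of degree N}`. -/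
def shiftedPrimeSet {F : Type*} [Field F] (N : ℕ) (Z : F[X]) : Set F[X] :=
  {G | ∃ P : F[X], P.Monic ∧ Irreducible P ∧ P.natDegree = N ∧ G = P + Z}

theorem shiftedPrimeSet_finite {F : Type*} [Field F] [Finite F] (N : ℕ) (Z : F[X]) :
    (shiftedPrimeSet N Z).Finite := by
  have h : {P : F[X] | P.natDegree = N}.Finite := by
    refine Set.Finite.of_finite_image (f := fun P (i : Fin (N + 1)) => P.coeff i)
      (Set.toFinite _) ?_
    intro P hP Q hQ hPQ
    ext n
    by_cases hn : n < N + 1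
    · exact congrFun hPQ ⟨n, hn⟩
    · change P.natDegree = N at hP; change Q.natDegree = N at hQ
      rw [coeff_eq_zero_of_natDegree_lt (by omega), coeff_eq_zero_of_natDegree_lt (by omega)]
  refine (h.image (fun P => P + Z)).subset ?_
  rintro G ⟨P, -, -, hN, rfl⟩
  exact ⟨P, hN, rfl⟩

/-- The finite set `{P + Z : P monic irreducible of degree N}` over a finite field. -/
noncomputable def shiftedPrimes {F : Type*} [Field F] [Finite F] (N : ℕ) (Z : F[X]) :
    Finset F[X] :=
  (shiftedPrimeSet_finite N Z).toFinset

/-- The normalized partial sum `|A| ^ (-1/2) ∑_{G ∈ A} f(G)` as a random variable. -/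
noncomputable def normalizedSum {F : Type*} [Field F] {Ω : Type*}
    (f : F[X] → Ω → ℂ) (A : Finset F[X]) (ω : Ω) : ℂ :=
  ((Real.sqrt (A.card : ℝ) : ℝ) : ℂ)⁻¹ * ∑ G ∈ A, f G ω

/-! ### The uniform distribution on the circle -/

/-! The sum is a martingale once the primes are ordered by degree. Almost every `a ∈ A` factors as
`a = P * c`, where `P` is its largest prime, of degree at least `M ≈ N / log N`, and `c` involves
only smaller primes. Grouping by `P` turns the normalized sum into `∑ f(P) W_P`, where `f(P)` is a
uniform phase independent of the past and `W_P` depends on the past only. Such a sum is close to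
Gaussian when `∑ E|W_P|^4` is small and `∑ |W_P|^2` is close to 1 in mean
(`norm_integral_exp_inner_sub_gaussian_le`).

Expanding `|W_P|^2`, the diagonal terms add up to nearly 1. By orthogonality of `f` on monic
polynomials, the off-diagonal terms have second moment equal to `crossEnergy`: the number of
solutions of `a c' = a' c` with `a ≠ c` sharing a leading prime, and likewise `a' ≠ c'`. This count
also controls the fourth moments (`IsSteinhaus.norm_charFun_sub_le`).

Dividing out gcds, every solution has the form `a = g x`, `c = g y`, `a' = h x`, `c' = h y` with
`deg g = deg h ≥ M` and `g x - Z`, `g y - Z`, `h x - Z`, `h y - Z` all irreducible. For fixed `x ≠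
y` Selberg's sieve bounds the number of `g` of degree `n` by `q^n / n^2` up to a power of `log N`
(`card_irreducible_pair_le`). Squaring and summing over `x`, `y` and their `N` possible degrees
gives about `N q^(2N) / M^4`, while `|A|^2` is at least `q^(2N) / (4 N^2)`. The ratio is therefore
`N^3 / M^4` up to logarithms, that is `N^(-1+o(1))`.

Elements without a usable leading prime have either a large square factor or very many prime
factors, and both kinds are rare (`card_not_hasLargePrime_le`). All bounds are uniform in `q ≥ 3`
and in `Z`, so convergence of characteristic functions along any sequence follows. -/

instance isProbabilityMeasure_uniformCircle : IsProbabilityMeasure uniformCircle := by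
  have : IsProbabilityMeasure (volume.restrict (Set.Ioc (0 : ℝ) 1)) := ⟨by simp⟩
  exact Measure.isProbabilityMeasure_map (Measurable.aemeasurable (by fun_prop))

theorem norm_eq_one_ae_uniformCircle : ∀ᵐ u ∂uniformCircle, ‖u‖ = 1 := by
  rw [uniformCircle, ae_map_iff (Measurable.aemeasurable (by fun_prop))
    (measurableSet_eq_fun (by fun_prop) (by fun_prop))]
  refine Eventually.of_forall fun θ => ?_
  have : (2 * Real.pi * θ * Complex.I : ℂ) = ((2 * Real.pi * θ : ℝ) : ℂ) * Complex.I := by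
    push_cast; ring
  rw [this, Complex.norm_exp_ofReal_mul_I]

theorem integral_pow_mul_conj_pow_uniformCircle (k l : ℕ) :
    ∫ u, u ^ k * (starRingEnd ℂ u) ^ l ∂uniformCircle = if k = l then 1 else 0 := by
  rw [uniformCircle, integral_map (Measurable.aemeasurable (by fun_prop))
    (Measurable.aestronglyMeasurable (by fun_prop)),
    ← intervalIntegral.integral_of_le zero_le_one]
  have h : ∀ θ : ℝ, Complex.exp (2 * Real.pi * θ * Complex.I) ^ k *
      (starRingEnd ℂ (Complex.exp (2 * Real.pi * θ * Complex.I))) ^ l =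
      Complex.exp ((2 * Real.pi * Complex.I * ((k : ℂ) - l)) * θ) := by
    intro θ
    rw [← Complex.exp_conj, ← Complex.exp_nat_mul, ← Complex.exp_nat_mul, ← Complex.exp_add]
    congr 1
    simp only [map_mul, Complex.conj_I, Complex.conj_ofReal, map_ofNat]
    ring
  simp_rw [h]
  split_ifs with hkl
  · simp [hkl]
  · have hc : (2 * Real.pi * Complex.I * ((k : ℂ) - l)) ≠ 0 := by
      refine mul_ne_zero Complex.two_pi_I_ne_zero (sub_ne_zero.2 ?_)
      exact_mod_cast hkl
    rw [integral_exp_mul_complex hc]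
    have : Complex.exp ((2 * Real.pi * Complex.I * ((k : ℂ) - l)) * (1 : ℝ)) = 1 := by
      rw [Complex.exp_eq_one_iff]
      exact ⟨(k : ℤ) - l, by push_cast; ring⟩
    rw [this]; simp

/-- For `|x| ≤ 1` this is Taylor's theorem; for `|x| > 1` every term is at most a constant times
`x^4`, so the same bound persists with no restriction on `x`. -/
theorem norm_exp_sub_taylor_le (x : ℝ) :
    ‖Complex.exp (x * Complex.I) -
      (1 + x * Complex.I - x ^ 2 / 2 - x ^ 3 / 6 * Complex.I)‖ ≤ 4 * x ^ 4 := by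
  have hI3 : Complex.I ^ 3 = -Complex.I := by
    rw [pow_succ, Complex.I_sq]; ring
  have hn : ‖(x : ℂ) * Complex.I‖ = |x| := by simp
  rcases le_or_gt |x| 1 with hx | hx
  · have h := Complex.exp_bound (x := x * Complex.I) (by rwa [hn]) (n := 4) (by norm_num)
    have e : ∑ m ∈ Finset.range 4, ((x : ℂ) * Complex.I) ^ m / (m.factorial : ℂ) =
        1 + x * Complex.I - x ^ 2 / 2 - x ^ 3 / 6 * Complex.I := by
      simp [Finset.sum_range_succ, Nat.factorial, mul_pow, hI3]
      ring
    rw [e, hn] at h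
    refine h.trans ?_
    have : |x| ^ 4 = x ^ 4 := by rw [← abs_pow]; exact abs_of_nonneg (by positivity)
    rw [this]
    norm_num [Nat.factorial]
    nlinarith [sq_nonneg (x ^ 2)]
  · have h1 : ‖Complex.exp (x * Complex.I)‖ = 1 := Complex.norm_exp_ofReal_mul_I x
    have h2 : ‖(1 + x * Complex.I - x ^ 2 / 2 - x ^ 3 / 6 * Complex.I : ℂ)‖ ≤
        1 + |x| + |x| ^ 2 / 2 + |x| ^ 3 / 6 := by
      refine (norm_sub_le _ _).trans (add_le_add ((norm_sub_le _ _).trans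
        (add_le_add ((norm_add_le _ _).trans ?_) ?_)) ?_) <;> simp
    have h3 := norm_sub_le (Complex.exp (x * Complex.I))
      (1 + x * Complex.I - x ^ 2 / 2 - x ^ 3 / 6 * Complex.I)
    have : |x| ^ 4 = x ^ 4 := by rw [← abs_pow]; exact abs_of_nonneg (by positivity)
    rw [← this]
    set y := |x|
    have a1 : 1 ≤ y ^ 4 := one_le_pow₀ hx.le
    have a2 : y ≤ y ^ 4 := le_self_pow₀ hx.le (by norm_num)
    have a3 : y ^ 2 ≤ y ^ 4 := pow_le_pow_right₀ hx.le (by norm_num)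
    have a4 : y ^ 3 ≤ y ^ 4 := pow_le_pow_right₀ hx.le (by norm_num)
    linarith

theorem inner_real_complex_eq (u h : ℂ) :
    ((inner ℝ u h : ℝ) : ℂ) = (u * starRingEnd ℂ h + starRingEnd ℂ u * h) / 2 := by
  rw [Complex.inner, Complex.re_eq_add_conj]
  simp; ring

theorem integrable_bounded_uniformCircle {g : ℂ → ℂ} (hg : Continuous g) :
    Integrable g uniformCircle := by
  obtain ⟨C, hC⟩ := (isCompact_sphere (0 : ℂ) 1).exists_bound_of_continuousOn hg.continuousOn
  refine Integrable.of_bound hg.aestronglyMeasurable C ?_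
  filter_upwards [norm_eq_one_ae_uniformCircle] with u hu
  exact hC u (by simpa using hu)

/-- Writing the inner product through `u` and its conjugate, only the balanced monomials `u^k * conj
u^k` have nonzero mean. Hence the linear and cubic Taylor terms vanish, and the quadratic one gives
`‖h‖^2 / 4`. -/
theorem norm_charFun_uniformCircle_sub_le (h : ℂ) :
    ‖charFun uniformCircle h - (1 - ‖h‖ ^ 2 / 4 : ℝ)‖ ≤ 4 * ‖h‖ ^ 4 := by
  have hmom : ∫ u, (1 + (inner ℝ u h : ℝ) * Complex.I - (inner ℝ u h : ℝ) ^ 2 / 2 -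
      (inner ℝ u h : ℝ) ^ 3 / 6 * Complex.I : ℂ) ∂uniformCircle = (1 - ‖h‖ ^ 2 / 4 : ℝ) := by
    have e : ∀ u : ℂ, (1 + (inner ℝ u h : ℝ) * Complex.I - (inner ℝ u h : ℝ) ^ 2 / 2 -
        (inner ℝ u h : ℝ) ^ 3 / 6 * Complex.I : ℂ) =
        1 * (u ^ 0 * (starRingEnd ℂ u) ^ 0)
        + (starRingEnd ℂ h / 2 * Complex.I) * (u ^ 1 * (starRingEnd ℂ u) ^ 0)
        + (h / 2 * Complex.I) * (u ^ 0 * (starRingEnd ℂ u) ^ 1)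
        + (-(starRingEnd ℂ h) ^ 2 / 8) * (u ^ 2 * (starRingEnd ℂ u) ^ 0)
        + (-(h * starRingEnd ℂ h) / 4) * (u ^ 1 * (starRingEnd ℂ u) ^ 1)
        + (-h ^ 2 / 8) * (u ^ 0 * (starRingEnd ℂ u) ^ 2)
        + (-(starRingEnd ℂ h) ^ 3 / 48 * Complex.I) * (u ^ 3 * (starRingEnd ℂ u) ^ 0)
        + (-(starRingEnd ℂ h) ^ 2 * h / 16 * Complex.I) * (u ^ 2 * (starRingEnd ℂ u) ^ 1)
        + (-(starRingEnd ℂ h) * h ^ 2 / 16 * Complex.I) * (u ^ 1 * (starRingEnd ℂ u) ^ 2)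
        + (-h ^ 3 / 48 * Complex.I) * (u ^ 0 * (starRingEnd ℂ u) ^ 3) := by
      intro u
      rw [inner_real_complex_eq]
      ring
    have hi : ∀ (c : ℂ) (k l : ℕ), ∫ u : ℂ, c * (u ^ k * (starRingEnd ℂ u) ^ l) ∂uniformCircle =
        c * if k = l then 1 else 0 := fun c k l => by
      rw [integral_const_mul, integral_pow_mul_conj_pow_uniformCircle]
    simp_rw [e]
    rw [integral_add, integral_add, integral_add, integral_add, integral_add, integral_add,
      integral_add, integral_add, integral_add]
    rotate_left
    any_goals exact integrable_bounded_uniformCircle (by fun_prop)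
    simp_rw [hi]
    norm_num
    have := Complex.mul_conj' h
    rw [this]; ring
  rw [charFun_apply, ← hmom, ← integral_sub]
  · refine (norm_integral_le_of_norm_le_const (C := 4 * ‖h‖ ^ 4) ?_).trans (by simp)
    filter_upwards [norm_eq_one_ae_uniformCircle] with u hu
    refine (norm_exp_sub_taylor_le _).trans ?_
    have h1 : |inner ℝ u h| ≤ ‖h‖ := by simpa [hu] using abs_real_inner_le_norm u h
    have : (inner ℝ u h) ^ 4 ≤ ‖h‖ ^ 4 := by
      calc (inner ℝ u h) ^ 4 = |inner ℝ u h| ^ 4 := by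
            rw [← abs_pow]; exact (abs_of_nonneg (by positivity)).symm
        _ ≤ _ := by gcongr
    linarith
  · exact integrable_bounded_uniformCircle (by fun_prop)
  · exact integrable_bounded_uniformCircle (by fun_prop)

/-- The factor `exp(‖h‖^2 / 4)` compensates the characteristic function up to fourth order; this is
the one-step estimate of the martingale argument. The constant 5 is the 4 of the Taylor bound plus 1
for the error of `e^s (1 - s)`. -/
theorem norm_exp_mul_charFun_uniformCircle_sub_one_le (h : ℂ) :
    ‖(Real.exp (‖h‖ ^ 2 / 4) : ℂ) * charFun uniformCircle h - 1‖ ≤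
      5 * Real.exp (‖h‖ ^ 2 / 4) * ‖h‖ ^ 4 := by
  set s : ℝ := ‖h‖ ^ 2 / 4 with hs
  have hs0 : 0 ≤ s := by positivity
  have h1 : |Real.exp s * (1 - s) - 1| ≤ Real.exp s * s ^ 2 := by
    have hp : 0 < Real.exp s := Real.exp_pos s
    have e1 : 1 - s ≤ Real.exp (-s) := by linarith [Real.add_one_le_exp (-s)]
    have e2 : 1 + s ≤ Real.exp s := by linarith [Real.add_one_le_exp s]
    have e3 : Real.exp s * Real.exp (-s) = 1 := by rw [← Real.exp_add]; simp
    have e4 : (1 + s) * Real.exp (-s) ≤ 1 :=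
      (mul_le_mul_of_nonneg_right e2 (Real.exp_pos _).le).trans e3.le
    -- Follows from `(1 + s)(1 - s + s^2) = 1 + s^3 ≥ 1`.
    have e5 : Real.exp (-s) ≤ 1 - s + s ^ 2 := by
      have : (1 + s) * Real.exp (-s) ≤ (1 + s) * (1 - s + s ^ 2) := by
        nlinarith [pow_nonneg hs0 3]
      exact le_of_mul_le_mul_left this (by linarith)
    rw [abs_le]
    constructor <;> nlinarith
  have e : (Real.exp s : ℂ) * charFun uniformCircle h - 1 =
      (Real.exp s : ℂ) * (charFun uniformCircle h - (1 - s : ℝ)) +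
        ((Real.exp s * (1 - s) - 1 : ℝ) : ℂ) := by
    push_cast; ring
  rw [e]
  refine (norm_add_le _ _).trans ?_
  rw [norm_mul, Complex.norm_real, Complex.norm_real, Real.norm_eq_abs, Real.norm_eq_abs,
    abs_of_pos (Real.exp_pos s)]
  have h2 := norm_charFun_uniformCircle_sub_le h
  rw [← hs] at h2
  have h3 : s ^ 2 ≤ ‖h‖ ^ 4 := by rw [hs]; nlinarith [pow_nonneg (norm_nonneg h) 4]
  have hp : 0 < Real.exp s := Real.exp_pos s
  nlinarith

/-! ### A central limit theorem for sums driven by independent uniform phases -/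

theorem inner_mul_left_complex (u w t : ℂ) :
    (inner ℝ (u * w) t : ℝ) = inner ℝ u (starRingEnd ℂ w * t) := by
  simp only [Complex.inner, map_mul]; ring_nf

/-- Conditioning on `m` freezes `A` and `w`, and integrating out `ξ` alone replaces the last
exponential by the characteristic function of the circle at `conj w * t`. With its compensator this
is `1 + O(‖t‖^4 ‖w‖^4)`. -/
theorem norm_integral_mul_exp_inner_sub_le {Ω : Type*} {m mΩ : MeasurableSpace Ω} {μ : Measure Ω}
    [IsProbabilityMeasure μ] (hm : m ≤ mΩ) {ξ : Ω → ℂ} (hξ : Measurable ξ)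
    (hind : Indep (MeasurableSpace.comap ξ inferInstance) m μ) (hlaw : μ.map ξ = uniformCircle)
    {A w : Ω → ℂ} (hA : Measurable[m] A) (hw : Measurable[m] w) (t : ℂ) {B : ℝ}
    (hB : ∀ ω, ‖A ω‖ * Real.exp (‖t‖ ^ 2 * ‖w ω‖ ^ 2 / 4) ≤ B)
    (hw4 : Integrable (fun ω => ‖w ω‖ ^ 4) μ) :
    ‖∫ ω, A ω * Real.exp (‖t‖ ^ 2 * ‖w ω‖ ^ 2 / 4) *
        Complex.exp ((inner ℝ (ξ ω * w ω) t : ℝ) * Complex.I) ∂μ - ∫ ω, A ω ∂μ‖ ≤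
      5 * B * ‖t‖ ^ 4 * ∫ ω, ‖w ω‖ ^ 4 ∂μ := by
  have hA' : Measurable A := hA.mono hm le_rfl
  have hw' : Measurable w := hw.mono hm le_rfl
  have hpair : IndepFun ξ (fun ω => (A ω, w ω)) μ := by
    rw [IndepFun_iff_Indep]
    exact indep_of_indep_of_le_right hind (hA.prodMk hw).comap_le
  set g : ℂ × (ℂ × ℂ) → ℂ := fun y => y.2.1 * Real.exp (‖t‖ ^ 2 * ‖y.2.2‖ ^ 2 / 4) *
    Complex.exp ((inner ℝ (y.1 * y.2.2) t : ℝ) * Complex.I) with hg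
  have hgm : Measurable g := by fun_prop
  have hbd : ∀ ω, ‖g (ξ ω, (A ω, w ω))‖ ≤ B := fun ω => by
    simp only [hg, norm_mul, Complex.norm_exp_ofReal_mul_I, mul_one, Complex.norm_real,
      Real.norm_eq_abs, Real.abs_exp]
    exact hB ω
  have hbd1 : ∀ ω, ‖A ω‖ ≤ B := fun ω => le_trans
    (le_mul_of_one_le_right (norm_nonneg _) (Real.one_le_exp (by positivity))) (hB ω)
  have hmap := hpair.map_prod_eq_prod_map_map hξ.aemeasurable (hA'.prodMk hw').aemeasurable
  have hgi : Integrable g (μ.map (fun ω => (ξ ω, (A ω, w ω)))) :=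
    (integrable_map_measure hgm.aestronglyMeasurable (by fun_prop)).2
      (Integrable.of_bound (hgm.comp (by fun_prop)).aestronglyMeasurable B
        (Eventually.of_forall hbd))
  have key : ∫ ω, g (ξ ω, (A ω, w ω)) ∂μ = ∫ ω, A ω *
      (Real.exp (‖starRingEnd ℂ (w ω) * t‖ ^ 2 / 4) *
        charFun uniformCircle (starRingEnd ℂ (w ω) * t)) ∂μ := by
    rw [← integral_map (φ := fun ω => (ξ ω, (A ω, w ω))) (by fun_prop)
      hgm.aestronglyMeasurable, hmap, integral_prod_symm _ (by rwa [← hmap]), hlaw,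
      integral_map (by fun_prop)]
    · refine integral_congr_ae (Eventually.of_forall fun ω => ?_)
      simp only [hg]
      rw [integral_const_mul, charFun_apply]
      simp_rw [inner_mul_left_complex]
      rw [norm_mul, mul_pow, RCLike.norm_conj, mul_comm (‖t‖ ^ 2)]
      ring
    · have : StronglyMeasurable fun y : (ℂ × ℂ) × ℂ => g (y.2, y.1) :=
        (hgm.comp (by fun_prop)).stronglyMeasurable
      exact this.integral_prod_right.aestronglyMeasurable
  have hAi : Integrable A μ :=
    Integrable.of_bound hA'.aestronglyMeasurable B (Eventually.of_forall hbd1)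
  have hcm : Measurable (charFun uniformCircle) := measurable_charFun
  have hi2 : Integrable (fun ω => A ω * (Real.exp (‖starRingEnd ℂ (w ω) * t‖ ^ 2 / 4) *
        charFun uniformCircle (starRingEnd ℂ (w ω) * t))) μ := by
    refine Integrable.of_bound (Measurable.aestronglyMeasurable ?_) B
      (Eventually.of_forall fun ω => ?_)
    · have : Measurable fun ω => charFun uniformCircle (starRingEnd ℂ (w ω) * t) :=
        hcm.comp (by fun_prop)
      fun_prop
    · rw [norm_mul, norm_mul, Complex.norm_real, Real.norm_eq_abs, Real.abs_exp, ← mul_assoc]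
      refine le_trans (mul_le_of_le_one_right (by positivity) (norm_charFun_le_one _)) ?_
      rw [norm_mul, mul_pow, RCLike.norm_conj, mul_comm (‖w ω‖ ^ 2)]
      exact hB ω
  change ‖∫ ω, g (ξ ω, (A ω, w ω)) ∂μ - _‖ ≤ _
  rw [key, ← integral_sub hi2 hAi, ← integral_const_mul]
  refine norm_integral_le_of_norm_le (hw4.const_mul _) (Eventually.of_forall fun ω => ?_)
  rw [show ∀ a b : ℂ, a * b - a = a * (b - 1) by intros; ring, norm_mul]
  have h := norm_exp_mul_charFun_uniformCircle_sub_one_le (starRingEnd ℂ (w ω) * t)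
  have e1 : ‖starRingEnd ℂ (w ω) * t‖ ^ 2 = ‖t‖ ^ 2 * ‖w ω‖ ^ 2 := by
    rw [norm_mul, mul_pow, RCLike.norm_conj, mul_comm]
  have e2 : ‖starRingEnd ℂ (w ω) * t‖ ^ 4 = ‖t‖ ^ 4 * ‖w ω‖ ^ 4 := by
    rw [norm_mul, mul_pow, RCLike.norm_conj, mul_comm]
  calc _ ≤ ‖A ω‖ * _ := mul_le_mul_of_nonneg_left h (norm_nonneg _)
    _ = 5 * (‖A ω‖ * Real.exp (‖t‖ ^ 2 * ‖w ω‖ ^ 2 / 4)) * ‖t‖ ^ 4 * ‖w ω‖ ^ 4 := by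
      rw [e1, e2]; ring
    _ ≤ _ := by gcongr; exact hB ω

/-- The σ-algebra generated by the variables `ξ i` with `i < j`. -/
noncomputable abbrev pastSigma {ι Ω : Type*} [LT ι] (ξ : ι → Ω → ℂ) (j : ι) : MeasurableSpace Ω :=
  ⨆ i ∈ {i | i < j}, MeasurableSpace.comap (ξ i) inferInstance

theorem measurable_pastSigma {ι Ω : Type*} [LT ι] {ξ : ι → Ω → ℂ} {i j : ι} (h : i < j) :
    Measurable[pastSigma ξ j] (ξ i) :=
  (comap_measurable (ξ i)).mono
    (le_iSup₂ (f := fun k (_ : k ∈ {k | k < j}) => MeasurableSpace.comap (ξ k) inferInstance) i h)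
    le_rfl

theorem pastSigma_mono {ι Ω : Type*} [Preorder ι] {ξ : ι → Ω → ℂ} {i j : ι} (h : i ≤ j) :
    pastSigma ξ i ≤ pastSigma ξ j :=
  biSup_mono fun _ hk => lt_of_lt_of_le hk h

theorem pastSigma_le {ι Ω : Type*} [LT ι] [mΩ : MeasurableSpace Ω] {ξ : ι → Ω → ℂ}
    (hξ : ∀ i, Measurable (ξ i)) (j : ι) : pastSigma ξ j ≤ mΩ :=
  iSup₂_le fun i _ => (hξ i).comap_le

theorem indep_comap_pastSigma {ι Ω : Type*} [Preorder ι] [MeasurableSpace Ω] {μ : Measure Ω}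
    {ξ : ι → Ω → ℂ} (hξ : ∀ i, Measurable (ξ i)) (hind : iIndepFun ξ μ) (j : ι) :
    Indep (MeasurableSpace.comap (ξ j) inferInstance) (pastSigma ξ j) μ := by
  have h := indep_iSup_of_disjoint (fun i => (hξ i).comap_le) hind.iIndep
    (S := {j}) (T := {i | i < j}) (by simp)
  rw [iSup_singleton] at h
  exact h

section PhaseCLT

variable {ι Ω : Type*} [LinearOrder ι] [mΩ : MeasurableSpace Ω] {μ : Measure Ω}
  [IsProbabilityMeasure μ] {ξ : ι → Ω → ℂ}

/-- The compensated exponential is almost a martingale of mean 1: the largest index is removed by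
conditioning on its past, at the cost of one fourth moment. The bound 2 on the total variance keeps
the remaining product below `exp(‖t‖^2 / 2)`. -/
theorem norm_integral_exp_sum_sub_one_le
    (hξ : ∀ i, Measurable (ξ i)) (hind : iIndepFun ξ μ) (hlaw : ∀ i, μ.map (ξ i) = uniformCircle)
    (s : Finset ι) (w : ι → Ω → ℂ) (hw : ∀ j ∈ s, Measurable[pastSigma ξ j] (w j))
    (hw2 : ∀ ω, ∑ j ∈ s, ‖w j ω‖ ^ 2 ≤ 2)
    (hw4 : ∀ j ∈ s, Integrable (fun ω => ‖w j ω‖ ^ 4) μ) (t : ℂ) :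
    ‖∫ ω, Complex.exp (∑ j ∈ s, ((‖t‖ ^ 2 * ‖w j ω‖ ^ 2 / 4 : ℝ) +
        (inner ℝ (ξ j ω * w j ω) t : ℝ) * Complex.I)) ∂μ - 1‖ ≤
      5 * Real.exp (‖t‖ ^ 2 / 2) * ‖t‖ ^ 4 * ∑ j ∈ s, ∫ ω, ‖w j ω‖ ^ 4 ∂μ := by
  induction s using Finset.induction_on_max with
  | empty => simp
  | insert a s ha ih =>
    have has : a ∉ s := fun h => lt_irrefl a (ha a h)
    have hsum : ∀ ω, ∑ j ∈ s, ‖w j ω‖ ^ 2 + ‖w a ω‖ ^ 2 ≤ 2 := fun ω => by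
      have := hw2 ω
      rw [Finset.sum_insert has] at this; linarith
    have ih' := ih (fun j hj => hw j (Finset.mem_insert_of_mem hj))
      (fun ω => le_trans (by have := sq_nonneg ‖w a ω‖; linarith) (hsum ω))
      (fun j hj => hw4 j (Finset.mem_insert_of_mem hj))
    set A : Ω → ℂ := fun ω => Complex.exp (∑ j ∈ s, ((‖t‖ ^ 2 * ‖w j ω‖ ^ 2 / 4 : ℝ) +
        (inner ℝ (ξ j ω * w j ω) t : ℝ) * Complex.I)) with hA
    have hAm : Measurable[pastSigma ξ a] A := by
      refine Complex.measurable_exp.comp (Finset.measurable_fun_sum s fun j hj => ?_)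
      have h1 : Measurable[pastSigma ξ a] (w j) :=
        (hw j (Finset.mem_insert_of_mem hj)).mono (pastSigma_mono (ha j hj).le) le_rfl
      have h2 : Measurable[pastSigma ξ a] (ξ j) := measurable_pastSigma (ha j hj)
      fun_prop
    have hB : ∀ ω, ‖A ω‖ * Real.exp (‖t‖ ^ 2 * ‖w a ω‖ ^ 2 / 4) ≤ Real.exp (‖t‖ ^ 2 / 2) := by
      intro ω
      rw [hA, Complex.norm_exp, ← Real.exp_add]
      gcongr
      have : (∑ j ∈ s, ((‖t‖ ^ 2 * ‖w j ω‖ ^ 2 / 4 : ℝ) +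
          (inner ℝ (ξ j ω * w j ω) t : ℝ) * Complex.I : ℂ)).re =
          ‖t‖ ^ 2 / 4 * ∑ j ∈ s, ‖w j ω‖ ^ 2 := by
        rw [Complex.re_sum, Finset.mul_sum]
        refine Finset.sum_congr rfl fun j _ => ?_
        rw [Complex.add_re, Complex.ofReal_re, Complex.re_ofReal_mul, Complex.I_re]
        ring
      rw [this]
      nlinarith [hsum ω, sq_nonneg ‖t‖]
    have hstep := norm_integral_mul_exp_inner_sub_le (pastSigma_le hξ a) (hξ a)
      (indep_comap_pastSigma hξ hind a) (hlaw a) hAm (hw a (Finset.mem_insert_self _ _)) t hB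
      (hw4 a (Finset.mem_insert_self _ _))
    have e : ∀ ω, Complex.exp (∑ j ∈ insert a s, ((‖t‖ ^ 2 * ‖w j ω‖ ^ 2 / 4 : ℝ) +
        (inner ℝ (ξ j ω * w j ω) t : ℝ) * Complex.I)) =
        A ω * Real.exp (‖t‖ ^ 2 * ‖w a ω‖ ^ 2 / 4) *
          Complex.exp ((inner ℝ (ξ a ω * w a ω) t : ℝ) * Complex.I) := by
      intro ω
      rw [Finset.sum_insert has, add_comm, Complex.exp_add, Complex.exp_add, Complex.ofReal_exp,
        mul_assoc]
    simp_rw [e]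
    rw [Finset.sum_insert has, mul_add]
    calc _ = ‖(_ - ∫ ω, A ω ∂μ) + (∫ ω, A ω ∂μ - 1)‖ := by rw [sub_add_sub_cancel]
      _ ≤ _ := (norm_add_le _ _).trans (add_le_add hstep ih')

/-- All surviving indices lie below the largest survivor, whose partial sum is at most `c`. -/
theorem sum_truncated_le {v : ι → ℝ} (hv : ∀ i, 0 ≤ v i) (s : Finset ι) {c : ℝ} (hc : 0 ≤ c) :
    ∑ i ∈ s, (if ∑ j ∈ s with j ≤ i, v j ≤ c then v i else 0) ≤ c := by
  rw [← Finset.sum_filter]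
  rcases (s.filter fun i => ∑ j ∈ s with j ≤ i, v j ≤ c).eq_empty_or_nonempty with h | h
  · simp [h, hc]
  · obtain ⟨m, hm, hmax⟩ := Finset.exists_max_image _ id h
    refine le_trans (Finset.sum_le_sum_of_subset_of_nonneg (fun i hi => ?_)
      fun i _ _ => hv i) (Finset.mem_filter.1 hm).2
    exact Finset.mem_filter.2 ⟨(Finset.mem_filter.1 hi).1, hmax i hi⟩

/-- A quantitative central limit theorem for `∑ ξ j * W j`, where the `ξ j` are independent and
uniform on the unit circle and `W j` depends only on the `ξ i` with `i < j`. -/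
theorem norm_integral_exp_inner_sub_gaussian_le
    (hξ : ∀ i, Measurable (ξ i)) (hind : iIndepFun ξ μ) (hlaw : ∀ i, μ.map (ξ i) = uniformCircle)
    (s : Finset ι) (W : ι → Ω → ℂ) (hW : ∀ j ∈ s, Measurable[pastSigma ξ j] (W j))
    (hW2 : ∀ j ∈ s, Integrable (fun ω => ‖W j ω‖ ^ 2) μ)
    (hW4 : ∀ j ∈ s, Integrable (fun ω => ‖W j ω‖ ^ 4) μ) (t : ℂ) :
    ‖∫ ω, Complex.exp ((inner ℝ (∑ j ∈ s, ξ j ω * W j ω) t : ℝ) * Complex.I) ∂μ -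
        Real.exp (-(‖t‖ ^ 2 / 4))‖ ≤
      5 * Real.exp (‖t‖ ^ 2 / 2) * ‖t‖ ^ 4 * ∑ j ∈ s, ∫ ω, ‖W j ω‖ ^ 4 ∂μ +
      (2 + Real.exp (‖t‖ ^ 2 / 2) * ‖t‖ ^ 2) * ∫ ω, |∑ j ∈ s, ‖W j ω‖ ^ 2 - 1| ∂μ := by
  have hWm : ∀ j ∈ s, Measurable (W j) := fun j hj => (hW j hj).mono (pastSigma_le hξ j) le_rfl
  -- Steps are switched off once the running variance exceeds 2. The running sum may include the
  -- index `j` itself and remain predictable, because `W j` depends only on the past of `j`.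
  set V : ι → Ω → ℝ := fun j ω => ∑ i ∈ s with i ≤ j, ‖W i ω‖ ^ 2 with hV
  set w : ι → Ω → ℂ := fun j ω => if V j ω ≤ 2 then W j ω else 0 with hw
  have hVm : ∀ j ∈ s, Measurable[pastSigma ξ j] (V j) := fun j hj => by
    refine Finset.measurable_fun_sum _ fun i hi => ?_
    have h1 : Measurable[pastSigma ξ j] (W i) :=
      (hW i (Finset.mem_filter.1 hi).1).mono (pastSigma_mono (Finset.mem_filter.1 hi).2) le_rfl
    have h2 : Measurable fun z : ℂ => ‖z‖ ^ 2 := by fun_prop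
    exact h2.comp h1
  have hwm : ∀ j ∈ s, Measurable[pastSigma ξ j] (w j) := fun j hj =>
    Measurable.ite (measurableSet_le (hVm j hj) measurable_const) (hW j hj) measurable_const
  have hwle : ∀ j ω, ‖w j ω‖ ≤ ‖W j ω‖ := fun j ω => by
    simp only [hw]; split_ifs <;> simp
  have hwm' : ∀ j ∈ s, Measurable (w j) := fun j hj => (hwm j hj).mono (pastSigma_le hξ j) le_rfl
  have hw4 : ∀ j ∈ s, Integrable (fun ω => ‖w j ω‖ ^ 4) μ := fun j hj => by
    refine (hW4 j hj).mono' (((hwm' j hj).norm.pow_const 4).aestronglyMeasurable)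
      (Eventually.of_forall fun ω => ?_)
    rw [Real.norm_eq_abs, abs_of_nonneg (by positivity)]
    gcongr; exact hwle j ω
  set V' : Ω → ℝ := fun ω => ∑ j ∈ s, ‖w j ω‖ ^ 2 with hV'
  have hV'2 : ∀ ω, V' ω ≤ 2 := fun ω => by
    have h := sum_truncated_le (v := fun j => ‖W j ω‖ ^ 2) (fun _ => by positivity) s
      (c := 2) (by norm_num)
    refine le_trans (Finset.sum_le_sum fun j _ => ?_) h
    simp only [hw, hV]; split_ifs <;> simp
  have hV'0 : ∀ ω, 0 ≤ V' ω := fun ω => Finset.sum_nonneg fun _ _ => by positivity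
  have hV'm : Measurable V' :=
    Finset.measurable_fun_sum _ fun j hj => (hwm' j hj).norm.pow_const 2
  set T : Ω → ℝ := fun ω => ∑ j ∈ s, ‖W j ω‖ ^ 2 with hT
  have hTi : Integrable (fun ω => |T ω - 1|) μ :=
    ((integrable_finsetSum s hW2).sub (integrable_const 1)).abs
  -- Truncation changes nothing unless `T > 2`. In that case `|T - 1| ≥ 1`, so every cost of
  -- truncating is absorbed by the mean of `|T - 1|`.
  have heq : ∀ ω, T ω ≤ 2 → ∀ j ∈ s, w j ω = W j ω := fun ω hω j hj => by
    refine if_pos (le_trans ?_ hω)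
    exact Finset.sum_le_sum_of_subset_of_nonneg (Finset.filter_subset _ _)
      fun _ _ _ => by positivity
  have hV'1 : ∀ ω, |V' ω - 1| ≤ |T ω - 1| := fun ω => by
    rcases le_or_gt (T ω) 2 with h | h
    · rw [hV', hT]
      simp only
      rw [Finset.sum_congr rfl fun j hj => by rw [heq ω h j hj]]
    · rw [abs_of_pos (by linarith : 0 < T ω - 1), abs_le]
      constructor <;> linarith [hV'2 ω, hV'0 ω]
  have h1 := norm_integral_exp_sum_sub_one_le hξ hind hlaw s w hwm hV'2 hw4 t
  set c : ℝ := ‖t‖ ^ 2 / 4 with hc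
  have hc0 : 0 ≤ c := by positivity
  set S : Ω → ℂ := fun ω => ∑ j ∈ s, ξ j ω * W j ω with hS
  set S' : Ω → ℂ := fun ω => ∑ j ∈ s, ξ j ω * w j ω with hS'
  have hSm : Measurable S := Finset.measurable_fun_sum _ fun j hj => (hξ j).mul (hWm j hj)
  have hS'm : Measurable S' := Finset.measurable_fun_sum _ fun j hj => (hξ j).mul (hwm' j hj)
  have hexp : ∀ ω, Complex.exp (∑ j ∈ s, ((‖t‖ ^ 2 * ‖w j ω‖ ^ 2 / 4 : ℝ) +
        (inner ℝ (ξ j ω * w j ω) t : ℝ) * Complex.I)) =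
      Real.exp (c * V' ω) * Complex.exp ((inner ℝ (S' ω) t : ℝ) * Complex.I) := by
    intro ω
    rw [Finset.sum_add_distrib, Complex.exp_add, hS', sum_inner, ← Finset.sum_mul,
      Complex.ofReal_sum, ← Complex.ofReal_sum, ← Complex.ofReal_exp]
    congr 4
    rw [hc, hV', Finset.mul_sum]
    exact Finset.sum_congr rfl fun _ _ => by ring
  simp_rw [hexp] at h1
  have hE1 : ∀ ω, ‖Complex.exp ((inner ℝ (S ω) t : ℝ) * Complex.I)‖ ≤ 1 := fun ω =>
    (Complex.norm_exp_ofReal_mul_I _).le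
  have hE2 : ∀ ω, ‖Complex.exp ((inner ℝ (S' ω) t : ℝ) * Complex.I)‖ ≤ 1 := fun ω =>
    (Complex.norm_exp_ofReal_mul_I _).le
  have hI1 : Integrable (fun ω => Complex.exp ((inner ℝ (S ω) t : ℝ) * Complex.I)) μ :=
    Integrable.of_bound (by fun_prop) 1 (Eventually.of_forall hE1)
  have hI2 : Integrable (fun ω => Complex.exp ((inner ℝ (S' ω) t : ℝ) * Complex.I)) μ :=
    Integrable.of_bound (by fun_prop) 1 (Eventually.of_forall hE2)
  have hI3 : Integrable (fun ω => (Real.exp (c * V' ω) : ℂ) *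
      Complex.exp ((inner ℝ (S' ω) t : ℝ) * Complex.I)) μ := by
    refine Integrable.of_bound (by fun_prop) (Real.exp (c * 2)) (Eventually.of_forall fun ω => ?_)
    rw [norm_mul, Complex.norm_exp_ofReal_mul_I, mul_one, Complex.norm_real, Real.norm_eq_abs,
      Real.abs_exp]
    gcongr; exact hV'2 ω
  have hA : ‖∫ ω, Complex.exp ((inner ℝ (S ω) t : ℝ) * Complex.I) ∂μ -
      ∫ ω, Complex.exp ((inner ℝ (S' ω) t : ℝ) * Complex.I) ∂μ‖ ≤ 2 * ∫ ω, |T ω - 1| ∂μ := by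
    rw [← integral_sub hI1 hI2, ← integral_const_mul]
    refine norm_integral_le_of_norm_le (hTi.const_mul _) (Eventually.of_forall fun ω => ?_)
    rcases le_or_gt (T ω) 2 with h | h
    · have : S' ω = S ω := Finset.sum_congr rfl fun j hj => by rw [heq ω h j hj]
      rw [this, sub_self, norm_zero]
      positivity
    · have h3 := norm_sub_le (Complex.exp ((inner ℝ (S ω) t : ℝ) * Complex.I))
        (Complex.exp ((inner ℝ (S' ω) t : ℝ) * Complex.I))
      have h4 : 1 ≤ |T ω - 1| := le_trans (by linarith) (le_abs_self _)
      linarith [hE1 ω, hE2 ω]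
  -- This compares the random compensator `exp(c V')` with its limiting value `exp c`.
  have hmvt : ∀ y : ℝ, y ≤ 2 → |Real.exp (c * (y - 1)) - 1| ≤
      4 * c * Real.exp (c * 2) * |y - 1| := by
    intro y hy
    have hx : c * (y - 1) ≤ c * 2 := by nlinarith
    have h1 := Real.add_one_le_exp (c * (y - 1))
    have h2 := Real.add_one_le_exp (-(c * (y - 1)))
    have h3 : Real.exp (c * (y - 1)) * Real.exp (-(c * (y - 1))) = 1 := by
      rw [← Real.exp_add]; simp
    have hp := Real.exp_pos (c * (y - 1))
    have h4 : Real.exp (c * (y - 1)) ≤ Real.exp (c * 2) := Real.exp_le_exp.2 hx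
    have h5 : 1 ≤ Real.exp (c * 2) := Real.one_le_exp (by linarith)
    rcases le_total 1 y with h | h
    · have hx0 : 0 ≤ c * (y - 1) := mul_nonneg hc0 (by linarith)
      rw [abs_of_nonneg (by linarith), abs_of_nonneg (by linarith : 0 ≤ y - 1)]
      nlinarith
    · have hx0 : 0 ≤ c * (1 - y) := mul_nonneg hc0 (by linarith)
      rw [abs_of_nonpos (by nlinarith [Real.exp_le_one_iff.2 (by linarith : c * (y - 1) ≤ 0)]),
        abs_of_nonpos (by linarith : y - 1 ≤ 0)]
      nlinarith
  have hBd : ‖∫ ω, Complex.exp ((inner ℝ (S' ω) t : ℝ) * Complex.I) ∂μ - Real.exp (-c) *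
      ∫ ω, (Real.exp (c * V' ω) : ℂ) * Complex.exp ((inner ℝ (S' ω) t : ℝ) * Complex.I) ∂μ‖ ≤
      (4 * c * Real.exp (c * 2)) * ∫ ω, |T ω - 1| ∂μ := by
    rw [← integral_const_mul, ← integral_sub hI2 (hI3.const_mul _), ← integral_const_mul]
    refine norm_integral_le_of_norm_le (hTi.const_mul _) (Eventually.of_forall fun ω => ?_)
    have e : Complex.exp ((inner ℝ (S' ω) t : ℝ) * Complex.I) - (Real.exp (-c) : ℂ) *
        ((Real.exp (c * V' ω) : ℂ) * Complex.exp ((inner ℝ (S' ω) t : ℝ) * Complex.I)) =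
        -((Real.exp (c * (V' ω - 1)) - 1 : ℝ) : ℂ) *
          Complex.exp ((inner ℝ (S' ω) t : ℝ) * Complex.I) := by
      have : Real.exp (c * (V' ω - 1)) = Real.exp (-c) * Real.exp (c * V' ω) := by
        rw [← Real.exp_add]; ring_nf
      rw [this]; push_cast; ring
    rw [e, norm_mul, Complex.norm_exp_ofReal_mul_I, mul_one, norm_neg, Complex.norm_real,
      Real.norm_eq_abs]
    refine (hmvt _ (hV'2 ω)).trans ?_
    gcongr 4 * c * Real.exp (c * 2) * ?_
    exact hV'1 ω
  have hCd : ‖Real.exp (-c) * ∫ ω, (Real.exp (c * V' ω) : ℂ) *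
      Complex.exp ((inner ℝ (S' ω) t : ℝ) * Complex.I) ∂μ - (Real.exp (-c) : ℂ)‖ ≤
      5 * Real.exp (‖t‖ ^ 2 / 2) * ‖t‖ ^ 4 * ∑ j ∈ s, ∫ ω, ‖W j ω‖ ^ 4 ∂μ := by
    rw [show ∀ a b : ℂ, a * b - a = a * (b - 1) by intros; ring, norm_mul, Complex.norm_real,
      Real.norm_eq_abs, Real.abs_exp]
    refine le_trans (mul_le_of_le_one_left (norm_nonneg _) ?_) (h1.trans ?_)
    · exact Real.exp_le_one_iff.2 (by linarith)
    · gcongr with j hj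
      · exact hw4 j hj
      · exact hW4 j hj
      · intro ω; simp only; gcongr; exact hwle j ω
  have e1 : Real.exp (‖t‖ ^ 2 / 2) * ‖t‖ ^ 2 = 4 * c * Real.exp (c * 2) := by
    rw [hc]; ring_nf
  rw [e1]
  have := norm_add₃_le (a := ∫ ω, Complex.exp ((inner ℝ (S ω) t : ℝ) * Complex.I) ∂μ -
      ∫ ω, Complex.exp ((inner ℝ (S' ω) t : ℝ) * Complex.I) ∂μ)
    (b := ∫ ω, Complex.exp ((inner ℝ (S' ω) t : ℝ) * Complex.I) ∂μ - Real.exp (-c) *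
      ∫ ω, (Real.exp (c * V' ω) : ℂ) * Complex.exp ((inner ℝ (S' ω) t : ℝ) * Complex.I) ∂μ)
    (c := Real.exp (-c) * ∫ ω, (Real.exp (c * V' ω) : ℂ) *
      Complex.exp ((inner ℝ (S' ω) t : ℝ) * Complex.I) ∂μ - (Real.exp (-c) : ℂ))
  rw [sub_add_sub_cancel, sub_add_sub_cancel] at this
  linarith

end PhaseCLT

/-! ### Monic polynomials over a finite field -/

section Monic

variable {F : Type*} [Field F]

theorem MonicIrred.ne_zero (P : MonicIrred F) : P.1 ≠ 0 := P.2.1.ne_zero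

theorem MonicIrred.natDegree_pos (P : MonicIrred F) : 0 < P.1.natDegree := P.2.2.natDegree_pos

/-- The exponent of the prime `P` in the factorization of `a`. -/
noncomputable def expo (a : F[X]) (P : MonicIrred F) : ℕ := multiplicity P.1 a

theorem finiteMultiplicity_monicIrred (P : MonicIrred F) {a : F[X]} (ha : a ≠ 0) :
    FiniteMultiplicity P.1 a := FiniteMultiplicity.of_prime_left P.2.2.prime ha

theorem expo_mul {a b : F[X]} (ha : a ≠ 0) (hb : b ≠ 0) (P : MonicIrred F) :
    expo (a * b) P = expo a P + expo b P :=
  multiplicity_mul P.2.2.prime (finiteMultiplicity_monicIrred P (mul_ne_zero ha hb))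

theorem expo_pos_iff {a : F[X]} (P : MonicIrred F) : 0 < expo a P ↔ P.1 ∣ a :=
  dvd_iff_multiplicity_pos

theorem expo_eq_zero_iff {a : F[X]} (P : MonicIrred F) : expo a P = 0 ↔ ¬ P.1 ∣ a := by
  rw [← expo_pos_iff]; omega

theorem coprime_monicIrred {P Q : MonicIrred F} (h : P ≠ Q) : IsCoprime P.1 Q.1 := by
  refine (P.2.2.coprime_iff_not_dvd).2 fun hd => h (Subtype.ext ?_)
  exact eq_of_monic_of_associated P.2.1 Q.2.1 (P.2.2.associated_of_dvd Q.2.2 hd)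

theorem exists_monicIrred_dvd {a : F[X]} (ha : ¬ IsUnit a) : ∃ P : MonicIrred F, P.1 ∣ a := by
  obtain ⟨p, hpm, hp, hd⟩ := exists_monic_irreducible_factor a ha
  exact ⟨⟨p, hpm, hp⟩, hd⟩

/-- The prime powers are pairwise coprime, so their product divides `a`. A nontrivial quotient would
have a prime factor, which would raise an exponent beyond the multiplicity. The freedom in `s` lets
several polynomials be factored over a common index set. -/
theorem prod_pow_expo {a : F[X]} (ha : a.Monic) {s : Finset (MonicIrred F)}
    (hs : ∀ P : MonicIrred F, P.1 ∣ a → P ∈ s) : ∏ P ∈ s, P.1 ^ expo a P = a := by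
  obtain ⟨b, hb⟩ : ∏ P ∈ s, P.1 ^ expo a P ∣ a :=
    Finset.prod_dvd_of_coprime (fun P _ Q _ h => (coprime_monicIrred h).pow)
      fun P _ => pow_multiplicity_dvd _ _
  have hm : (∏ P ∈ s, P.1 ^ expo a P).Monic := monic_prod_of_monic _ _ fun P _ => P.2.1.pow _
  have hbm : b.Monic := hm.of_mul_monic_left (hb ▸ ha)
  by_cases hu : IsUnit b
  · rw [hbm.eq_one_of_isUnit hu, mul_one] at hb
    exact hb.symm
  · obtain ⟨P, c, hc⟩ := exists_monicIrred_dvd hu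
    have hPs : P ∈ s := hs P (hb ▸ (Dvd.intro c hc.symm).mul_left _)
    have : P.1 ^ (expo a P + 1) ∣ a := by
      rw [pow_succ]
      conv_rhs => rw [hb]
      exact mul_dvd_mul (Finset.dvd_prod_of_mem (fun P : MonicIrred F => P.1 ^ expo a P) hPs)
        (Dvd.intro c hc.symm)
    exact absurd this
      ((finiteMultiplicity_monicIrred P ha.ne_zero).not_pow_dvd_of_multiplicity_lt (Nat.lt_succ_self _))

theorem finite_primeDivisors {a : F[X]} (ha : a ≠ 0) : {P : MonicIrred F | P.1 ∣ a}.Finite := by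
  classical
  obtain ⟨n, hn⟩ : ∃ n, n = a.natDegree := ⟨_, rfl⟩
  induction n using Nat.strong_induction_on generalizing a with
  | _ n ih =>
    by_cases hu : IsUnit a
    · convert Set.finite_empty
      refine Set.eq_empty_of_forall_notMem fun P hP => P.2.2.not_isUnit (isUnit_of_dvd_unit hP hu)
    · obtain ⟨P, b, rfl⟩ := exists_monicIrred_dvd hu
      have hb : b ≠ 0 := right_ne_zero_of_mul ha
      rw [natDegree_mul P.ne_zero hb] at hn
      refine ((ih b.natDegree (by have := P.natDegree_pos; omega) hb rfl).insert P).subset ?_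
      intro Q hQ
      by_cases h : Q = P
      · exact Or.inl h
      · exact Or.inr ((coprime_monicIrred h).dvd_of_dvd_mul_left hQ)

/-- The primes dividing `a` (empty for `a = 0`). -/
noncomputable def primeDivisors (a : F[X]) : Finset (MonicIrred F) := by
  classical exact if h : a ≠ 0 then (finite_primeDivisors h).toFinset else ∅

theorem mem_primeDivisors {a : F[X]} (ha : a ≠ 0) {P : MonicIrred F} :
    P ∈ primeDivisors a ↔ P.1 ∣ a := by
  simp [primeDivisors, ha]

theorem prod_primeDivisors_pow_expo {a : F[X]} (ha : a.Monic) :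
    ∏ P ∈ primeDivisors a, P.1 ^ expo a P = a :=
  prod_pow_expo ha fun _ h => (mem_primeDivisors ha.ne_zero).2 h

theorem monic_eq_of_expo_eq {a b : F[X]} (ha : a.Monic) (hb : b.Monic)
    (h : ∀ P, expo a P = expo b P) : a = b := by
  have hd : ∀ P : MonicIrred F, P.1 ∣ a ↔ P.1 ∣ b := fun P => by
    rw [← expo_pos_iff, h, expo_pos_iff]
  rw [← prod_primeDivisors_pow_expo ha, ← prod_pow_expo hb (s := primeDivisors a)
    fun P hP => (mem_primeDivisors ha.ne_zero).2 ((hd P).2 hP)]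
  simp_rw [h]

theorem natDegree_prod_pow (s : Finset (MonicIrred F)) (k : MonicIrred F → ℕ) :
    (∏ P ∈ s, P.1 ^ k P).natDegree = ∑ P ∈ s, k P * P.1.natDegree := by
  rw [natDegree_prod_of_monic _ _ fun P _ => P.2.1.pow _]
  simp

variable (F) in
theorem finite_monic_natDegree [Finite F] (n : ℕ) :
    {a : F[X] | a.Monic ∧ a.natDegree = n}.Finite := by
  have : Finite (degreeLT F n) := Module.finite_of_finite F
  exact Set.finite_coe_iff.1 (Finite.of_equiv _ (monicEquivDegreeLT (R := F) n).symm)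

variable (F) in
/-- The monic polynomials of degree `n`. -/
noncomputable def monicOfDegree [Finite F] (n : ℕ) : Finset F[X] :=
  (finite_monic_natDegree F n).toFinset

@[simp]
theorem mem_monicOfDegree [Finite F] {n : ℕ} {a : F[X]} :
    a ∈ monicOfDegree F n ↔ a.Monic ∧ a.natDegree = n := by
  simp [monicOfDegree]

theorem card_degreeLT [Finite F] (n : ℕ) : Nat.card (degreeLT F n) = Nat.card F ^ n := by
  rw [Nat.card_congr (degreeLTEquiv F n).toEquiv, Nat.card_pi]
  simp

theorem card_monicOfDegree [Finite F] (n : ℕ) : (monicOfDegree F n).card = Nat.card F ^ n := by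
  rw [← card_degreeLT, ← Nat.card_congr (monicEquivDegreeLT n), ← Nat.card_eq_finsetCard]
  exact Nat.card_congr (Equiv.subtypeEquivRight fun a => mem_monicOfDegree)

variable (F) in
theorem finite_monicIrred_natDegree_le [Finite F] (n : ℕ) :
    {P : MonicIrred F | P.1.natDegree ≤ n}.Finite := by
  refine Set.Finite.of_finite_image (f := Subtype.val) ?_ Subtype.val_injective.injOn
  refine ((Set.finite_Iic n).biUnion fun k _ => finite_monic_natDegree F k).subset ?_
  rintro _ ⟨P, hP, rfl⟩
  exact Set.mem_biUnion (x := P.1.natDegree) hP ⟨P.2.1, rfl⟩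

variable (F) in
/-- The monic irreducible polynomials of degree at most `n`. -/
noncomputable def primesLE [Finite F] (n : ℕ) : Finset (MonicIrred F) :=
  (finite_monicIrred_natDegree_le F n).toFinset

@[simp]
theorem mem_primesLE [Finite F] {n : ℕ} {P : MonicIrred F} :
    P ∈ primesLE F n ↔ P.1.natDegree ≤ n := by
  simp [primesLE]

variable (F) in
/-- The monic irreducible polynomials of degree `n`. -/
noncomputable def primesEq [Finite F] (n : ℕ) : Finset (MonicIrred F) :=
  (primesLE F n).filter fun P => P.1.natDegree = n

@[simp]
theorem mem_primesEq [Finite F] {n : ℕ} {P : MonicIrred F} :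
    P ∈ primesEq F n ↔ P.1.natDegree = n := by
  simp only [primesEq, Finset.mem_filter, mem_primesLE]
  exact ⟨fun h => h.2, fun h => ⟨h.le, h⟩⟩

theorem natDegree_mul_card_primesEq_le [Finite F] (n : ℕ) :
    n * (primesEq F n).card ≤ Nat.card F ^ n := by
  rcases Nat.eq_zero_or_pos n with rfl | hn
  · simp
  have hq : 1 < Nat.card F := Finite.one_lt_card
  have hX := FiniteField.X_pow_card_pow_sub_X_ne_zero F hn.ne' hq
  have hdvd : ∏ P ∈ primesEq F n, P.1 ∣ X ^ Nat.card F ^ n - X := by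
    refine Finset.prod_dvd_of_coprime (fun P _ Q _ h => coprime_monicIrred h) fun P hP => ?_
    rw [← P.2.2.natDegree_dvd_iff_dvd_X_pow_card_pow_sub_X, mem_primesEq.1 hP]
  have h := natDegree_le_of_dvd hdvd hX
  rw [FiniteField.X_pow_card_pow_sub_X_natDegree_eq F hn.ne' hq,
    natDegree_prod_of_monic _ _ fun P _ => P.2.1,
    Finset.sum_congr rfl fun P hP => mem_primesEq.1 hP] at h
  simpa [mul_comm] using h

/-- A lower bound for the number of monic irreducible polynomials of degree `n`. -/
theorem card_pow_le_two_mul_card_primesEq [Finite F] {n : ℕ} (hn : 1 ≤ n)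
    (hq : 3 ≤ Nat.card F) : Nat.card F ^ n ≤ 2 * n * (primesEq F n).card := by
  classical
  have hq1 : 1 < Nat.card F := by omega
  set q := Nat.card F
  have hX := FiniteField.X_pow_card_pow_sub_X_ne_zero F (by omega : n ≠ 0) hq1
  have hdeg := FiniteField.X_pow_card_pow_sub_X_natDegree_eq F (by omega : n ≠ 0) hq1
  -- This polynomial is squarefree and its prime factors have degree dividing `n`. Comparing degrees
  -- bounds `q^n` by the sum of `d * |primesEq d|` over the divisors `d` of `n`.
  set T := (X ^ q ^ n - X : F[X]) with hT
  have hmon : T.Monic := by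
    refine monic_X_pow_sub ?_
    rw [degree_X]
    exact_mod_cast Nat.one_lt_pow (by omega) hq1
  have hsq : Squarefree T := by
    obtain ⟨p, hp⟩ := CharP.exists F
    have hq0 : (q : F) = 0 := by
      have := Fintype.ofFinite F
      rw [show q = Fintype.card F from Nat.card_eq_fintype_card]
      exact Nat.cast_card_eq_zero F
    refine (galois_poly_separable p (q ^ n) ?_).squarefree
    rw [← CharP.cast_eq_zero_iff F p, Nat.cast_pow, hq0, zero_pow (by omega)]
  have hdvd : ∀ P : MonicIrred F, P.1 ∣ T → P ∈ n.divisors.biUnion fun d => primesEq F d := by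
    intro P hP
    have := P.2.2.natDegree_dvd_iff_dvd_X_pow_card_pow_sub_X.2 hP
    simp only [Finset.mem_biUnion, Nat.mem_divisors, mem_primesEq]
    exact ⟨_, ⟨this, by omega⟩, rfl⟩
  have h1 := congrArg natDegree (prod_pow_expo hmon hdvd)
  rw [natDegree_prod_pow, hdeg] at h1
  have hexpo : ∀ P, expo T P ≤ 1 := fun P => by
    by_contra h
    have h2 : P.1 * P.1 ∣ T := by
      rw [← sq]; exact pow_dvd_of_le_multiplicity (by unfold expo at h; omega)
    exact P.2.2.not_isUnit (hsq _ h2)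
  have h2 : q ^ n ≤ ∑ d ∈ n.properDivisors, q ^ d + n * (primesEq F n).card := by
    calc q ^ n = _ := h1.symm
      _ ≤ ∑ P ∈ n.divisors.biUnion fun d => primesEq F d, P.1.natDegree :=
        Finset.sum_le_sum fun P _ => by nlinarith [hexpo P]
      _ = ∑ d ∈ n.divisors, ∑ P ∈ primesEq F d, P.1.natDegree :=
        Finset.sum_biUnion fun d _ e _ hde => Finset.disjoint_left.2 fun P h h' =>
          hde ((mem_primesEq.1 h).symm.trans (mem_primesEq.1 h'))
      _ = ∑ d ∈ n.divisors, d * (primesEq F d).card := Finset.sum_congr rfl fun d _ => by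
        rw [Finset.sum_congr rfl fun P hP => mem_primesEq.1 hP]
        simp [mul_comm]
      _ = ∑ d ∈ n.properDivisors, d * (primesEq F d).card + n * (primesEq F n).card := by
        rw [← Nat.insert_self_properDivisors (by omega), Finset.sum_insert (by simp), add_comm]
      _ ≤ _ := by
        gcongr with d
        exact natDegree_mul_card_primesEq_le d
  -- Here `q ≥ 3` is essential: all proper divisors together account for at most half of `q^n`.
  have h3 : ∀ m, 2 * ∑ d ∈ Finset.range m, q ^ d ≤ q ^ m := fun m => by
    induction m with
    | zero => simp
    | succ m ih => rw [Finset.sum_range_succ, pow_succ]; nlinarith [Nat.zero_le (q ^ m)]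
  have h4 : ∑ d ∈ n.properDivisors, q ^ d ≤ ∑ d ∈ Finset.range n, q ^ d :=
    Finset.sum_le_sum_of_subset fun d hd => Finset.mem_range.2 (Nat.mem_properDivisors.1 hd).2
  nlinarith [h3 n]

end Monic

/-! ### Equidistribution in residue classes and Selberg's sieve -/

section Sieve

variable {F : Type*} [Field F]

theorem dvd_sub_modByMonic (D a : F[X]) : D ∣ a - a %ₘ D :=
  ⟨a /ₘ D, by rw [sub_eq_iff_eq_add, add_comm]; exact (modByMonic_add_div a D).symm⟩

variable [Finite F]

variable (F) in
/-- The polynomials of degree less than `d`. -/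
noncomputable def polyLT (d : ℕ) : Finset F[X] :=
  (Set.finite_coe_iff.1 (Module.finite_of_finite F : Finite (degreeLT F d))).toFinset

theorem mem_polyLT {d : ℕ} {r : F[X]} : r ∈ polyLT F d ↔ r.degree < d := by
  simp [polyLT, mem_degreeLT]

theorem card_polyLT (d : ℕ) : (polyLT F d).card = Nat.card F ^ d := by
  rw [← card_degreeLT, ← Nat.card_eq_finsetCard]
  exact Nat.card_congr (Equiv.subtypeEquivRight fun a => by simp [polyLT])

theorem modByMonic_mem_polyLT {D : F[X]} (hD : D.Monic) (a : F[X]) :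
    a %ₘ D ∈ polyLT F D.natDegree := by
  rw [mem_polyLT, ← degree_eq_natDegree hD.ne_zero]
  exact degree_modByMonic_lt a hD

/-- Division with remainder, `a = b * D + r`, is a bijection with pairs of a monic `b` of
complementary degree and an arbitrary `r` of degree below `deg D`. Equidistribution in residue
classes is thus exact, with no error term for the sieve. -/
theorem sum_monicOfDegree_of_periodic {M : Type*} [AddCommMonoid M] {D : F[X]} (hD : D.Monic)
    {n : ℕ} (hn : D.natDegree ≤ n) {g : F[X] → M} (hg : ∀ a b, D ∣ a - b → g a = g b) :
    ∑ a ∈ monicOfDegree F n, g a =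
      Nat.card F ^ (n - D.natDegree) • ∑ r ∈ polyLT F D.natDegree, g r := by
  rw [← card_monicOfDegree, ← Finset.sum_const, ← Finset.sum_product']
  symm
  refine Finset.sum_nbij' (fun p => p.1 * D + p.2) (fun a => (a /ₘ D, a %ₘ D)) ?_ ?_ ?_ ?_ ?_
  · rintro ⟨b, r⟩ h
    simp only [Finset.mem_product, mem_monicOfDegree, mem_polyLT] at h ⊢
    have hlt : r.degree < (b * D).degree := by
      rw [degree_eq_natDegree (h.1.1.mul hD).ne_zero, h.1.1.natDegree_mul hD]
      exact h.2.trans_le (by exact_mod_cast Nat.le_add_left _ _)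
    refine ⟨(h.1.1.mul hD).add_of_left hlt, ?_⟩
    rw [natDegree_add_eq_left_of_degree_lt hlt, h.1.1.natDegree_mul hD, h.1.2]
    omega
  · intro a h
    rw [mem_monicOfDegree] at h
    simp only [Finset.mem_product, mem_monicOfDegree, modByMonic_mem_polyLT hD, and_true]
    refine ⟨?_, by rw [natDegree_divByMonic _ hD, h.2]⟩
    rw [Monic, leadingCoeff_divByMonic_of_monic hD, h.1]
    rw [degree_eq_natDegree hD.ne_zero, degree_eq_natDegree h.1.ne_zero, h.2]
    exact_mod_cast hn
  · rintro ⟨b, r⟩ h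
    simp only [Finset.mem_product, mem_polyLT] at h
    have := div_modByMonic_unique (f := b * D + r) b r hD
      ⟨by ring, by rw [degree_eq_natDegree hD.ne_zero]; exact h.2⟩
    exact Prod.ext this.1 this.2
  · intro a _
    simp only
    rw [mul_comm, add_comm, modByMonic_add_div]
  · rintro ⟨b, r⟩ _
    exact hg _ _ ⟨-b, by ring⟩

/-- Chinese remainder theorem. Two monics of degree `deg (D * E)` differ by a polynomial of smaller
degree, so they agree modulo `D` and `E` only if equal; surjectivity then follows by counting. -/
theorem sum_monicOfDegree_mul_of_periodic {D E : F[X]} (hD : D.Monic) (hE : E.Monic)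
    (hDE : IsCoprime D E) {g h : F[X] → ℝ} (hg : ∀ a b, D ∣ a - b → g a = g b)
    (hh : ∀ a b, E ∣ a - b → h a = h b) :
    ∑ a ∈ monicOfDegree F (D.natDegree + E.natDegree), g a * h a =
      (∑ r ∈ polyLT F D.natDegree, g r) * ∑ r ∈ polyLT F E.natDegree, h r := by
  classical
  rw [Finset.sum_mul_sum, ← Finset.sum_product']
  have hinj : Set.InjOn (fun a : F[X] => (a %ₘ D, a %ₘ E))
      (monicOfDegree F (D.natDegree + E.natDegree)) := by
    intro a ha b hb hab
    simp only [Prod.mk.injEq] at hab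
    rw [Finset.mem_coe, mem_monicOfDegree] at ha hb
    have h1 : D ∣ a - b := by
      have := dvd_sub (dvd_sub_modByMonic D a) (dvd_sub_modByMonic D b)
      rwa [hab.1, sub_sub_sub_cancel_right] at this
    have h2 : E ∣ a - b := by
      have := dvd_sub (dvd_sub_modByMonic E a) (dvd_sub_modByMonic E b)
      rwa [hab.2, sub_sub_sub_cancel_right] at this
    by_contra hne
    have h3 := degree_le_of_dvd (hDE.mul_dvd h1 h2) (sub_ne_zero.2 hne)
    have h4 : (a - b).degree < a.degree := degree_sub_lt_left
      (by rw [degree_eq_natDegree ha.1.ne_zero, degree_eq_natDegree hb.1.ne_zero, ha.2, hb.2])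
      ha.1.ne_zero (by rw [ha.1.leadingCoeff, hb.1.leadingCoeff])
    rw [degree_eq_natDegree (hD.mul hE).ne_zero, hD.natDegree_mul hE] at h3
    rw [degree_eq_natDegree ha.1.ne_zero, ha.2] at h4
    exact absurd (h3.trans_lt h4) (lt_irrefl _)
  have himage : (monicOfDegree F (D.natDegree + E.natDegree)).image
      (fun a : F[X] => (a %ₘ D, a %ₘ E)) = polyLT F D.natDegree ×ˢ polyLT F E.natDegree := by
    refine Finset.eq_of_subset_of_card_le (fun p hp => ?_) ?_
    · obtain ⟨a, _, rfl⟩ := Finset.mem_image.1 hp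
      exact Finset.mem_product.2 ⟨modByMonic_mem_polyLT hD a, modByMonic_mem_polyLT hE a⟩
    · rw [Finset.card_image_of_injOn hinj, Finset.card_product, card_polyLT, card_polyLT,
        card_monicOfDegree, pow_add]
  rw [← himage, Finset.sum_image hinj]
  exact Finset.sum_congr rfl fun a _ => by
    rw [hg _ _ (dvd_sub_modByMonic D a), hh _ _ (dvd_sub_modByMonic E a)]

/-- The average of `g` over the monic polynomials of degree `n`. -/
noncomputable def monicAvg (n : ℕ) (g : F[X] → ℝ) : ℝ :=
  ((Nat.card F : ℝ) ^ n)⁻¹ * ∑ a ∈ monicOfDegree F n, g a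

theorem monicAvg_of_periodic {D : F[X]} (hD : D.Monic) {n : ℕ} (hn : D.natDegree ≤ n)
    {g : F[X] → ℝ} (hg : ∀ a b, D ∣ a - b → g a = g b) :
    monicAvg n g = monicAvg D.natDegree g := by
  have hq : (Nat.card F : ℝ) ≠ 0 := by exact_mod_cast Nat.card_pos.ne'
  rw [monicAvg, monicAvg, sum_monicOfDegree_of_periodic hD hn hg,
    sum_monicOfDegree_of_periodic hD le_rfl hg, nsmul_eq_mul, nsmul_eq_mul]
  conv_lhs => rw [show n = (n - D.natDegree) + D.natDegree by omega, pow_add]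
  simp only [Nat.add_sub_cancel, Nat.sub_self, Nat.cast_pow, pow_zero]
  field_simp
  simp

theorem monicAvg_mul_of_periodic {D E : F[X]} (hD : D.Monic) (hE : E.Monic)
    (hDE : IsCoprime D E) {g h : F[X] → ℝ} (hg : ∀ a b, D ∣ a - b → g a = g b)
    (hh : ∀ a b, E ∣ a - b → h a = h b) :
    monicAvg (D.natDegree + E.natDegree) (fun a => g a * h a) =
      monicAvg D.natDegree g * monicAvg E.natDegree h := by
  rw [monicAvg, monicAvg, monicAvg, sum_monicOfDegree_mul_of_periodic hD hE hDE hg hh,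
    sum_monicOfDegree_of_periodic hD le_rfl hg, sum_monicOfDegree_of_periodic hE le_rfl hh]
  simp only [Nat.sub_self, pow_zero, one_smul]
  rw [pow_add, mul_inv]; ring

/-- Residues modulo distinct primes behave as independent random variables as long as the total
degree of the primes does not exceed `n`. -/
theorem monicAvg_prod {n : ℕ} {Q : Finset (MonicIrred F)} (hQ : ∑ P ∈ Q, P.1.natDegree ≤ n)
    {g : MonicIrred F → F[X] → ℝ} (hg : ∀ P a b, P.1 ∣ a - b → g P a = g P b) :
    monicAvg n (fun a => ∏ P ∈ Q, g P a) = ∏ P ∈ Q, monicAvg P.1.natDegree (g P) := by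
  classical
  have hper : ∀ Q : Finset (MonicIrred F), ∀ a b : F[X], ∏ P ∈ Q, P.1 ∣ a - b →
      ∏ P ∈ Q, g P a = ∏ P ∈ Q, g P b := fun Q a b hab =>
    Finset.prod_congr rfl fun P hP => hg P a b ((Finset.dvd_prod_of_mem _ hP).trans hab)
  have hmon : ∀ Q : Finset (MonicIrred F), (∏ P ∈ Q, P.1).Monic := fun Q =>
    monic_prod_of_monic _ _ fun P _ => P.2.1
  have hdeg : ∀ Q : Finset (MonicIrred F), (∏ P ∈ Q, P.1).natDegree = ∑ P ∈ Q, P.1.natDegree :=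
    fun Q => natDegree_prod_of_monic _ _ fun P _ => P.2.1
  rw [monicAvg_of_periodic (hmon Q) (by rwa [hdeg]) (hper Q)]
  clear hQ
  induction Q using Finset.induction_on with
  | empty => simp [monicAvg, card_monicOfDegree]
  | insert P Q hP ih =>
    rw [Finset.prod_insert hP, Finset.prod_insert hP, P.2.1.natDegree_mul (hmon Q), ← ih]
    simp_rw [Finset.prod_insert hP]
    refine monicAvg_mul_of_periodic P.2.1 (hmon Q) ?_ (hg P) (hper Q)
    exact IsCoprime.prod_right fun R hR => coprime_monicIrred fun h => hP (h ▸ hR)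

open scoped Classical in
/-- **Selberg's sieve** over `F[X]`: if the members of `S` avoid, for each prime `P ∈ T`, a set
`R P` of residue classes modulo `P` of density `δ P`, then `|S| ≤ qⁿ / L`. -/
theorem selberg_sieve {n K : ℕ} (hK : 2 * K ≤ n) (T : Finset (MonicIrred F))
    (R : MonicIrred F → F[X] → Prop) (hR : ∀ P a b, P.1 ∣ a - b → (R P a ↔ R P b))
    (δ : MonicIrred F → ℝ) (hδ0 : ∀ P ∈ T, 0 ≤ δ P) (hδ1 : ∀ P ∈ T, δ P < 1)
    (hδ : ∀ P ∈ T, monicAvg P.1.natDegree (fun a => if R P a then 1 else 0) = δ P)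
    (S : Finset F[X]) (hS : S ⊆ monicOfDegree F n) (hSR : ∀ a ∈ S, ∀ P ∈ T, ¬ R P a) :
    S.card * ∑ Q ∈ T.powerset with ∑ P ∈ Q, P.1.natDegree ≤ K, ∏ P ∈ Q, δ P / (1 - δ P) ≤
      (Nat.card F : ℝ) ^ n := by
  have hq : (0 : ℝ) < Nat.card F := by exact_mod_cast Nat.card_pos
  set c : MonicIrred F → ℝ := fun P => δ P / (1 - δ P) with hc
  have hc0 : ∀ P ∈ T, 0 ≤ c P := fun P hP => div_nonneg (hδ0 P hP) (by linarith [hδ1 P hP])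
  -- The values are chosen so that `ψ P` has mean 0 and mean square exactly `c P`. The products over
  -- sets in `𝒬` are then orthogonal, and `G` below has mean square `L`, while it equals `L`
  -- identically on `S`.
  set ψ : MonicIrred F → F[X] → ℝ := fun P a => if R P a then -1 else c P with hψ
  set 𝒬 := T.powerset.filter fun Q => ∑ P ∈ Q, P.1.natDegree ≤ K with h𝒬
  set L := ∑ Q ∈ 𝒬, ∏ P ∈ Q, c P with hL
  have hQT : ∀ Q ∈ 𝒬, Q ⊆ T := fun Q hQ => Finset.mem_powerset.1 (Finset.mem_filter.1 hQ).1
  have hL1 : 1 ≤ L := by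
    have : (∅ : Finset (MonicIrred F)) ∈ 𝒬 := by simp [h𝒬]
    refine le_trans (by simp) (Finset.single_le_sum (f := fun Q => ∏ P ∈ Q, c P)
      (fun Q hQ => Finset.prod_nonneg fun P hP => hc0 P (hQT Q hQ hP)) this)
  have hψper : ∀ P a b, P.1 ∣ a - b → ψ P a = ψ P b := fun P a b hab => by
    simp only [hψ, hR P a b hab]
  have hone : ∀ m : ℕ, monicAvg (F := F) m (fun _ => 1) = 1 := fun m => by
    rw [monicAvg, Finset.sum_const, card_monicOfDegree, nsmul_eq_mul, mul_one, Nat.cast_pow,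
      inv_mul_cancel₀ (by positivity)]
  have hlin : ∀ (m : ℕ) (g : F[X] → ℝ) (x y : ℝ),
      monicAvg m (fun a => x + y * g a) = x + y * monicAvg m g := fun m g x y => by
    have := hone m
    rw [monicAvg] at this ⊢
    rw [Finset.sum_add_distrib, ← Finset.mul_sum, mul_add, monicAvg]
    rw [Finset.sum_const, nsmul_eq_mul] at this ⊢
    linear_combination x * this
  have havg1 : ∀ P ∈ T, monicAvg P.1.natDegree (ψ P) = 0 := fun P hP => by
    have e : ψ P = fun a => c P + (-1 - c P) * (if R P a then 1 else 0) := by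
      funext a; simp only [hψ]; split_ifs <;> ring
    rw [e, hlin, hδ P hP, hc]
    have := hδ1 P hP
    field_simp [(by linarith : 1 - δ P ≠ 0)]
    ring
  have havg2 : ∀ P ∈ T, monicAvg P.1.natDegree (fun a => ψ P a * ψ P a) = c P := fun P hP => by
    have e : (fun a => ψ P a * ψ P a) =
        fun a => c P ^ 2 + (1 - c P ^ 2) * (if R P a then 1 else 0) := by
      funext a; simp only [hψ]; split_ifs <;> ring
    rw [e, hlin, hδ P hP, hc]
    have := hδ1 P hP
    have h0 : 1 - δ P ≠ 0 := by linarith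
    field_simp
    ring
  have horth : ∀ Q ∈ 𝒬, ∀ Q' ∈ 𝒬, monicAvg n (fun a => (∏ P ∈ Q, ψ P a) * ∏ P ∈ Q', ψ P a) =
      if Q = Q' then ∏ P ∈ Q, c P else 0 := by
    intro Q hQ Q' hQ'
    have e : ∀ a, (∏ P ∈ Q, ψ P a) * ∏ P ∈ Q', ψ P a = ∏ P ∈ Q ∪ Q',
        ((if P ∈ Q then ψ P a else 1) * (if P ∈ Q' then ψ P a else 1)) := fun a => by
      rw [Finset.prod_mul_distrib, Finset.prod_ite_mem, Finset.prod_ite_mem,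
        Finset.union_inter_cancel_left, Finset.union_inter_cancel_right]
    simp_rw [e]
    rw [monicAvg_prod (g := fun P a =>
      (if P ∈ Q then ψ P a else 1) * (if P ∈ Q' then ψ P a else 1))]
    · split_ifs with h
      · subst h
        rw [Finset.union_self]
        refine Finset.prod_congr rfl fun P hP => ?_
        simp only [hP, if_true]
        exact havg2 P (hQT Q hQ hP)
      · have : ∃ P ∈ Q ∪ Q', ¬ (P ∈ Q ∧ P ∈ Q') := by
          by_contra hcon
          push Not at hcon
          exact h (Finset.ext fun P => ⟨fun hP => (hcon P (Finset.mem_union_left _ hP)).2,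
            fun hP => (hcon P (Finset.mem_union_right _ hP)).1⟩)
        obtain ⟨P, hP, hP'⟩ := this
        refine Finset.prod_eq_zero hP ?_
        rcases Finset.mem_union.1 hP with h1 | h1
        · have h2 : P ∉ Q' := fun h => hP' ⟨h1, h⟩
          simp only [h1, h2, if_true, if_false, mul_one]
          exact havg1 P (hQT Q hQ h1)
        · have h2 : P ∉ Q := fun h => hP' ⟨h, h1⟩
          simp only [h1, h2, if_true, if_false, one_mul]
          exact havg1 P (hQT Q' hQ' h1)
    -- The primes of `Q ∪ Q'` have total degree at most `2 * K ≤ n`, as exact independence requires.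
    · have := Finset.sum_union_inter (s₁ := Q) (s₂ := Q') (f := fun P => P.1.natDegree)
      have h1 := (Finset.mem_filter.1 hQ).2
      have h2 := (Finset.mem_filter.1 hQ').2
      omega
    · intro P a b hab
      simp only [hψper P a b hab]
  set G : F[X] → ℝ := fun a => ∑ Q ∈ 𝒬, ∏ P ∈ Q, ψ P a with hG
  have hG2 : monicAvg n (fun a => G a * G a) = L := by
    have e : monicAvg n (fun a => G a * G a) = ∑ Q ∈ 𝒬, ∑ Q' ∈ 𝒬,
        monicAvg n (fun a => (∏ P ∈ Q, ψ P a) * ∏ P ∈ Q', ψ P a) := by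
      simp only [monicAvg, hG, Finset.sum_mul_sum]
      rw [Finset.sum_comm, Finset.mul_sum]
      refine Finset.sum_congr rfl fun Q _ => ?_
      rw [Finset.sum_comm, Finset.mul_sum]
    rw [e]
    refine Finset.sum_congr rfl fun Q hQ => ?_
    rw [Finset.sum_congr rfl fun Q' hQ' => horth Q hQ Q' hQ']
    simp [hQ]
  have hGS : ∀ a ∈ S, G a = L := fun a ha =>
    Finset.sum_congr rfl fun Q hQ => Finset.prod_congr rfl fun P hP =>
      if_neg (hSR a ha P (hQT Q hQ hP))
  have h1 : S.card * (L * L) ≤ (Nat.card F : ℝ) ^ n * L := by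
    calc S.card * (L * L) = ∑ a ∈ S, G a * G a := by
          rw [Finset.sum_congr rfl fun a ha => by rw [hGS a ha], Finset.sum_const, nsmul_eq_mul]
      _ ≤ ∑ a ∈ monicOfDegree F n, G a * G a :=
          Finset.sum_le_sum_of_subset_of_nonneg hS fun a _ _ => mul_self_nonneg _
      _ = (Nat.card F : ℝ) ^ n * L := by
          rw [← hG2, monicAvg, mul_inv_cancel_left₀ (by positivity)]
  rw [← mul_assoc] at h1
  exact le_of_mul_le_mul_right h1 (by linarith)

end Sieve

/-! ### Lower bound for the Selberg sum in dimension two -/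

section SieveDensity

variable {F : Type*} [Field F]

/-- The reciprocal norm `1 / |P|` of a prime. -/
noncomputable def invNorm (P : MonicIrred F) : ℝ := ((Nat.card F : ℝ) ^ P.1.natDegree)⁻¹

theorem invNorm_le_third (hq : 3 ≤ Nat.card F) (P : MonicIrred F) : invNorm P ≤ 1 / 3 := by
  unfold invNorm
  have hq' : (3 : ℝ) ≤ Nat.card F := by exact_mod_cast hq
  rw [one_div]
  refine inv_anti₀ (by norm_num) (hq'.trans (le_self_pow₀ (by linarith) P.natDegree_pos.ne'))

theorem geom_sum_le_inv_one_sub {u : ℝ} (h0 : 0 ≤ u) (h1 : u < 1) (K : ℕ) :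
    ∑ i ∈ Finset.range K, u ^ i ≤ (1 - u)⁻¹ := by
  have h : (∑ i ∈ Finset.range K, u ^ i) * (1 - u) = 1 - u ^ K := geom_sum_mul_neg u K
  rw [← one_div, le_div_iff₀ (by linarith), h]
  linarith [pow_nonneg h0 K]

theorem inv_norm_pow_eq_prod {a : F[X]} (ha : a.Monic) {s : Finset (MonicIrred F)}
    (hs : ∀ P : MonicIrred F, P.1 ∣ a → P ∈ s) :
    ((Nat.card F : ℝ) ^ a.natDegree)⁻¹ = ∏ P ∈ s, invNorm P ^ expo a P := by
  conv_lhs => rw [← prod_pow_expo ha hs, natDegree_prod_pow]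
  rw [← Finset.prod_pow_eq_pow_sum, ← Finset.prod_inv_distrib]
  refine Finset.prod_congr rfl fun P _ => ?_
  rw [invNorm, inv_pow, ← pow_mul, mul_comm]

theorem expo_le_natDegree {a : F[X]} (ha : a.Monic) (P : MonicIrred F) :
    expo a P ≤ a.natDegree := by
  have h := natDegree_le_of_dvd (pow_multiplicity_dvd P.1 a) ha.ne_zero
  rw [natDegree_pow] at h
  exact le_trans (Nat.le_mul_of_pos_right _ P.natDegree_pos) h

variable [Finite F]

theorem invNorm_pos (P : MonicIrred F) : 0 < invNorm P := by
  have hq : (0 : ℝ) < Nat.card F := by exact_mod_cast Nat.card_pos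
  unfold invNorm; positivity

variable (F) in
/-- Pairs of monic polynomials of total degree at most `K`. -/
noncomputable def monicPairs (K : ℕ) : Finset (F[X] × F[X]) := by
  classical
  exact (((Finset.range (K + 1)).biUnion (monicOfDegree F)) ×ˢ
    ((Finset.range (K + 1)).biUnion (monicOfDegree F))).filter
      fun x => x.1.natDegree + x.2.natDegree ≤ K

theorem mem_monicPairs {K : ℕ} {x : F[X] × F[X]} : x ∈ monicPairs F K ↔
    x.1.Monic ∧ x.2.Monic ∧ x.1.natDegree + x.2.natDegree ≤ K := by
  simp only [monicPairs, Finset.mem_filter, Finset.mem_product, Finset.mem_biUnion,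
    Finset.mem_range, mem_monicOfDegree]
  constructor
  · rintro ⟨⟨⟨_, _, h1, _⟩, ⟨_, _, h2, _⟩⟩, h3⟩
    exact ⟨h1, h2, h3⟩
  · rintro ⟨h1, h2, h3⟩
    exact ⟨⟨⟨_, by omega, h1, rfl⟩, ⟨_, by omega, h2, rfl⟩⟩, h3⟩

/-- Each pair of degrees contributes exactly 1, so this counts pairs of degrees with sum at most
`K`. -/
theorem sum_monicPairs (K : ℕ) :
    ∑ x ∈ monicPairs F K, ((Nat.card F : ℝ) ^ x.1.natDegree)⁻¹ *
      ((Nat.card F : ℝ) ^ x.2.natDegree)⁻¹ = (K + 1) * (K + 2) / 2 := by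
  classical
  have hq : (0 : ℝ) < Nat.card F := by exact_mod_cast Nat.card_pos
  have hmaps : ∀ x ∈ monicPairs F K, (⟨x.1.natDegree + x.2.natDegree, x.1.natDegree⟩ : Σ _ : ℕ, ℕ) ∈
      (Finset.range (K + 1)).sigma fun m => Finset.range (m + 1) := by
    intro x hx
    have := (mem_monicPairs.1 hx).2.2
    simp only [Finset.mem_sigma, Finset.mem_range]
    omega
  rw [← Finset.sum_fiberwise_of_maps_to hmaps, Finset.sum_sigma]
  have h1 : ∀ m ∈ Finset.range (K + 1), ∀ i ∈ Finset.range (m + 1),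
      ∑ x ∈ monicPairs F K with
        (⟨x.1.natDegree + x.2.natDegree, x.1.natDegree⟩ : Σ _ : ℕ, ℕ) = ⟨m, i⟩,
        ((Nat.card F : ℝ) ^ x.1.natDegree)⁻¹ * ((Nat.card F : ℝ) ^ x.2.natDegree)⁻¹ = 1 := by
    intro m hm i hi
    rw [Finset.mem_range] at hm hi
    have e : (monicPairs F K).filter (fun x =>
        (⟨x.1.natDegree + x.2.natDegree, x.1.natDegree⟩ : Σ _ : ℕ, ℕ) = ⟨m, i⟩) =
        monicOfDegree F i ×ˢ monicOfDegree F (m - i) := by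
      ext x
      simp only [Finset.mem_filter, mem_monicPairs, Finset.mem_product, mem_monicOfDegree,
        Sigma.mk.injEq, heq_eq_eq]
      constructor
      · rintro ⟨⟨h1, h2, h3⟩, h4, h5⟩
        exact ⟨⟨h1, h5⟩, h2, by omega⟩
      · rintro ⟨⟨h1, h5⟩, h2, h6⟩
        exact ⟨⟨h1, h2, by omega⟩, by omega, h5⟩
    rw [e, Finset.sum_congr rfl (g := fun _ => ((Nat.card F : ℝ) ^ i)⁻¹ *
      ((Nat.card F : ℝ) ^ (m - i))⁻¹) fun x hx => by
        simp only [Finset.mem_product, mem_monicOfDegree] at hx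
        rw [hx.1.2, hx.2.2]]
    rw [Finset.sum_const, Finset.card_product, card_monicOfDegree, card_monicOfDegree,
      nsmul_eq_mul]
    push_cast
    field_simp
  rw [Finset.sum_congr rfl fun m hm => Finset.sum_congr rfl (h1 m hm)]
  simp only [Finset.sum_const, Finset.card_range, nsmul_eq_mul, mul_one]
  clear h1 hmaps
  induction K with
  | zero => simp
  | succ K ih => rw [Finset.sum_range_succ, ih]; push_cast; ring

theorem sum_box_pow_le {u : ℝ} (h0 : 0 ≤ u) (h1 : u < 1) (K : ℕ) :
    ∑ p ∈ Finset.range K ×ˢ Finset.range K, u ^ (p.1 + p.2) ≤ ((1 - u)⁻¹) ^ 2 := by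
  rw [Finset.sum_product]
  simp_rw [pow_add]
  rw [← Finset.sum_mul_sum, ← sq]
  exact pow_le_pow_left₀ (Finset.sum_nonneg fun _ _ => pow_nonneg h0 _)
    (geom_sum_le_inv_one_sub h0 h1 _) 2

/-- Local factor at a sieving prime: since `(1 - u)^2 ≥ 1 - 2u`, the full double series minus its
constant term is at most `1 / (1 - 2u) - 1`, the Selberg weight for density `2u`. -/
theorem sum_box_erase_pow_le {u : ℝ} (h0 : 0 ≤ u) (h1 : u ≤ 1 / 3) (K : ℕ) :
    ∑ p ∈ (Finset.range (K + 1) ×ˢ Finset.range (K + 1)).erase (0, 0), u ^ (p.1 + p.2) ≤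
      2 * u / (1 - 2 * u) := by
  have hm : ((0, 0) : ℕ × ℕ) ∈ Finset.range (K + 1) ×ˢ Finset.range (K + 1) := by simp
  have e := Finset.add_sum_erase _ (fun p : ℕ × ℕ => u ^ (p.1 + p.2)) hm
  have h2 := sum_box_pow_le h0 (by linarith : u < 1) (K + 1)
  simp only [add_zero, pow_zero] at e
  have h5 : ((1 - u)⁻¹) ^ 2 - 1 ≤ 2 * u / (1 - 2 * u) := by
    rw [inv_pow, sub_le_iff_le_add, ← one_div, div_add_one (by linarith),
      div_le_div_iff₀ (by nlinarith) (by linarith)]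
    nlinarith [pow_nonneg h0 3, sq_nonneg u]
  linarith

theorem sum_le_sum_of_fibers {α β : Type*} {s : Finset α} {t : Finset β} {φ : α → β}
    (hφ : ∀ x ∈ s, φ x ∈ t) {f : α → ℝ} {g : β → ℝ}
    (h : ∀ y ∈ t, ∀ B ⊆ s, (∀ x ∈ B, φ x = y) → ∑ x ∈ B, f x ≤ g y) :
    ∑ x ∈ s, f x ≤ ∑ y ∈ t, g y := by
  classical
  rw [← Finset.sum_fiberwise_of_maps_to hφ]
  exact Finset.sum_le_sum fun y hy =>
    h y hy _ (Finset.filter_subset _ _) fun x hx => (Finset.mem_filter.1 hx).2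

-- The left side is the sum of `1 / (|b| |c|)` over monic pairs of total degree at most `K`. The
-- pairs are grouped by the set `Q` of primes of `T` dividing `b * c`, and each group is bounded by
-- an Euler product: primes of `Q` give the Selberg weight, other primes of `T` give 1, and primes
-- outside `T` give the correction factor `(1 - 1/|P|)^(-2)`.
open scoped Classical in
theorem selberg_density_lower_bound (hq : 3 ≤ Nat.card F) (K : ℕ) (T : Finset (MonicIrred F))
    (hT : T ⊆ primesLE F K) :
    ((K : ℝ) + 1) * (K + 2) / 2 ≤
      (∑ Q ∈ T.powerset with ∑ P ∈ Q, P.1.natDegree ≤ K,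
        ∏ P ∈ Q, 2 * invNorm P / (1 - 2 * invNorm P)) *
      ∏ P ∈ primesLE F K \ T, ((1 - invNorm P)⁻¹) ^ 2 := by
  rw [← sum_monicPairs (F := F)]
  set Pr := primesLE F K with hPr
  set 𝒬 := T.powerset.filter fun Q => ∑ P ∈ Q, P.1.natDegree ≤ K with h𝒬
  set supp : F[X] × F[X] → Finset (MonicIrred F) :=
    fun x => T.filter fun P => P.1 ∣ x.1 * x.2 with hsupp
  have hmaps : ∀ x ∈ monicPairs F K, supp x ∈ 𝒬 := by
    intro x hx
    obtain ⟨h1, h2, h3⟩ := mem_monicPairs.1 hx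
    refine Finset.mem_filter.2 ⟨Finset.mem_powerset.2 (Finset.filter_subset _ _), ?_⟩
    have hd : ∏ P ∈ supp x, P.1 ∣ x.1 * x.2 :=
      Finset.prod_dvd_of_coprime (fun P _ Q _ h => coprime_monicIrred h)
        fun P hP => (Finset.mem_filter.1 hP).2
    have := natDegree_le_of_dvd hd (h1.mul h2).ne_zero
    rw [natDegree_prod_of_monic _ _ fun P _ => P.2.1, h1.natDegree_mul h2] at this
    omega
  rw [Finset.sum_mul]
  refine sum_le_sum_of_fibers hmaps fun Q hQ B hBs hBQ => ?_
  have hBmem : ∀ x ∈ B, x ∈ monicPairs F K ∧ supp x = Q := fun x hx => ⟨hBs hx, hBQ x hx⟩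
  have hQT : Q ⊆ T := Finset.mem_powerset.1 (Finset.mem_filter.1 hQ).1
  set I := Finset.range (K + 1) with hI
  -- Possible exponents of `P` in the pair: not both zero on `Q`, both zero on the rest of `T`,
  -- unrestricted off `T`.
  set A : Pr → Finset (ℕ × ℕ) := fun P =>
    if P.1 ∈ Q then (I ×ˢ I).erase (0, 0) else if P.1 ∈ T then {(0, 0)} else I ×ˢ I with hA
  set φ : F[X] × F[X] → Pr → ℕ × ℕ := fun x P => (expo x.1 P.1, expo x.2 P.1) with hφ
  have hPrd : ∀ x ∈ monicPairs F K, (∀ P : MonicIrred F, P.1 ∣ x.1 → P ∈ Pr) ∧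
      ∀ P : MonicIrred F, P.1 ∣ x.2 → P ∈ Pr := by
    intro x hx
    obtain ⟨h1, h2, h3⟩ := mem_monicPairs.1 hx
    constructor <;> intro P hP <;> rw [hPr, mem_primesLE]
    · exact (natDegree_le_of_dvd hP h1.ne_zero).trans (by omega)
    · exact (natDegree_le_of_dvd hP h2.ne_zero).trans (by omega)
  have hφA : ∀ x ∈ B, φ x ∈ Fintype.piFinset A := by
    intro x hx
    obtain ⟨hx, hxQ⟩ := hBmem x hx
    obtain ⟨h1, h2, h3⟩ := mem_monicPairs.1 hx
    rw [Fintype.mem_piFinset]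
    intro P
    have hin : φ x P ∈ I ×ˢ I := by
      simp only [hφ, hI, Finset.mem_product, Finset.mem_range]
      have e1 := expo_le_natDegree h1 P.1
      have e2 := expo_le_natDegree h2 P.1
      omega
    have hQiff : P.1 ∈ Q ↔ P.1 ∈ T ∧ P.1.1 ∣ x.1 * x.2 := by
      rw [← hxQ, hsupp, Finset.mem_filter]
    have hdiv : P.1.1 ∣ x.1 * x.2 ↔ φ x P ≠ (0, 0) := by
      rw [← expo_pos_iff, expo_mul h1.ne_zero h2.ne_zero]
      simp only [hφ, ne_eq, Prod.mk.injEq]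
      omega
    simp only [hA]
    split_ifs with c1 c2
    · exact Finset.mem_erase.2 ⟨hdiv.1 (hQiff.1 c1).2, hin⟩
    · rw [Finset.mem_singleton]
      by_contra hne
      exact c1 (hQiff.2 ⟨c2, hdiv.2 hne⟩)
    · exact hin
  have hφinj : Set.InjOn φ B := by
    intro x hx y hy hxy
    have hx' := (hBmem x hx).1
    have hy' := (hBmem y hy).1
    obtain ⟨h1, h2, -⟩ := mem_monicPairs.1 hx'
    obtain ⟨h3, h4, -⟩ := mem_monicPairs.1 hy'
    have hex : ∀ P : MonicIrred F, expo x.1 P = expo y.1 P ∧ expo x.2 P = expo y.2 P := by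
      intro P
      by_cases hP : P ∈ Pr
      · have := congrFun hxy ⟨P, hP⟩
        simpa [hφ] using this
      · rw [(expo_eq_zero_iff P).2 fun h => hP ((hPrd x hx').1 P h),
          (expo_eq_zero_iff P).2 fun h => hP ((hPrd x hx').2 P h),
          (expo_eq_zero_iff P).2 fun h => hP ((hPrd y hy').1 P h),
          (expo_eq_zero_iff P).2 fun h => hP ((hPrd y hy').2 P h)]
        exact ⟨rfl, rfl⟩
    exact Prod.ext (monic_eq_of_expo_eq h1 h3 fun P => (hex P).1)
      (monic_eq_of_expo_eq h2 h4 fun P => (hex P).2)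
  have hu0 : ∀ P : MonicIrred F, 0 ≤ invNorm P := fun P => (invNorm_pos P).le
  have hu3 : ∀ P : MonicIrred F, invNorm P ≤ 1 / 3 := invNorm_le_third hq
  calc ∑ x ∈ B, ((Nat.card F : ℝ) ^ x.1.natDegree)⁻¹ *
        ((Nat.card F : ℝ) ^ x.2.natDegree)⁻¹
      = ∑ x ∈ B,
          ∏ P : Pr, invNorm P.1 ^ ((φ x P).1 + (φ x P).2) := by
        refine Finset.sum_congr rfl fun x hx => ?_
        have hx' := (hBmem x hx).1
        obtain ⟨h1, h2, -⟩ := mem_monicPairs.1 hx'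
        rw [inv_norm_pow_eq_prod h1 (hPrd x hx').1, inv_norm_pow_eq_prod h2 (hPrd x hx').2,
          ← Finset.prod_mul_distrib, ← Finset.prod_coe_sort]
        exact Finset.prod_congr rfl fun P _ => (pow_add _ _ _).symm
    _ = ∑ y ∈ B.image φ,
          ∏ P : Pr, invNorm P.1 ^ ((y P).1 + (y P).2) := (Finset.sum_image
          (f := fun y : Pr → ℕ × ℕ => ∏ P : Pr, invNorm P.1 ^ ((y P).1 + (y P).2)) hφinj).symm
    _ ≤ ∑ y ∈ Fintype.piFinset A, ∏ P : Pr, invNorm P.1 ^ ((y P).1 + (y P).2) :=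
        Finset.sum_le_sum_of_subset_of_nonneg (Finset.image_subset_iff.2 hφA)
          fun _ _ _ => Finset.prod_nonneg fun _ _ => pow_nonneg (hu0 _) _
    _ = ∏ P : Pr, ∑ p ∈ A P, invNorm P.1 ^ (p.1 + p.2) :=
        (Finset.prod_univ_sum A fun (P : Pr) (p : ℕ × ℕ) => invNorm P.1 ^ (p.1 + p.2)).symm
    _ ≤ ∏ P : Pr, if P.1 ∈ Q then 2 * invNorm P.1 / (1 - 2 * invNorm P.1) else
          if P.1 ∈ T then 1 else ((1 - invNorm P.1)⁻¹) ^ 2 := by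
        refine Finset.prod_le_prod (fun P _ => Finset.sum_nonneg fun _ _ => pow_nonneg (hu0 _) _)
          fun P _ => ?_
        simp only [hA]
        split_ifs with c1 c2
        · exact sum_box_erase_pow_le (hu0 P.1) (hu3 P.1) K
        · simp
        · exact sum_box_pow_le (hu0 P.1) (by linarith [hu3 P.1]) _
    _ = (∏ P ∈ Q, 2 * invNorm P / (1 - 2 * invNorm P)) *
          ∏ P ∈ Pr \ T, ((1 - invNorm P)⁻¹) ^ 2 := by
        rw [Finset.prod_coe_sort Pr (fun P => if P ∈ Q then 2 * invNorm P / (1 - 2 * invNorm P) else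
          if P ∈ T then 1 else ((1 - invNorm P)⁻¹) ^ 2), ← Finset.prod_sdiff hT, mul_comm]
        congr 1
        · rw [← Finset.prod_sdiff hQT, Finset.prod_eq_one, one_mul]
          · exact Finset.prod_congr rfl fun P hP => if_pos hP
          · intro P hP
            rw [Finset.mem_sdiff] at hP
            simp [hP.1, hP.2]
        · refine Finset.prod_congr rfl fun P hP => ?_
          rw [Finset.mem_sdiff] at hP
          have : P ∉ Q := fun h => hP.2 (hQT h)
          simp [hP.2, this]

end SieveDensity

/-! ### Sieve bound for simultaneous irreducibility of two linear forms -/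

section PairSieve

variable {F : Type*} [Field F]

theorem sum_natDegree_primeDivisors_le {a : F[X]} (ha : a ≠ 0) :
    ∑ P ∈ primeDivisors a, P.1.natDegree ≤ a.natDegree := by
  have hd : ∏ P ∈ primeDivisors a, P.1 ∣ a :=
    Finset.prod_dvd_of_coprime (fun P _ Q _ h => coprime_monicIrred h)
      fun P hP => (mem_primeDivisors ha).1 hP
  have := natDegree_le_of_dvd hd ha
  rwa [natDegree_prod_of_monic _ _ fun P _ => P.2.1] at this

theorem card_primeDivisors_le {a : F[X]} (ha : a ≠ 0) :
    (primeDivisors a).card ≤ a.natDegree := by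
  refine le_trans ?_ (sum_natDegree_primeDivisors_le ha)
  rw [Finset.card_eq_sum_ones]
  exact Finset.sum_le_sum fun P _ => P.natDegree_pos

variable [Finite F]

/-- Primes of degree `j` contribute at most `1/j` in total, which gives a harmonic sum up to `D`;
each prime of larger degree contributes at most `3^(-D)`. -/
theorem sum_invNorm_le (hq : 3 ≤ Nat.card F) (B : Finset (MonicIrred F)) {D : ℕ} :
    ∑ P ∈ B, invNorm P ≤ 1 + Real.log D + B.card / 3 ^ D := by
  classical
  have hq' : (3 : ℝ) ≤ Nat.card F := by exact_mod_cast hq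
  have hq0 : (0 : ℝ) < Nat.card F := by linarith
  rw [← Finset.sum_filter_add_sum_filter_not B (fun P => P.1.natDegree ≤ D)]
  refine add_le_add ?_ ?_
  · calc ∑ P ∈ B with P.1.natDegree ≤ D, invNorm P
        ≤ ∑ P ∈ (Finset.Icc 1 D).biUnion (primesEq F), invNorm P := by
          refine Finset.sum_le_sum_of_subset_of_nonneg (fun P hP => ?_)
            fun P _ _ => (invNorm_pos P).le
          simp only [Finset.mem_biUnion, Finset.mem_Icc, mem_primesEq]
          exact ⟨_, ⟨P.natDegree_pos, (Finset.mem_filter.1 hP).2⟩, rfl⟩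
      _ = ∑ j ∈ Finset.Icc 1 D, ∑ P ∈ primesEq F j, invNorm P :=
          Finset.sum_biUnion fun d _ e _ hde => Finset.disjoint_left.2 fun P h h' =>
            hde ((mem_primesEq.1 h).symm.trans (mem_primesEq.1 h'))
      _ ≤ ∑ j ∈ Finset.Icc 1 D, ((j : ℝ))⁻¹ := by
          refine Finset.sum_le_sum fun j hj => ?_
          have hj1 : (0 : ℝ) < j := by exact_mod_cast (Finset.mem_Icc.1 hj).1
          rw [Finset.sum_congr rfl (g := fun _ => ((Nat.card F : ℝ) ^ j)⁻¹) fun P hP => by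
            rw [invNorm, mem_primesEq.1 hP], Finset.sum_const, nsmul_eq_mul]
          have h : (j : ℝ) * (primesEq F j).card ≤ (Nat.card F : ℝ) ^ j := by
            exact_mod_cast natDegree_mul_card_primesEq_le (F := F) j
          rw [← div_eq_mul_inv, div_le_iff₀ (by positivity), inv_mul_eq_div, le_div_iff₀ hj1]
          linarith
      _ ≤ 1 + Real.log D := by
          have := harmonic_le_one_add_log D
          rw [harmonic_eq_sum_Icc] at this
          simpa using this
  · calc ∑ P ∈ B with ¬ P.1.natDegree ≤ D, invNorm P
        ≤ ∑ P ∈ B with ¬ P.1.natDegree ≤ D, ((3 : ℝ) ^ D)⁻¹ := by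
          refine Finset.sum_le_sum fun P hP => inv_anti₀ (by positivity) ?_
          have h := (Finset.mem_filter.1 hP).2
          calc (3 : ℝ) ^ D ≤ (Nat.card F : ℝ) ^ D := by gcongr
            _ ≤ _ := pow_le_pow_right₀ (by linarith) (by omega)
      _ ≤ _ := by
          rw [Finset.sum_const, nsmul_eq_mul, div_eq_mul_inv]
          gcongr
          exact Finset.filter_subset _ _

theorem prod_inv_one_sub_invNorm_sq_le (hq : 3 ≤ Nat.card F) (B : Finset (MonicIrred F)) (D : ℕ) :
    ∏ P ∈ B, ((1 - invNorm P)⁻¹) ^ 2 ≤ Real.exp (3 * (1 + Real.log D + B.card / 3 ^ D)) := by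
  calc ∏ P ∈ B, ((1 - invNorm P)⁻¹) ^ 2 ≤ ∏ P ∈ B, Real.exp (3 * invNorm P) := by
        refine Finset.prod_le_prod (fun P _ => by positivity) fun P _ => ?_
        have h0 := invNorm_pos P
        have h3 := invNorm_le_third hq P
        set u := invNorm P
        have h1 : (1 - u)⁻¹ ≤ Real.exp (3 / 2 * u) := by
          refine le_trans ?_ (Real.add_one_le_exp _)
          rw [← one_div, div_le_iff₀ (by linarith)]
          nlinarith
        calc ((1 - u)⁻¹) ^ 2 ≤ Real.exp (3 / 2 * u) ^ 2 :=
              pow_le_pow_left₀ (inv_nonneg.2 (by linarith)) h1 2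
          _ = Real.exp (3 * u) := by rw [← Real.exp_nat_mul]; congr 1; push_cast; ring
    _ = Real.exp (3 * ∑ P ∈ B, invNorm P) := by rw [← Real.exp_sum, Finset.mul_sum]
    _ ≤ _ := by
        gcongr
        exact sum_invNorm_le hq B

/-- If `P ∤ x`, exactly one residue class modulo `P` solves `a * x ≡ Z`. -/
theorem card_monicOfDegree_dvd_mul_sub (P : MonicIrred F) {x : F[X]} (hx : ¬ P.1 ∣ x) (Z : F[X])
    [DecidablePred fun a : F[X] => P.1 ∣ a * x - Z] :
    ((monicOfDegree F P.1.natDegree).filter fun a => P.1 ∣ a * x - Z).card = 1 := by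
  rw [Finset.card_eq_one]
  obtain ⟨u, v, huv⟩ := (P.2.2.coprime_iff_not_dvd).2 hx
  set s := (Z * v) %ₘ P.1 with hs
  have hslt : s.degree < P.1.degree := degree_modByMonic_lt _ P.2.1
  have hmem : P.1 ∣ (P.1 + s) * x - Z := by
    have h1 := dvd_sub_modByMonic P.1 (Z * v)
    have h2 : (P.1 + s) * x - Z = P.1 * (x - u * Z) - (Z * v - s) * x := by
      linear_combination Z * huv
    rw [h2]
    exact dvd_sub (dvd_mul_right _ _) (h1.mul_right x)
  refine ⟨P.1 + s, Finset.ext fun a => ?_⟩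
  rw [Finset.mem_filter, mem_monicOfDegree, Finset.mem_singleton]
  constructor
  · rintro ⟨⟨ham, had⟩, hd⟩
    have h1 : P.1 ∣ (a - (P.1 + s)) * x := by
      have := dvd_sub hd hmem
      rwa [show a * x - Z - ((P.1 + s) * x - Z) = (a - (P.1 + s)) * x by ring] at this
    have h2 := (P.2.2.prime.dvd_or_dvd h1).resolve_right hx
    by_contra hne
    have h3 := degree_le_of_dvd h2 (sub_ne_zero.2 hne)
    have hPs : (P.1 + s).Monic := P.2.1.add_of_left hslt
    have h4 : (a - (P.1 + s)).degree < a.degree := degree_sub_lt_left (by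
      rw [degree_add_eq_left_of_degree_lt hslt, degree_eq_natDegree ham.ne_zero, had,
        degree_eq_natDegree P.ne_zero]) ham.ne_zero (by rw [ham.leadingCoeff, hPs.leadingCoeff])
    rw [degree_eq_natDegree ham.ne_zero, had, ← degree_eq_natDegree P.ne_zero] at h4
    exact absurd (h3.trans_lt h4) (lt_irrefl _)
  · rintro rfl
    exact ⟨⟨P.2.1.add_of_left hslt, natDegree_add_eq_left_of_degree_lt hslt⟩, hmem⟩

-- Each form excludes one residue class. The classes are distinct: a common solution `a` would
-- satisfy `P ∣ a * (x - y)`, hence `P ∣ a` and so `P ∣ Z`.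
open scoped Classical in
theorem monicAvg_dvd_or_dvd (P : MonicIrred F) {x y Z : F[X]} (hx : ¬ P.1 ∣ x) (hy : ¬ P.1 ∣ y)
    (hZ : ¬ P.1 ∣ Z) (hxy : ¬ P.1 ∣ x - y) :
    monicAvg P.1.natDegree
      (fun a => if P.1 ∣ a * x - Z ∨ P.1 ∣ a * y - Z then 1 else 0) = 2 * invNorm P := by
  have hdisj : ∀ a, ¬ (P.1 ∣ a * x - Z ∧ P.1 ∣ a * y - Z) := by
    rintro a ⟨h1, h2⟩
    have h3 : P.1 ∣ a * (x - y) := by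
      have := dvd_sub h1 h2
      rwa [show a * x - Z - (a * y - Z) = a * (x - y) by ring] at this
    have h4 := (P.2.2.prime.dvd_or_dvd h3).resolve_right hxy
    exact hZ ((dvd_sub_right (h4.mul_right x)).1 h1)
  rw [monicAvg, Finset.sum_boole, Finset.filter_or, Finset.card_union_of_disjoint,
    card_monicOfDegree_dvd_mul_sub P hx, card_monicOfDegree_dvd_mul_sub P hy, invNorm]
  · push_cast; ring
  · rw [Finset.disjoint_filter]
    exact fun a _ h1 h2 => hdisj a ⟨h1, h2⟩

open scoped Classical in
/-- An upper bound for the number of monic `a` of degree `n` such that `a * x - Z` and `a * y - Z`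
are both irreducible. -/
theorem card_irreducible_pair_le (hq : 3 ≤ Nat.card F) {N n k D : ℕ} (hn : 1 ≤ n)
    (hN : n + k = N) (hD : N ≤ 3 ^ D) {x y Z : F[X]} (hx : x.Monic) (hxk : x.natDegree = k)
    (hy : y.Monic) (hyk : y.natDegree = k) (hxy : x ≠ y) (hZ : Z.Monic)
    (hZN : Z.natDegree ≤ N - 1) :
    (((monicOfDegree F n).filter fun a => Irreducible (a * x - Z) ∧
      Irreducible (a * y - Z)).card : ℝ) ≤
      (Nat.card F : ℝ) ^ n * (8 * Real.exp (3 * (5 + Real.log D)) / n ^ 2) := by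
  set K := n / 2 with hK
  -- The primes dividing `m` are exactly those where the two excluded classes may fail to exist or
  -- may coincide. They are left out of the sieve, and their cost is the factor bounded in `hS`.
  set m := x * y * Z * (x - y) with hm
  have hm0 : m ≠ 0 :=
    mul_ne_zero (mul_ne_zero (mul_ne_zero hx.ne_zero hy.ne_zero) hZ.ne_zero) (sub_ne_zero.2 hxy)
  have hmdeg : m.natDegree ≤ 4 * N := by
    have h1 : (x - y).natDegree ≤ k := (natDegree_sub_le _ _).trans (by simp [hxk, hyk])
    have h2 : m.natDegree ≤ x.natDegree + y.natDegree + Z.natDegree + (x - y).natDegree :=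
      natDegree_mul_le.trans (Nat.add_le_add_right (natDegree_mul_le.trans
        (Nat.add_le_add_right natDegree_mul_le _)) _)
    omega
  set T := primesLE F K \ primeDivisors m with hT
  have hTm : ∀ P ∈ T, ¬ P.1 ∣ x ∧ ¬ P.1 ∣ y ∧ ¬ P.1 ∣ Z ∧ ¬ P.1 ∣ x - y := by
    intro P hP
    have h := fun h => (Finset.mem_sdiff.1 hP).2 ((mem_primeDivisors hm0).2 h)
    refine ⟨fun h' => h ?_, fun h' => h ?_, fun h' => h ?_, fun h' => h ?_⟩
    · exact ((h'.mul_right y).mul_right Z).mul_right _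
    · exact ((h'.mul_left x).mul_right Z).mul_right _
    · exact (h'.mul_left (x * y)).mul_right _
    · exact h'.mul_left _
  have hu3 := invNorm_le_third hq
  have hirr : ∀ a ∈ monicOfDegree F n, ∀ w : F[X], w.Monic → w.natDegree = k →
      Irreducible (a * w - Z) → ∀ P ∈ T, ¬ P.1 ∣ a * w - Z := by
    intro a ha w hw hwk hI P hP hd
    obtain ⟨ham, had⟩ := mem_monicOfDegree.1 ha
    have hlt : Z.natDegree < (a * w).natDegree := by
      rw [ham.natDegree_mul hw]; omega
    have h1 : (a * w - Z).natDegree = N := by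
      rw [natDegree_sub_eq_left_of_natDegree_lt hlt, ham.natDegree_mul hw]; omega
    have h2 := natDegree_eq_of_degree_eq (degree_eq_degree_of_associated
      (P.2.2.associated_of_dvd hI hd))
    have h3 := mem_primesLE.1 (Finset.mem_sdiff.1 hP).1
    omega
  have hsieve := selberg_sieve (n := n) (K := K) (by omega) T
    (fun P a => P.1 ∣ a * x - Z ∨ P.1 ∣ a * y - Z)
    (fun P a b hab => by
      have h : ∀ w : F[X], P.1 ∣ a * w - Z ↔ P.1 ∣ b * w - Z := fun w => by
        have : a * w - Z = (a - b) * w + (b * w - Z) := by ring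
        rw [this, dvd_add_right (hab.mul_right w)]
      simp only [h])
    (fun P => 2 * invNorm P) (fun P _ => by linarith [invNorm_pos P])
    (fun P _ => by linarith [hu3 P])
    (fun P hP => by
      convert monicAvg_dvd_or_dvd P (hTm P hP).1 (hTm P hP).2.1 (hTm P hP).2.2.1 (hTm P hP).2.2.2)
    ((monicOfDegree F n).filter fun a => Irreducible (a * x - Z) ∧ Irreducible (a * y - Z))
    (Finset.filter_subset _ _) (fun a ha P hP => by
      obtain ⟨h1, h2, h3⟩ := Finset.mem_filter.1 ha
      exact not_or.2 ⟨hirr a h1 x hx hxk h2 P hP, hirr a h1 y hy hyk h3 P hP⟩)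
  have hL := selberg_density_lower_bound hq K T Finset.sdiff_subset
  -- At most `deg m ≤ 4 * N ≤ 4 * 3^D` primes are left out, which turns `1 + log D` into `5 + log
  -- D`.
  have hS : ∏ P ∈ primesLE F K \ T, ((1 - invNorm P)⁻¹) ^ 2 ≤
      Real.exp (3 * (5 + Real.log D)) := by
    refine (prod_inv_one_sub_invNorm_sq_le hq _ D).trans ?_
    have h1 : (primesLE F K \ T).card ≤ 4 * N := by
      refine (Finset.card_le_card (t := primeDivisors m) fun P hP => ?_).trans
        ((card_primeDivisors_le hm0).trans hmdeg)
      simp only [hT, Finset.mem_sdiff, not_and, not_not] at hP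
      exact hP.2 hP.1
    have h2 : ((primesLE F K \ T).card : ℝ) ≤ 4 * 3 ^ D := by
      exact_mod_cast h1.trans (by omega)
    have h3 : ((primesLE F K \ T).card : ℝ) / 3 ^ D ≤ 4 := by
      rw [div_le_iff₀ (by positivity)]; exact h2
    exact Real.exp_le_exp.2 (by linarith)
  set L := ∑ Q ∈ T.powerset with ∑ P ∈ Q, P.1.natDegree ≤ K,
        ∏ P ∈ Q, 2 * invNorm P / (1 - 2 * invNorm P) with hLdef
  set E := Real.exp (3 * (5 + Real.log D)) with hE
  have hE0 : 0 < E := Real.exp_pos _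
  have hL0 : 0 ≤ L := Finset.sum_nonneg fun Q _ => Finset.prod_nonneg fun P _ =>
    div_nonneg (by linarith [invNorm_pos P]) (by linarith [hu3 P])
  have hLE : (n : ℝ) ^ 2 / 8 ≤ L * E := by
    refine le_trans ?_ (hL.trans (mul_le_mul_of_nonneg_left hS hL0))
    have hnK : (n : ℝ) ≤ 2 * K + 1 := by exact_mod_cast (by omega : n ≤ 2 * K + 1)
    have hn0 : (0 : ℝ) ≤ n := by positivity
    nlinarith [(Nat.cast_nonneg K : (0 : ℝ) ≤ K)]
  have hn0 : (0 : ℝ) < n := by exact_mod_cast hn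
  set c : ℝ := (((monicOfDegree F n).filter fun a => Irreducible (a * x - Z) ∧
      Irreducible (a * y - Z)).card : ℝ) with hc
  have hc0 : 0 ≤ c := by positivity
  rw [mul_div_assoc', le_div_iff₀ (by positivity)]
  calc c * n ^ 2 = c * (n ^ 2 / 8) * 8 := by ring
    _ ≤ c * (L * E) * 8 := by gcongr
    _ = (c * L) * E * 8 := by ring
    _ ≤ (Nat.card F : ℝ) ^ n * E * 8 := by gcongr
    _ = _ := by ring

end PairSieve

/-! ### Rarity of polynomials without a usable leading prime -/

section Exceptional

variable {F : Type*} [Field F]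

/-- `a` has a prime factor of degree at least `M` and no square factor `b ^ 2`, `deg b ≥ J`. -/
def HasLargePrime (M J : ℕ) (a : F[X]) : Prop :=
  (∃ P : MonicIrred F, P.1 ∣ a ∧ M ≤ P.1.natDegree) ∧
    ∀ b : F[X], b.Monic → J ≤ b.natDegree → ¬ b ^ 2 ∣ a

theorem prime_dvd_prod_iff {s : Finset (MonicIrred F)} {P : MonicIrred F} :
    P.1 ∣ ∏ Q ∈ s, Q.1 ↔ P ∈ s := by
  refine ⟨fun h => ?_, fun h => Finset.dvd_prod_of_mem (fun Q : MonicIrred F => Q.1) h⟩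
  obtain ⟨Q, hQ, hd⟩ := (P.2.2.prime.dvd_finsetProd_iff _).1 h
  by_contra hP
  have hne : P ≠ Q := fun e => hP (e ▸ hQ)
  exact (P.2.2.coprime_iff_not_dvd).1 (coprime_monicIrred hne) hd

/-- Halving the exponents, rounded down, gives `b` with `b^2 ∣ a`, hence `deg b < J`. What remains
of `a` is a product of distinct primes, each of degree below `M`. -/
theorem two_mul_add_mul_card_primeDivisors {M J : ℕ} {a : F[X]} (ha : a.Monic)
    (hs : ∀ b : F[X], b.Monic → J ≤ b.natDegree → ¬ b ^ 2 ∣ a)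
    (hM : ∀ P : MonicIrred F, P.1 ∣ a → P.1.natDegree < M) :
    a.natDegree ≤ 2 * J + M * (primeDivisors a).card := by
  set b := ∏ P ∈ primeDivisors a, P.1 ^ (expo a P / 2) with hb
  have hbm : b.Monic := monic_prod_of_monic _ _ fun P _ => P.2.1.pow _
  have hbd : b ^ 2 ∣ a := by
    conv_rhs => rw [← prod_primeDivisors_pow_expo ha]
    rw [hb, ← Finset.prod_pow]
    refine Finset.prod_dvd_prod_of_dvd _ _ fun P _ => ?_
    rw [← pow_mul]
    exact pow_dvd_pow _ (by omega)
  have hbJ : b.natDegree < J := by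
    by_contra h
    exact hs b hbm (by omega) hbd
  rw [hb, natDegree_prod_pow] at hbJ
  have h1 : a.natDegree = ∑ P ∈ primeDivisors a, expo a P * P.1.natDegree := by
    conv_lhs => rw [← prod_primeDivisors_pow_expo ha, natDegree_prod_pow]
  have h2 : ∑ P ∈ primeDivisors a, expo a P * P.1.natDegree ≤
      ∑ P ∈ primeDivisors a, (2 * (expo a P / 2 * P.1.natDegree) + M) := by
    refine Finset.sum_le_sum fun P hP => ?_
    have h3 := hM P ((mem_primeDivisors ha.ne_zero).1 hP)
    have h4 : expo a P ≤ 2 * (expo a P / 2) + 1 := by omega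
    nlinarith [Nat.mul_le_mul_right P.1.natDegree h4]
  rw [Finset.sum_add_distrib, ← Finset.mul_sum, Finset.sum_const, smul_eq_mul] at h2
  nlinarith

variable [Finite F]

variable (F) in
/-- Pairs of monic polynomials of total degree `N`. -/
noncomputable def monicPairsEq (N : ℕ) : Finset (F[X] × F[X]) := by
  classical
  exact (Finset.range (N + 1)).biUnion fun i => monicOfDegree F i ×ˢ monicOfDegree F (N - i)

theorem card_monicPairsEq_le (N : ℕ) :
    (monicPairsEq F N).card ≤ (N + 1) * Nat.card F ^ N := by
  classical
  refine Finset.card_biUnion_le.trans ?_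
  rw [Finset.sum_congr rfl (g := fun _ => Nat.card F ^ N)]
  · simp
  · intro i hi
    rw [Finset.mem_range] at hi
    rw [Finset.card_product, card_monicOfDegree, card_monicOfDegree, ← pow_add]
    congr 1; omega

-- Each set of prime divisors of `a` gives a different factorization of `a` into two monic factors.
open scoped Classical in
theorem two_pow_card_primeDivisors_le {N : ℕ} {a : F[X]} (ha : a ∈ monicOfDegree F N) :
    2 ^ (primeDivisors a).card ≤ ((monicPairsEq F N).filter fun x => x.1 * x.2 = a).card := by
  obtain ⟨ham, haN⟩ := mem_monicOfDegree.1 ha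
  rw [← Finset.card_powerset]
  have hd : ∀ s ∈ (primeDivisors a).powerset, ∏ P ∈ s, P.1 ∣ a := fun s hs =>
    Finset.prod_dvd_of_coprime (fun P _ Q _ h => coprime_monicIrred h)
      fun P hP => (mem_primeDivisors ham.ne_zero).1 (Finset.mem_powerset.1 hs hP)
  have hm : ∀ s : Finset (MonicIrred F), (∏ P ∈ s, P.1).Monic := fun s =>
    monic_prod_of_monic _ _ fun P _ => P.2.1
  have hmul : ∀ s ∈ (primeDivisors a).powerset,
      (∏ P ∈ s, P.1) * (a /ₘ ∏ P ∈ s, P.1) = a := fun s hs => by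
    have h1 := modByMonic_add_div a (∏ P ∈ s, P.1)
    rwa [(modByMonic_eq_zero_iff_dvd (hm s)).2 (hd s hs), zero_add] at h1
  refine Finset.card_le_card_of_injOn (fun s => (∏ P ∈ s, P.1, a /ₘ ∏ P ∈ s, P.1)) ?_ ?_
  · intro s hs
    have hs' : s ∈ (primeDivisors a).powerset := hs
    have h1 := hmul s hs'
    have h2 : (a /ₘ ∏ P ∈ s, P.1).Monic := (hm s).of_mul_monic_left (by rwa [h1])
    have h3 := (hm s).natDegree_mul h2
    rw [h1, haN] at h3
    simp only [Finset.coe_filter, Set.mem_ofPred_eq, h1, and_true, monicPairsEq, Finset.mem_biUnion,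
      Finset.mem_range, Finset.mem_product, mem_monicOfDegree]
    exact ⟨_, by omega, ⟨hm s, rfl⟩, h2, by omega⟩
  · intro s _ s' _ h
    have h1 := congrArg Prod.fst h
    simp only at h1
    ext P
    rw [← prime_dvd_prod_iff, h1, prime_dvd_prod_iff]

-- With `deg b = j`, there are at most `q^(j + N - 2j) = q^(N - j)` products `b^2 * c`.
open scoped Classical in
theorem card_large_square_factor_le (hq : 3 ≤ Nat.card F) (N J : ℕ) :
    (((monicOfDegree F N).filter fun a =>
      ∃ b : F[X], b.Monic ∧ J ≤ b.natDegree ∧ b ^ 2 ∣ a).card : ℝ) ≤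
      (N + 1) * ((Nat.card F : ℝ) ^ N / 3 ^ J) := by
  have hq' : (3 : ℝ) ≤ Nat.card F := by exact_mod_cast hq
  set I := (Finset.range (N + 1)).filter fun j => J ≤ j ∧ 2 * j ≤ N with hI
  have hsub : ((monicOfDegree F N).filter fun a =>
      ∃ b : F[X], b.Monic ∧ J ≤ b.natDegree ∧ b ^ 2 ∣ a) ⊆
      I.biUnion fun j => (monicOfDegree F j ×ˢ monicOfDegree F (N - 2 * j)).image
        fun x => x.1 ^ 2 * x.2 := by
    intro a ha
    obtain ⟨ha, b, hb, hJ, c, rfl⟩ := Finset.mem_filter.1 ha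
    obtain ⟨ham, haN⟩ := mem_monicOfDegree.1 ha
    have hc : c.Monic := (hb.pow 2).of_mul_monic_left ham
    rw [(hb.pow 2).natDegree_mul hc, natDegree_pow] at haN
    refine Finset.mem_biUnion.2 ⟨b.natDegree, ?_, Finset.mem_image.2 ⟨(b, c), ?_, rfl⟩⟩
    · rw [hI, Finset.mem_filter, Finset.mem_range]; omega
    · rw [Finset.mem_product, mem_monicOfDegree, mem_monicOfDegree]
      exact ⟨⟨hb, rfl⟩, hc, by simp only; omega⟩
  calc _ ≤ ((I.biUnion fun j => (monicOfDegree F j ×ˢ monicOfDegree F (N - 2 * j)).image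
        fun x => x.1 ^ 2 * x.2).card : ℝ) := by exact_mod_cast Finset.card_le_card hsub
    _ ≤ ∑ j ∈ I, (((monicOfDegree F j ×ˢ monicOfDegree F (N - 2 * j)).image
        fun x => x.1 ^ 2 * x.2).card : ℝ) := by exact_mod_cast Finset.card_biUnion_le
    _ ≤ ∑ j ∈ I, (Nat.card F : ℝ) ^ N / 3 ^ J := by
        refine Finset.sum_le_sum fun j hj => ?_
        obtain ⟨_, hJ, hj2⟩ := Finset.mem_filter.1 hj
        have h1 := Finset.card_image_le (s := monicOfDegree F j ×ˢ monicOfDegree F (N - 2 * j))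
          (f := fun x => x.1 ^ 2 * x.2)
        rw [Finset.card_product, card_monicOfDegree, card_monicOfDegree, ← pow_add] at h1
        rw [le_div_iff₀ (by positivity)]
        calc _ ≤ (Nat.card F : ℝ) ^ (j + (N - 2 * j)) * (Nat.card F : ℝ) ^ J := by
              gcongr
              exact_mod_cast h1
          _ = (Nat.card F : ℝ) ^ (j + (N - 2 * j) + J) := (pow_add _ _ _).symm
          _ ≤ _ := pow_le_pow_right₀ (by linarith) (by omega)
    _ ≤ _ := by
        rw [Finset.sum_const, nsmul_eq_mul]
        gcongr
        exact_mod_cast (Finset.card_filter_le _ _).trans (by simp)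

-- Without large squares or large primes, `a` must have at least `R` prime factors. Such `a` have at
-- least `2^R` factorizations each, against a total of at most `(N + 1) q^N` pairs.
open scoped Classical in
theorem card_not_hasLargePrime_le (hq : 3 ≤ Nat.card F) {N M J R : ℕ} (hM : 0 < M)
    (hR : 2 * J + M * R ≤ N) :
    (((monicOfDegree F N).filter fun a => ¬ HasLargePrime M J a).card : ℝ) ≤
      (N + 1) * (Nat.card F : ℝ) ^ N * (1 / 3 ^ J + 1 / 2 ^ R) := by
  set A1 := (monicOfDegree F N).filter fun a =>
      ∃ b : F[X], b.Monic ∧ J ≤ b.natDegree ∧ b ^ 2 ∣ a with hA1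
  set A2 := (monicOfDegree F N).filter fun a => R ≤ (primeDivisors a).card with hA2
  have hsub : ((monicOfDegree F N).filter fun a => ¬ HasLargePrime M J a) ⊆ A1 ∪ A2 := by
    intro a ha
    obtain ⟨ha, hna⟩ := Finset.mem_filter.1 ha
    obtain ⟨ham, haN⟩ := mem_monicOfDegree.1 ha
    by_cases h1 : ∃ b : F[X], b.Monic ∧ J ≤ b.natDegree ∧ b ^ 2 ∣ a
    · exact Finset.mem_union_left _ (Finset.mem_filter.2 ⟨ha, h1⟩)
    · refine Finset.mem_union_right _ (Finset.mem_filter.2 ⟨ha, ?_⟩)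
      have h2 : ∀ b : F[X], b.Monic → J ≤ b.natDegree → ¬ b ^ 2 ∣ a := fun b hb hJ hd =>
        h1 ⟨b, hb, hJ, hd⟩
      have h3 : ∀ P : MonicIrred F, P.1 ∣ a → P.1.natDegree < M := fun P hP => by
        by_contra h
        exact hna ⟨⟨P, hP, by omega⟩, h2⟩
      have h4 := two_mul_add_mul_card_primeDivisors ham h2 h3
      rw [haN] at h4
      exact Nat.le_of_mul_le_mul_left (by omega) hM
  have hc2 : (A2.card : ℝ) ≤ (N + 1) * ((Nat.card F : ℝ) ^ N / 2 ^ R) := by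
    have h1 : A2.card * 2 ^ R ≤ (N + 1) * Nat.card F ^ N := by
      calc A2.card * 2 ^ R = ∑ a ∈ A2, 2 ^ R := by simp
        _ ≤ ∑ a ∈ A2, ((monicPairsEq F N).filter fun x => x.1 * x.2 = a).card := by
            refine Finset.sum_le_sum fun a ha => ?_
            obtain ⟨ha, hRa⟩ := Finset.mem_filter.1 ha
            exact (Nat.pow_le_pow_right (by norm_num) hRa).trans (two_pow_card_primeDivisors_le ha)
        _ = (A2.biUnion fun a => (monicPairsEq F N).filter fun x => x.1 * x.2 = a).card := by
            rw [Finset.card_biUnion]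
            intro a _ b _ hab
            refine Finset.disjoint_left.2 fun x hx hx' => hab ?_
            exact (Finset.mem_filter.1 hx).2.symm.trans (Finset.mem_filter.1 hx').2
        _ ≤ (monicPairsEq F N).card := Finset.card_le_card
            (Finset.biUnion_subset.2 fun a _ => Finset.filter_subset _ _)
        _ ≤ _ := card_monicPairsEq_le N
    rw [mul_div_assoc', le_div_iff₀ (by positivity)]
    exact_mod_cast h1
  have hc1 := card_large_square_factor_le hq N J
  calc _ ≤ ((A1 ∪ A2).card : ℝ) := by exact_mod_cast Finset.card_le_card hsub
    _ ≤ A1.card + A2.card := by exact_mod_cast Finset.card_union_le _ _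
    _ ≤ (N + 1) * ((Nat.card F : ℝ) ^ N / 3 ^ J) + (N + 1) * ((Nat.card F : ℝ) ^ N / 2 ^ R) := by
        gcongr
    _ = _ := by ring

end Exceptional

/-! ### Orthogonality and moments of Steinhaus functions -/

section Steinhaus

variable {F : Type*} [Field F] {Ω : Type*} [MeasurableSpace Ω] {μ : Measure Ω}
  {f : F[X] → Ω → ℂ}

theorem IsSteinhaus.eq_prod (hf : IsSteinhaus f μ) {a : F[X]} (ha : a.Monic)
    {s : Finset (MonicIrred F)} (hs : ∀ P : MonicIrred F, P.1 ∣ a → P ∈ s) (ω : Ω) :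
    f a ω = ∏ P ∈ s, f P.1 ω ^ expo a P := by
  conv_lhs => rw [← prod_pow_expo ha hs, hf.map_prod_pow s (expo a) ω]

theorem IsSteinhaus.map_mul (hf : IsSteinhaus f μ) {a b : F[X]} (ha : a.Monic) (hb : b.Monic)
    (ω : Ω) : f (a * b) ω = f a ω * f b ω := by
  have h0 := (ha.mul hb).ne_zero
  rw [hf.eq_prod (ha.mul hb) (s := primeDivisors (a * b))
      (fun P hP => (mem_primeDivisors h0).2 hP),
    hf.eq_prod ha (s := primeDivisors (a * b))
      (fun P hP => (mem_primeDivisors h0).2 (hP.mul_right b)),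
    hf.eq_prod hb (s := primeDivisors (a * b))
      (fun P hP => (mem_primeDivisors h0).2 (hP.mul_left a)), ← Finset.prod_mul_distrib]
  exact Finset.prod_congr rfl fun P _ => by rw [expo_mul ha.ne_zero hb.ne_zero, pow_add]

theorem IsSteinhaus.map_one (hf : IsSteinhaus f μ) (ω : Ω) : f 1 ω = 1 := by
  simpa using hf.map_prod_pow ∅ (fun _ => 0) ω

theorem IsSteinhaus.measurable_monic (hf : IsSteinhaus f μ) {a : F[X]} (ha : a.Monic) :
    Measurable (f a) := by
  have h : f a = fun ω => ∏ P ∈ primeDivisors a, f P.1 ω ^ expo a P := funext fun ω =>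
    hf.eq_prod ha (fun P hP => (mem_primeDivisors ha.ne_zero).2 hP) ω
  rw [h]
  exact Finset.measurable_fun_prod _ fun P _ => (hf.measurable P).pow_const _

theorem IsSteinhaus.norm_eq_one (hf : IsSteinhaus f μ) {a : F[X]} (ha : a.Monic) :
    ∀ᵐ ω ∂μ, ‖f a ω‖ = 1 := by
  have h1 : ∀ P : MonicIrred F, ∀ᵐ ω ∂μ, ‖f P.1 ω‖ = 1 := fun P => by
    have h := norm_eq_one_ae_uniformCircle
    rw [← hf.uniform P] at h
    exact ae_of_ae_map (hf.measurable P).aemeasurable h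
  have h2 : ∀ᵐ ω ∂μ, ∀ P ∈ primeDivisors a, ‖f P.1 ω‖ = 1 :=
    (Filter.eventually_all_finset _).2 fun P _ => h1 P
  filter_upwards [h2] with ω hω
  rw [hf.eq_prod ha (fun P hP => (mem_primeDivisors ha.ne_zero).2 hP) ω, norm_prod]
  refine Finset.prod_eq_one fun P hP => ?_
  rw [norm_pow, hω P hP, one_pow]

/-- Independence splits the integral over primes, and a prime with different exponents in `a` and
`b` contributes a vanishing circle moment. -/
theorem IsSteinhaus.integral_mul_conj [IsProbabilityMeasure μ] (hf : IsSteinhaus f μ)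
    {a b : F[X]} (ha : a.Monic) (hb : b.Monic) [Decidable (a = b)] :
    ∫ ω, f a ω * starRingEnd ℂ (f b ω) ∂μ = if a = b then 1 else 0 := by
  classical
  set s := primeDivisors a ∪ primeDivisors b with hs
  have hsa : ∀ P : MonicIrred F, P.1 ∣ a → P ∈ s := fun P hP =>
    Finset.mem_union_left _ ((mem_primeDivisors ha.ne_zero).2 hP)
  have hsb : ∀ P : MonicIrred F, P.1 ∣ b → P ∈ s := fun P hP =>
    Finset.mem_union_right _ ((mem_primeDivisors hb.ne_zero).2 hP)
  have e : ∀ ω, f a ω * starRingEnd ℂ (f b ω) = ∏ P : s,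
      (fun u : ℂ => u ^ expo a P.1 * starRingEnd ℂ u ^ expo b P.1) (f P.1.1 ω) := fun ω => by
    rw [hf.eq_prod ha hsa, hf.eq_prod hb hsb, _root_.map_prod, ← Finset.prod_mul_distrib,
      ← Finset.prod_coe_sort]
    simp only [_root_.map_pow]
  have hind : iIndepFun (fun (P : s) => f P.1.1) μ :=
    hf.indep.precomp (g := fun P : s => P.1) Subtype.val_injective
  rw [integral_congr_ae (Eventually.of_forall e), hind.integral_fun_prod_comp
    (f := fun (P : s) (u : ℂ) => u ^ expo a P.1 * starRingEnd ℂ u ^ expo b P.1) (fun P => (hf.measurable P.1).aemeasurable)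
    (fun P => Measurable.aestronglyMeasurable (by fun_prop))]
  have h1 : ∀ P : s, ∫ ω, (fun u : ℂ => u ^ expo a P.1 * starRingEnd ℂ u ^ expo b P.1)
      (f P.1.1 ω) ∂μ = if expo a P.1 = expo b P.1 then 1 else 0 := fun P => by
    rw [← integral_pow_mul_conj_pow_uniformCircle, ← hf.uniform P.1,
      integral_map (hf.measurable P.1).aemeasurable (Measurable.aestronglyMeasurable (by fun_prop))]
  rw [Finset.prod_congr rfl fun P _ => h1 P]
  split_ifs with hab
  · subst hab; simp
  · have : ∃ P : MonicIrred F, expo a P ≠ expo b P := by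
      by_contra h
      push Not at h
      exact hab (monic_eq_of_expo_eq ha hb h)
    obtain ⟨P, hP⟩ := this
    have hPs : P ∈ s := by
      by_contra h
      exact hP (((expo_eq_zero_iff P).2 fun hd => h (hsa P hd)).trans
        ((expo_eq_zero_iff P).2 fun hd => h (hsb P hd)).symm)
    refine Finset.prod_eq_zero (i := (⟨P, hPs⟩ : s)) (Finset.mem_univ _) ?_
    rw [if_neg hP]

open scoped Classical in
/-- The number of pairs `(a, c), (a', c')` in `Q` with `a * c' = a' * c`. -/
noncomputable def crossEnergy (Q : Finset (F[X] × F[X])) : ℕ :=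
  ((Q ×ˢ Q).filter fun z => z.1.1 * z.2.2 = z.2.1 * z.1.2).card

theorem IsSteinhaus.integrable_sum [IsFiniteMeasure μ] (hf : IsSteinhaus f μ)
    {Q : Finset (F[X] × F[X])} (hQ : ∀ x ∈ Q, x.1.Monic ∧ x.2.Monic) (k : ℕ) :
    Integrable (fun ω => ‖∑ x ∈ Q, f x.1 ω * starRingEnd ℂ (f x.2 ω)‖ ^ k) μ := by
  have hm : Measurable fun ω => ∑ x ∈ Q, f x.1 ω * starRingEnd ℂ (f x.2 ω) :=
    Finset.measurable_fun_sum _ fun x hx => (hf.measurable_monic (hQ x hx).1).mul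
      (Complex.continuous_conj.measurable.comp (hf.measurable_monic (hQ x hx).2))
  refine Integrable.of_bound (hm.norm.pow_const k).aestronglyMeasurable ((Q.card : ℝ) ^ k) ?_
  have h : ∀ᵐ ω ∂μ, ∀ x ∈ Q, ‖f x.1 ω‖ = 1 ∧ ‖f x.2 ω‖ = 1 :=
    (Filter.eventually_all_finset _).2 fun x hx =>
      (hf.norm_eq_one (hQ x hx).1).and (hf.norm_eq_one (hQ x hx).2)
  filter_upwards [h] with ω hω
  rw [Real.norm_eq_abs, abs_of_nonneg (by positivity)]
  gcongr
  refine (norm_sum_le _ _).trans ?_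
  rw [Finset.sum_congr rfl (g := fun _ => (1 : ℝ)) fun x hx => by
    rw [norm_mul, RCLike.norm_conj, (hω x hx).1, (hω x hx).2, one_mul]]
  simp

/-- By multiplicativity the cross term of `(a, c)` and `(a', c')` is `f(a c')` times the conjugate
of `f(a' c)`, so orthogonality counts the solutions of `a c' = a' c`. -/
theorem IsSteinhaus.integral_norm_sq_sum [IsProbabilityMeasure μ] (hf : IsSteinhaus f μ)
    {Q : Finset (F[X] × F[X])} (hQ : ∀ x ∈ Q, x.1.Monic ∧ x.2.Monic) :
    ∫ ω, ‖∑ x ∈ Q, f x.1 ω * starRingEnd ℂ (f x.2 ω)‖ ^ 2 ∂μ = crossEnergy Q := by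
  classical
  have e : ∀ ω, ((‖∑ x ∈ Q, f x.1 ω * starRingEnd ℂ (f x.2 ω)‖ ^ 2 : ℝ) : ℂ) =
      ∑ z ∈ Q ×ˢ Q, f (z.1.1 * z.2.2) ω * starRingEnd ℂ (f (z.2.1 * z.1.2) ω) := fun ω => by
    rw [Complex.ofReal_pow, ← Complex.mul_conj', map_sum, Finset.sum_mul_sum,
      ← Finset.sum_product']
    refine Finset.sum_congr rfl fun z hz => ?_
    obtain ⟨h1, h2⟩ := Finset.mem_product.1 hz
    rw [hf.map_mul (hQ _ h1).1 (hQ _ h2).2, hf.map_mul (hQ _ h2).1 (hQ _ h1).2]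
    simp only [_root_.map_mul, Complex.conj_conj]
    ring
  have hint : ∀ z ∈ Q ×ˢ Q, Integrable (fun ω => f (z.1.1 * z.2.2) ω *
      starRingEnd ℂ (f (z.2.1 * z.1.2) ω)) μ := fun z hz => by
    obtain ⟨h1, h2⟩ := Finset.mem_product.1 hz
    have m1 := (hQ _ h1).1.mul (hQ _ h2).2
    have m2 := (hQ _ h2).1.mul (hQ _ h1).2
    refine Integrable.of_bound ((hf.measurable_monic m1).mul
      (Complex.continuous_conj.measurable.comp (hf.measurable_monic m2))).aestronglyMeasurable 1 ?_
    filter_upwards [hf.norm_eq_one m1, hf.norm_eq_one m2] with ω w1 w2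
    rw [norm_mul, RCLike.norm_conj, w1, w2, one_mul]
  apply Complex.ofReal_injective
  rw [← integral_complex_ofReal]
  simp_rw [e]
  rw [integral_finsetSum _ hint, Finset.sum_congr rfl fun z hz => by
    obtain ⟨h1, h2⟩ := Finset.mem_product.1 hz
    rw [hf.integral_mul_conj ((hQ _ h1).1.mul (hQ _ h2).2) ((hQ _ h2).1.mul (hQ _ h1).2)]]
  rw [Finset.sum_boole, crossEnergy]
  norm_cast

theorem integral_le_sqrt_integral_sq [IsProbabilityMeasure μ] {g : Ω → ℝ} (h1 : Integrable g μ)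
    (h2 : Integrable (fun ω => g ω ^ 2) μ) : ∫ ω, g ω ∂μ ≤ √(∫ ω, g ω ^ 2 ∂μ) := by
  refine Real.le_sqrt_of_sq_le ?_
  set c := ∫ ω, g ω ∂μ with hc
  have h : 0 ≤ ∫ ω, (g ω ^ 2 + ((-2 * c) * g ω + c ^ 2)) ∂μ :=
    integral_nonneg fun ω => by
      have := sq_nonneg (g ω - c)
      simp only [Pi.zero_apply]
      linarith
  have h3 : Integrable (fun ω => (-2 * c) * g ω + c ^ 2) μ :=
    (h1.const_mul _).add (integrable_const _)
  rw [integral_add h2 h3, integral_add (h1.const_mul _) (integrable_const _), integral_const_mul, ← hc] at h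
  simp at h
  linarith

theorem IsSteinhaus.integral_norm_sum_le [IsProbabilityMeasure μ] (hf : IsSteinhaus f μ)
    {Q : Finset (F[X] × F[X])} (hQ : ∀ x ∈ Q, x.1.Monic ∧ x.2.Monic) :
    ∫ ω, ‖∑ x ∈ Q, f x.1 ω * starRingEnd ℂ (f x.2 ω)‖ ∂μ ≤ √(crossEnergy Q) := by
  rw [← hf.integral_norm_sq_sum hQ]
  refine integral_le_sqrt_integral_sq ?_ (hf.integrable_sum hQ 2)
  simpa using hf.integrable_sum hQ 1

/-- Special case of pairs `(a, 1)`, whose energy equation reduces to `a = a'`. -/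
theorem IsSteinhaus.integral_norm_sum_single_le [IsProbabilityMeasure μ] (hf : IsSteinhaus f μ)
    {B : Finset F[X]} (hB : ∀ a ∈ B, a.Monic) :
    ∫ ω, ‖∑ a ∈ B, f a ω‖ ∂μ ≤ √B.card := by
  classical
  have hinj : Set.InjOn (fun a : F[X] => (a, (1 : F[X]))) B := fun a _ b _ h =>
    congrArg Prod.fst h
  have hQ : ∀ x ∈ B.image (fun a => (a, (1 : F[X]))), x.1.Monic ∧ x.2.Monic := by
    intro x hx
    obtain ⟨a, ha, rfl⟩ := Finset.mem_image.1 hx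
    exact ⟨hB a ha, monic_one⟩
  have h := hf.integral_norm_sum_le hQ
  have e : ∀ ω, ∑ x ∈ B.image (fun a => (a, (1 : F[X]))), f x.1 ω * starRingEnd ℂ (f x.2 ω) =
      ∑ a ∈ B, f a ω := fun ω => by
    rw [Finset.sum_image hinj]
    exact Finset.sum_congr rfl fun a _ => by rw [hf.map_one]; simp
  simp_rw [e] at h
  refine h.trans (Real.sqrt_le_sqrt ?_)
  rw [crossEnergy]
  norm_cast
  refine Finset.card_le_card_of_injOn (fun z => z.1.1) ?_ ?_
  · intro z hz
    obtain ⟨hz, _⟩ := Finset.mem_filter.1 hz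
    obtain ⟨a, ha, h⟩ := Finset.mem_image.1 (Finset.mem_product.1 hz).1
    simp only [← h]
    exact ha
  · intro z hz z' hz' hzz
    obtain ⟨hz, hz2⟩ := Finset.mem_filter.1 hz
    obtain ⟨hz', hz2'⟩ := Finset.mem_filter.1 hz'
    obtain ⟨a, ha, h1⟩ := Finset.mem_image.1 (Finset.mem_product.1 hz).1
    obtain ⟨b, hb, h2⟩ := Finset.mem_image.1 (Finset.mem_product.1 hz).2
    obtain ⟨a', ha', h1'⟩ := Finset.mem_image.1 (Finset.mem_product.1 hz').1
    obtain ⟨b', hb', h2'⟩ := Finset.mem_image.1 (Finset.mem_product.1 hz').2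
    obtain ⟨z1, z2⟩ := z
    obtain ⟨z1', z2'⟩ := z'
    simp only at h1 h2 h1' h2' hzz hz2 hz2'
    subst h1 h2 h1' h2'
    simp only [mul_one] at hzz hz2 hz2'
    subst hzz hz2 hz2'
    rfl

end Steinhaus

/-! ### From the phase central limit theorem to Steinhaus functions -/

section SteinhausCLT

theorem norm_exp_mul_I_sub_le (x y : ℝ) :
    ‖Complex.exp (x * Complex.I) - Complex.exp (y * Complex.I)‖ ≤ |x - y| := by
  have e : Complex.exp (x * Complex.I) - Complex.exp (y * Complex.I) =
      Complex.exp (y * Complex.I) * (Complex.exp (Complex.I * ((x - y : ℝ) : ℂ)) - 1) := by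
    rw [mul_sub, ← Complex.exp_add, mul_one]
    congr 2
    push_cast; ring
  rw [e, norm_mul, Complex.norm_exp_ofReal_mul_I, one_mul]
  exact Real.norm_exp_I_mul_ofReal_sub_one_le

variable {F : Type*} [Field F] {Ω : Type*} [MeasurableSpace Ω] {μ : Measure Ω}
  [IsProbabilityMeasure μ] {f : F[X] → Ω → ℂ}

open scoped Classical in
/-- The pairs of distinct elements of `G` with the same leading prime. -/
noncomputable def leadPairs (G : Finset F[X]) (lead : F[X] → MonicIrred F) :
    Finset (F[X] × F[X]) :=
  (G ×ˢ G).filter fun x => x.1 ≠ x.2 ∧ lead x.1 = lead x.2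

open scoped Classical in
/-- The elements of `G` with leading prime `P`. -/
noncomputable def leadFiber (G : Finset F[X]) (lead : F[X] → MonicIrred F) (P : MonicIrred F) :
    Finset F[X] :=
  G.filter fun a => lead a = P

theorem mem_leadFiber {G : Finset F[X]} {lead : F[X] → MonicIrred F} {P : MonicIrred F}
    {a : F[X]} : a ∈ leadFiber G lead P ↔ a ∈ G ∧ lead a = P := by
  simp [leadFiber]

theorem sum_leadFiber {M : Type*} [AddCommMonoid M] {G : Finset F[X]}
    {lead : F[X] → MonicIrred F} {s : Finset (MonicIrred F)} (hs : ∀ a ∈ G, lead a ∈ s)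
    (g : F[X] → M) : ∑ P ∈ s, ∑ a ∈ leadFiber G lead P, g a = ∑ a ∈ G, g a := by
  classical
  rw [← Finset.sum_fiberwise_of_maps_to hs]
  refine Finset.sum_congr rfl fun P _ => Finset.sum_congr ?_ fun _ _ => rfl
  ext a
  simp [mem_leadFiber]

theorem mem_leadPairs {G : Finset F[X]} {lead : F[X] → MonicIrred F} {x : F[X] × F[X]} :
    x ∈ leadPairs G lead ↔ (x.1 ∈ G ∧ x.2 ∈ G) ∧ x.1 ≠ x.2 ∧ lead x.1 = lead x.2 := by
  simp [leadPairs]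

theorem norm_sq_sum_eq {α : Type*} [DecidableEq α] (B : Finset α) (g : α → ℂ)
    (hg : ∀ a ∈ B, ‖g a‖ = 1) :
    ((‖∑ a ∈ B, g a‖ ^ 2 : ℝ) : ℂ) = B.card +
      ∑ x ∈ (B ×ˢ B).filter (fun x => x.1 ≠ x.2), g x.1 * starRingEnd ℂ (g x.2) := by
  rw [Complex.ofReal_pow, ← Complex.mul_conj', map_sum, Finset.sum_mul_sum,
    ← Finset.sum_product', ← Finset.sum_filter_add_sum_filter_not (B ×ˢ B) (fun x => x.1 = x.2)]
  congr 1
  have e : (B ×ˢ B).filter (fun x => x.1 = x.2) = B.image fun a => (a, a) := by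
    ext ⟨a, b⟩
    simp only [Finset.mem_filter, Finset.mem_product, Finset.mem_image, Prod.mk.injEq]
    constructor
    · rintro ⟨⟨h1, _⟩, h3⟩; exact ⟨a, h1, rfl, h3⟩
    · rintro ⟨c, hc, rfl, rfl⟩; exact ⟨⟨hc, hc⟩, rfl⟩
  rw [e, Finset.sum_image fun a _ b _ h => congrArg Prod.fst h,
    Finset.sum_congr rfl (g := fun _ => (1 : ℂ)) fun a ha => by
      rw [Complex.mul_conj', hg a ha]; simp]
  simp

theorem sum_leadFiber_card_sq_le {G : Finset F[X]} {lead : F[X] → MonicIrred F}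
    {s : Finset (MonicIrred F)} (hs : ∀ a ∈ G, lead a ∈ s) {k : ℕ}
    (hk : ∀ P, (leadFiber G lead P).card ≤ k) :
    ∑ P ∈ s, (leadFiber G lead P).card ^ 2 ≤ k * G.card := by
  classical
  rw [Finset.card_eq_sum_card_fiberwise hs, Finset.mul_sum]
  refine Finset.sum_le_sum fun P _ => ?_
  rw [sq]
  refine Nat.mul_le_mul (hk P) (Finset.card_le_card fun a ha => ?_)
  exact Finset.mem_filter.2 (mem_leadFiber.1 ha)

/-- The fibres partition `leadPairs`; the energy of the union also counts solutions whose two pairs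
lie in different fibres. -/
theorem sum_crossEnergy_leadFiber_le [DecidableEq F[X]] (G : Finset F[X])
    (lead : F[X] → MonicIrred F) (s : Finset (MonicIrred F)) :
    ∑ P ∈ s, crossEnergy ((leadFiber G lead P ×ˢ leadFiber G lead P).filter
      fun x => x.1 ≠ x.2) ≤ crossEnergy (leadPairs G lead) := by
  classical
  simp only [crossEnergy]
  rw [← Finset.card_biUnion]
  · refine Finset.card_le_card (Finset.biUnion_subset.2 fun P _ z hz => ?_)
    simp only [Finset.mem_filter, Finset.mem_product, mem_leadFiber, mem_leadPairs] at hz ⊢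
    obtain ⟨⟨⟨⟨h1, h2⟩, h3⟩, ⟨⟨h4, h5⟩, h6⟩⟩, h7⟩ := hz
    exact ⟨⟨⟨⟨h1.1, h2.1⟩, h3, h1.2.trans h2.2.symm⟩, ⟨⟨h4.1, h5.1⟩, h6, h4.2.trans h5.2.symm⟩⟩,
      h7⟩
  · intro P _ P' _ hPP
    refine Finset.disjoint_left.2 fun z hz hz' => hPP ?_
    simp only [Finset.mem_filter, Finset.mem_product, mem_leadFiber] at hz hz'
    exact hz.1.1.1.1.2.symm.trans hz'.1.1.1.1.2

set_option maxHeartbeats 1000000 in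
/-- A quantitative central limit theorem for Steinhaus random multiplicative functions. -/
theorem IsSteinhaus.norm_charFun_sub_le [LinearOrder (MonicIrred F)] [DecidableEq F[X]]
    (hf : IsSteinhaus f μ) {A G : Finset F[X]} (hGA : G ⊆ A) (hA : ∀ a ∈ A, a.Monic)
    (hA0 : A.Nonempty) (lead : F[X] → MonicIrred F) (cof : F[X] → F[X])
    (hcof : ∀ a ∈ G, (cof a).Monic) (hlead : ∀ a ∈ G, a = (lead a).1 * cof a)
    (hlt : ∀ a ∈ G, ∀ P : MonicIrred F, P.1 ∣ cof a → P < lead a) {k : ℕ}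
    (hk : ∀ P, (leadFiber G lead P).card ≤ k) (t : ℂ) :
    ‖charFun (μ.map (normalizedSum f A)) t - Real.exp (-(‖t‖ ^ 2 / 4))‖ ≤
      ‖t‖ * √((A \ G).card / A.card) +
      5 * Real.exp (‖t‖ ^ 2 / 2) * ‖t‖ ^ 4 *
        (2 * (k / A.card + crossEnergy (leadPairs G lead) / A.card ^ 2)) +
      (2 + Real.exp (‖t‖ ^ 2 / 2) * ‖t‖ ^ 2) *
        ((A \ G).card / A.card + √(crossEnergy (leadPairs G lead)) / A.card) := by
  have hAc : (0 : ℝ) < A.card := by exact_mod_cast hA0.card_pos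
  have hG : ∀ a ∈ G, a.Monic := fun a ha => hA a (hGA ha)
  set σ : ℝ := (√(A.card : ℝ))⁻¹ with hσ
  have hσ0 : 0 < σ := inv_pos.2 (Real.sqrt_pos.2 hAc)
  have hσ2 : σ ^ 2 = (A.card : ℝ)⁻¹ := by rw [hσ, inv_pow, Real.sq_sqrt hAc.le]
  set ξ : MonicIrred F → Ω → ℂ := fun P => f P.1 with hξ
  set s := G.image lead with hs
  have hGs : ∀ a ∈ G, lead a ∈ s := fun a ha => Finset.mem_image_of_mem _ ha
  set B := leadFiber G lead with hB
  have hBG : ∀ {P a}, a ∈ B P → a ∈ G := fun h => (mem_leadFiber.1 h).1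
  -- The martingale coefficient of `f P`. It depends on the past of `P` because the cofactors
  -- contain only primes below `P`.
  set W : MonicIrred F → Ω → ℂ := fun P ω => σ * ∑ a ∈ B P, f (cof a) ω with hW
  have hWm : ∀ P ∈ s, Measurable[pastSigma ξ P] (W P) := by
    intro P _
    refine Measurable.const_mul (Finset.measurable_fun_sum _ fun a ha => ?_) _
    have hm := hcof a (hBG ha)
    have e : f (cof a) = fun ω => ∏ R ∈ primeDivisors (cof a), ξ R ω ^ expo (cof a) R :=
      funext fun ω => hf.eq_prod hm (fun R hR => (mem_primeDivisors hm.ne_zero).2 hR) ω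
    rw [e]
    refine Finset.measurable_fun_prod _ fun R hR => Measurable.pow_const ?_ _
    refine measurable_pastSigma ?_
    rw [← (mem_leadFiber.1 ha).2]
    exact hlt a (hBG ha) R ((mem_primeDivisors hm.ne_zero).1 hR)
  have hWm' : ∀ P ∈ s, Measurable (W P) := fun P hP =>
    (hWm P hP).mono (pastSigma_le hf.measurable P) le_rfl
  have hcof1 : ∀ᵐ ω ∂μ, ∀ a ∈ G, ‖f (cof a) ω‖ = 1 :=
    (Filter.eventually_all_finset _).2 fun a ha => hf.norm_eq_one (hcof a ha)
  have hG1 : ∀ᵐ ω ∂μ, ∀ a ∈ G, ‖f a ω‖ = 1 :=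
    (Filter.eventually_all_finset _).2 fun a ha => hf.norm_eq_one (hG a ha)
  have hs1 : ∀ᵐ ω ∂μ, ∀ P ∈ s, ‖ξ P ω‖ = 1 :=
    (Filter.eventually_all_finset _).2 fun P _ => hf.norm_eq_one P.2.1
  have hWint : ∀ P ∈ s, ∀ j : ℕ, Integrable (fun ω => ‖W P ω‖ ^ j) μ := by
    intro P hP j
    refine Integrable.of_bound ((hWm' P hP).norm.pow_const j).aestronglyMeasurable
      ((σ * (B P).card) ^ j) ?_
    filter_upwards [hcof1] with ω hω
    rw [Real.norm_eq_abs, abs_of_nonneg (by positivity)]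
    gcongr
    rw [hW, norm_mul, Complex.norm_real, Real.norm_eq_abs, abs_of_pos hσ0]
    gcongr
    refine (norm_sum_le _ _).trans ?_
    rw [Finset.sum_congr rfl (g := fun _ => (1 : ℝ)) fun a ha => hω a (hBG ha)]
    simp
  have hξW : ∀ P ω, ξ P ω * W P ω = σ * ∑ a ∈ B P, f a ω := fun P ω => by
    rw [hW, mul_left_comm, Finset.mul_sum]
    congr 1
    refine Finset.sum_congr rfl fun a ha => ?_
    conv_rhs => rw [hlead a (hBG ha), hf.map_mul (lead a).2.1 (hcof a (hBG ha))]
    rw [(mem_leadFiber.1 ha).2]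
  have hsum : ∀ ω, ∑ P ∈ s, ξ P ω * W P ω = σ * ∑ a ∈ G, f a ω := fun ω => by
    simp_rw [hξW]
    rw [← Finset.mul_sum, sum_leadFiber hGs]
  have hclt := norm_integral_exp_inner_sub_gaussian_le (ξ := ξ) hf.measurable hf.indep hf.uniform
    s W hWm (fun P hP => hWint P hP 2) (fun P hP => hWint P hP 4) t
  simp_rw [hsum] at hclt
  set Qf : MonicIrred F → Finset (F[X] × F[X]) := fun P =>
    (B P ×ˢ B P).filter fun x => x.1 ≠ x.2 with hQf
  set Y : MonicIrred F → Ω → ℂ := fun P ω =>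
    ∑ x ∈ Qf P, f x.1 ω * starRingEnd ℂ (f x.2 ω) with hY
  have hQfm : ∀ P, ∀ x ∈ Qf P, x.1.Monic ∧ x.2.Monic := fun P x hx => by
    obtain ⟨h1, h2⟩ := Finset.mem_product.1 (Finset.mem_filter.1 hx).1
    exact ⟨hG _ (hBG h1), hG _ (hBG h2)⟩
  -- Multiplying by the unimodular `ξ P` restores `f a` in place of `f (cof a)`, so the off-diagonal
  -- part `Y P` is a sum over pairs of elements of `G` itself.
  have hW2 : ∀ᵐ ω ∂μ, ∀ P ∈ s, ((‖W P ω‖ ^ 2 : ℝ) : ℂ) =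
      (σ ^ 2 : ℝ) * ((B P).card + Y P ω) := by
    filter_upwards [hG1, hs1] with ω h1 h2 P hP
    have h3 : ‖W P ω‖ = σ * ‖∑ a ∈ B P, f a ω‖ :=
      calc ‖W P ω‖ = ‖ξ P ω * W P ω‖ := by rw [norm_mul (ξ P ω), h2 P hP, one_mul]
        _ = _ := by rw [hξW, norm_mul, Complex.norm_real, Real.norm_eq_abs, abs_of_pos hσ0]
    rw [h3, mul_pow, Complex.ofReal_mul, norm_sq_sum_eq _ _ fun a ha => h1 a (hBG ha)]
  have hQ : ∀ x ∈ leadPairs G lead, x.1.Monic ∧ x.2.Monic := fun x hx =>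
    ⟨hG _ (mem_leadPairs.1 hx).1.1, hG _ (mem_leadPairs.1 hx).1.2⟩
  set E := crossEnergy (leadPairs G lead) with hE
  have hcardG : ((A \ G).card : ℝ) = A.card - G.card := by
    rw [Finset.card_sdiff_of_subset hGA, Nat.cast_sub (Finset.card_le_card hGA)]
  have hYsum : ∀ ω, ∑ P ∈ s, Y P ω =
      ∑ x ∈ leadPairs G lead, f x.1 ω * starRingEnd ℂ (f x.2 ω) := fun ω => by
    rw [← Finset.sum_fiberwise_of_maps_to (s := leadPairs G lead) (t := s)
      (g := fun x => lead x.1) fun x hx => hGs _ (mem_leadPairs.1 hx).1.1]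
    refine Finset.sum_congr rfl fun P _ => Finset.sum_congr ?_ fun _ _ => rfl
    ext x
    simp only [hQf, hB, Finset.mem_filter, Finset.mem_product, mem_leadFiber, mem_leadPairs]
    constructor
    · rintro ⟨⟨h1, h2⟩, h3⟩
      exact ⟨⟨⟨h1.1, h2.1⟩, h3, h1.2.trans h2.2.symm⟩, h1.2⟩
    · rintro ⟨⟨⟨h1, h2⟩, h3, h4⟩, h5⟩
      exact ⟨⟨⟨h1, h5⟩, h2, h4 ▸ h5⟩, h3⟩
  have hBcard : ∑ P ∈ s, (B P).card = G.card := by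
    rw [Finset.card_eq_sum_card_fiberwise hGs]
    exact Finset.sum_congr rfl fun P _ => congrArg Finset.card (by ext a; simp [hB, mem_leadFiber])
  -- The diagonal sums to `|G| / |A|`, short of 1 by the proportion of discarded elements; the
  -- off-diagonal part is bounded in mean through its second moment.
  have hV : ∫ ω, |∑ P ∈ s, ‖W P ω‖ ^ 2 - 1| ∂μ ≤ (A \ G).card / A.card + √E / A.card := by
    have hi : Integrable (fun ω => (A \ G).card / (A.card : ℝ) + σ ^ 2 *
        ‖∑ x ∈ leadPairs G lead, f x.1 ω * starRingEnd ℂ (f x.2 ω)‖) μ :=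
      (integrable_const _).add ((by simpa using hf.integrable_sum hQ 1 : Integrable _ μ).const_mul _)
    have hle : ∀ᵐ ω ∂μ, |∑ P ∈ s, ‖W P ω‖ ^ 2 - 1| ≤ (A \ G).card / (A.card : ℝ) + σ ^ 2 *
        ‖∑ x ∈ leadPairs G lead, f x.1 ω * starRingEnd ℂ (f x.2 ω)‖ := by
      filter_upwards [hW2] with ω hω
      have e : ((∑ P ∈ s, ‖W P ω‖ ^ 2 - 1 : ℝ) : ℂ) = ((-((A \ G).card / (A.card : ℝ)) : ℝ) : ℂ) +
          (σ ^ 2 : ℝ) * ∑ x ∈ leadPairs G lead, f x.1 ω * starRingEnd ℂ (f x.2 ω) := by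
        rw [Complex.ofReal_sub, Complex.ofReal_sum, Finset.sum_congr rfl hω, ← Finset.mul_sum,
          Finset.sum_add_distrib, hYsum, ← Nat.cast_sum, hBcard, hcardG, hσ2]
        have : (A.card : ℂ) ≠ 0 := by exact_mod_cast hAc.ne'
        push_cast
        field_simp
        ring
      rw [← Real.norm_eq_abs, ← Complex.norm_real, e]
      refine (norm_add_le _ _).trans ?_
      rw [norm_mul, Complex.norm_real, Complex.norm_real, Real.norm_eq_abs, Real.norm_eq_abs,
        abs_neg, abs_of_nonneg (by positivity), abs_of_nonneg (by positivity)]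
    refine (integral_mono_of_nonneg (Eventually.of_forall fun ω => abs_nonneg _) hi hle).trans ?_
    rw [integral_add (integrable_const _)
      ((by simpa using hf.integrable_sum hQ 1 : Integrable _ μ).const_mul _), integral_const_mul,
      hσ2]
    have := hf.integral_norm_sum_le hQ
    rw [← hE] at this
    simp only [integral_const, probReal_univ, one_smul, div_eq_inv_mul]
    gcongr
  have h4 : ∑ P ∈ s, ∫ ω, ‖W P ω‖ ^ 4 ∂μ ≤ 2 * (k / A.card + E / A.card ^ 2) := by
    have h5 : ∀ P ∈ s, ∫ ω, ‖W P ω‖ ^ 4 ∂μ ≤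
        2 * (σ ^ 2) ^ 2 * (((B P).card : ℝ) ^ 2 + crossEnergy (Qf P)) := by
      intro P hP
      have hi := ((integrable_const (((B P).card : ℝ) ^ 2)).add
        (hf.integrable_sum (hQfm P) 2)).const_mul (2 * (σ ^ 2) ^ 2)
      refine (integral_mono_of_nonneg (Eventually.of_forall fun ω => by positivity) hi ?_).trans ?_
      · filter_upwards [hW2] with ω hω
        have e : ‖W P ω‖ ^ 2 = σ ^ 2 * ‖((B P).card : ℂ) + Y P ω‖ :=
          calc ‖W P ω‖ ^ 2 = ‖((‖W P ω‖ ^ 2 : ℝ) : ℂ)‖ := by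
                rw [Complex.norm_real, Real.norm_eq_abs, abs_of_nonneg (by positivity)]
            _ = _ := by
                rw [hω P hP, norm_mul, Complex.norm_real, Real.norm_eq_abs,
                  abs_of_nonneg (by positivity)]
        have h6 : ‖((B P).card : ℂ) + Y P ω‖ ≤ (B P).card + ‖Y P ω‖ := by
          simpa using norm_add_le ((B P).card : ℂ) (Y P ω)
        have h7 : ‖((B P).card : ℂ) + Y P ω‖ ^ 2 ≤ 2 * (((B P).card : ℝ) ^ 2 + ‖Y P ω‖ ^ 2) := by
          refine (pow_le_pow_left₀ (norm_nonneg _) h6 2).trans ?_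
          nlinarith [sq_nonneg (((B P).card : ℝ) - ‖Y P ω‖)]
        calc ‖W P ω‖ ^ 4 = (σ ^ 2) ^ 2 * ‖((B P).card : ℂ) + Y P ω‖ ^ 2 := by
              rw [← mul_pow, ← e, ← pow_mul]
          _ ≤ (σ ^ 2) ^ 2 * (2 * (((B P).card : ℝ) ^ 2 + ‖Y P ω‖ ^ 2)) := by gcongr
          _ = _ := by simp only [Pi.add_apply, hY]; ring
      · rw [integral_const_mul]
        gcongr
        simp only [Pi.add_apply]
        rw [integral_add (integrable_const _) (hf.integrable_sum (hQfm P) 2),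
          hf.integral_norm_sq_sum (hQfm P)]
        simp
    refine (Finset.sum_le_sum h5).trans ?_
    rw [← Finset.mul_sum, Finset.sum_add_distrib, hσ2]
    have h6 : ∑ P ∈ s, ((B P).card : ℝ) ^ 2 ≤ k * A.card := by
      have := (sum_leadFiber_card_sq_le hGs hk).trans
        (Nat.mul_le_mul_left k (Finset.card_le_card hGA))
      exact_mod_cast this
    have h7 : ∑ P ∈ s, (crossEnergy (Qf P) : ℝ) ≤ E := by
      exact_mod_cast sum_crossEnergy_leadFiber_le G lead s
    calc 2 * ((A.card : ℝ)⁻¹) ^ 2 * (∑ P ∈ s, ((B P).card : ℝ) ^ 2 +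
          ∑ P ∈ s, (crossEnergy (Qf P) : ℝ))
        ≤ 2 * ((A.card : ℝ)⁻¹) ^ 2 * (k * A.card + E) := by gcongr
      _ = _ := by field_simp
  have hXm : Measurable (normalizedSum f A) :=
    (Finset.measurable_fun_sum _ fun a ha => hf.measurable_monic (hA a ha)).const_mul _
  have hGm : Measurable fun ω => (σ : ℂ) * ∑ a ∈ G, f a ω :=
    (Finset.measurable_fun_sum _ fun a ha => hf.measurable_monic (hG a ha)).const_mul _
  -- Cost of discarding `A \ G`, from the square-root bound on the mean modulus of the discarded
  -- sum.
  have hdiff : ‖charFun (μ.map (normalizedSum f A)) t -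
      ∫ ω, Complex.exp ((inner ℝ ((σ : ℂ) * ∑ a ∈ G, f a ω) t : ℝ) * Complex.I) ∂μ‖ ≤
      ‖t‖ * √((A \ G).card / A.card) := by
    have hAG : ∀ a ∈ A \ G, a.Monic := fun a ha => hA a (Finset.mem_sdiff.1 ha).1
    have hm : Measurable fun z : ℂ => Complex.exp ((inner ℝ z t : ℝ) * Complex.I) := by fun_prop
    have h1 : Integrable (fun ω => Complex.exp ((inner ℝ (normalizedSum f A ω) t : ℝ) *
        Complex.I)) μ := Integrable.of_bound (hm.comp hXm).aestronglyMeasurable 1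
      (Eventually.of_forall fun ω => (Complex.norm_exp_ofReal_mul_I _).le)
    have h2 : Integrable (fun ω => Complex.exp ((inner ℝ ((σ : ℂ) * ∑ a ∈ G, f a ω) t : ℝ) *
        Complex.I)) μ := Integrable.of_bound (hm.comp hGm).aestronglyMeasurable 1
      (Eventually.of_forall fun ω => (Complex.norm_exp_ofReal_mul_I _).le)
    rw [charFun_apply, integral_map hXm.aemeasurable (by fun_prop), ← integral_sub h1 h2]
    have hi : Integrable (fun ω => ‖∑ a ∈ A \ G, f a ω‖) μ := by
      refine (integrable_finsetSum _ fun a ha => ?_).norm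
      refine Integrable.of_bound (hf.measurable_monic (hAG a ha)).aestronglyMeasurable 1 ?_
      filter_upwards [hf.norm_eq_one (hAG a ha)] with ω hω using hω.le
    refine (norm_integral_le_of_norm_le (hi.const_mul (‖t‖ * σ))
      (Eventually.of_forall fun ω => ?_)).trans ?_
    · refine (norm_exp_mul_I_sub_le _ _).trans ?_
      have e : normalizedSum f A ω - (σ : ℂ) * ∑ a ∈ G, f a ω =
          (σ : ℂ) * ∑ a ∈ A \ G, f a ω := by
        rw [normalizedSum, ← Finset.sum_sdiff hGA, hσ]
        push_cast; ring
      rw [← inner_sub_left, e]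
      refine (abs_real_inner_le_norm _ _).trans (le_of_eq ?_)
      rw [norm_mul, Complex.norm_real, Real.norm_eq_abs, abs_of_pos hσ0]
      ring
    · rw [integral_const_mul, mul_assoc]
      gcongr
      rw [Real.sqrt_div (by positivity), div_eq_inv_mul, ← hσ]
      gcongr
      exact hf.integral_norm_sum_single_le hAG
  calc _ = ‖(charFun (μ.map (normalizedSum f A)) t -
        ∫ ω, Complex.exp ((inner ℝ ((σ : ℂ) * ∑ a ∈ G, f a ω) t : ℝ) * Complex.I) ∂μ) +
        (∫ ω, Complex.exp ((inner ℝ ((σ : ℂ) * ∑ a ∈ G, f a ω) t : ℝ) * Complex.I) ∂μ -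
        Real.exp (-(‖t‖ ^ 2 / 4)))‖ := by rw [sub_add_sub_cancel]
    _ ≤ _ := norm_add_le _ _
    _ ≤ _ := by
        rw [add_assoc]
        refine add_le_add hdiff (hclt.trans ?_)
        gcongr

end SteinhausCLT

/-! ### Bounding the cross energy; the ordering of primes -/

section EnergyBound

variable {F : Type*} [Field F]

theorem exists_monic_gcd {a c : F[X]} (ha : a.Monic) (hc : c.Monic) :
    ∃ g x y : F[X], g.Monic ∧ x.Monic ∧ y.Monic ∧ a = g * x ∧ c = g * y ∧ IsCoprime x y ∧
      ∀ d, d ∣ a → d ∣ c → d ∣ g := by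
  classical
  set g₀ := EuclideanDomain.gcd a c with hg₀
  have h0 : g₀ ≠ 0 := fun h => ha.ne_zero (EuclideanDomain.gcd_eq_zero_iff.1 h).1
  set u : F[X] := C g₀.leadingCoeff⁻¹ with hu
  have hu' : IsUnit u := isUnit_C.2 (inv_ne_zero (leadingCoeff_ne_zero.2 h0)).isUnit
  have hg : (g₀ * u).Monic := monic_mul_leadingCoeff_inv h0
  obtain ⟨x, hx⟩ := (hu'.mul_right_dvd).2 (EuclideanDomain.gcd_dvd_left a c)
  obtain ⟨y, hy⟩ := (hu'.mul_right_dvd).2 (EuclideanDomain.gcd_dvd_right a c)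
  refine ⟨g₀ * u, x, y, hg, hg.of_mul_monic_left (hx ▸ ha), hg.of_mul_monic_left (hy ▸ hc), hx, hy,
    ⟨EuclideanDomain.gcdA a c * u, EuclideanDomain.gcdB a c * u, ?_⟩,
    fun d h1 h2 => (EuclideanDomain.dvd_gcd h1 h2).mul_right u⟩
  refine mul_left_cancel₀ hg.ne_zero ?_
  have h := EuclideanDomain.gcd_eq_gcd_ab a c
  calc _ = (g₀ * u * x * EuclideanDomain.gcdA a c + g₀ * u * y * EuclideanDomain.gcdB a c) * u := by
        ring
    _ = g₀ * u * 1 := by rw [← hx, ← hy, ← h, mul_one]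

variable [Finite F]

open scoped Classical in
/-- Monic `g` of degree `n` such that `g * x - Z` and `g * y - Z` are both irreducible. -/
noncomputable def pairCofactors (Z : F[X]) (n : ℕ) (w : F[X] × F[X]) : Finset F[X] :=
  (monicOfDegree F n).filter fun g => Irreducible (g * w.1 - Z) ∧ Irreducible (g * w.2 - Z)

open scoped Classical in
/-- Pairs of distinct monic polynomials of degree `k`. -/
noncomputable def distinctMonicPairs (F : Type*) [Field F] [Finite F] (k : ℕ) :
    Finset (F[X] × F[X]) :=
  (monicOfDegree F k ×ˢ monicOfDegree F k).filter fun w => w.1 ≠ w.2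

/-- With `g` the monic gcd of `a` and `c`, one has `a = g x` and `c = g y` with `x`, `y` coprime.
Then `a c' = a' c` forces `a' = h x` and `c' = h y`. For fixed `(x, y)` both `g` and `h` range over
the same set, hence the square; the common divisor of degree at least `M` gives `deg x ≤ N - M`. -/
theorem crossEnergy_le_sum {N M : ℕ} {Z : F[X]} {Q : Finset (F[X] × F[X])}
    (hQ : ∀ w ∈ Q, w.1 ∈ monicOfDegree F N ∧ w.2 ∈ monicOfDegree F N ∧ w.1 ≠ w.2 ∧
      Irreducible (w.1 - Z) ∧ Irreducible (w.2 - Z) ∧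
      ∃ d : F[X], d ∣ w.1 ∧ d ∣ w.2 ∧ M ≤ d.natDegree) :
    crossEnergy Q ≤ ∑ k ∈ Finset.range (N - M + 1), ∑ w ∈ distinctMonicPairs F k,
      (pairCofactors Z (N - k) w).card ^ 2 := by
  classical
  have hsub : ((Q ×ˢ Q).filter fun z => z.1.1 * z.2.2 = z.2.1 * z.1.2) ⊆
      (Finset.range (N - M + 1)).biUnion fun k => (distinctMonicPairs F k).biUnion fun w =>
        (pairCofactors Z (N - k) w ×ˢ pairCofactors Z (N - k) w).image fun v =>
          ((v.1 * w.1, v.1 * w.2), (v.2 * w.1, v.2 * w.2)) := by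
    rintro ⟨⟨a, c⟩, ⟨a', c'⟩⟩ hz
    obtain ⟨hz, heq⟩ := Finset.mem_filter.1 hz
    obtain ⟨h1, h2⟩ := Finset.mem_product.1 hz
    obtain ⟨ha, hc, hac, hIa, hIc, d, hda, hdc, hd⟩ := hQ _ h1
    obtain ⟨ha', hc', -, hIa', hIc', -⟩ := hQ _ h2
    simp only [mem_monicOfDegree] at ha hc ha' hc' hac hda hdc heq
    simp only at hIa hIc hIa' hIc'
    obtain ⟨g, x, y, hg, hx, hy, rfl, rfl, hxy, hmax⟩ := exists_monic_gcd ha.1 hc.1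
    have hdg := natDegree_le_of_dvd (hmax d hda hdc) hg.ne_zero
    have e1 : x * c' = a' * y := mul_left_cancel₀ hg.ne_zero (by linear_combination heq)
    obtain ⟨h, rfl⟩ : x ∣ a' := hxy.dvd_of_dvd_mul_right (Dvd.intro _ e1)
    obtain rfl : c' = h * y := mul_left_cancel₀ hx.ne_zero (by linear_combination e1)
    have hh : h.Monic := hx.of_mul_monic_left ha'.1
    have dx := hg.natDegree_mul hx
    have dy := hg.natDegree_mul hy
    have dh := hx.natDegree_mul hh
    simp only [Finset.mem_biUnion, Finset.mem_image, Finset.mem_range]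
    refine ⟨x.natDegree, by omega, (x, y), ?_, (g, h), ?_, ?_⟩
    · simp only [distinctMonicPairs, Finset.mem_filter, Finset.mem_product, mem_monicOfDegree]
      exact ⟨⟨⟨hx, trivial⟩, hy, by omega⟩, fun e => hac (by rw [e])⟩
    · rw [mul_comm x h] at hIa'
      simp only [pairCofactors, Finset.mem_filter, Finset.mem_product, mem_monicOfDegree]
      exact ⟨⟨⟨hg, by omega⟩, hIa, hIc⟩, ⟨hh, by omega⟩, hIa', hIc'⟩
    · rw [mul_comm x h]
  refine (Finset.card_le_card hsub).trans (Finset.card_biUnion_le.trans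
    (Finset.sum_le_sum fun k _ => Finset.card_biUnion_le.trans (Finset.sum_le_sum fun w _ => ?_)))
  refine Finset.card_image_le.trans ?_
  rw [Finset.card_product, sq]

/-- For each degree `k` there are at most `q^(2k)` pairs `(x, y)`, and the squared sieve bound
carries `q^(2(N - k))`. Every `k` therefore contributes at most the same multiple of `q^(2N)`, using
`N - k ≥ M`. -/
theorem crossEnergy_le (hq : 3 ≤ Nat.card F) {N M D : ℕ} (hM : 1 ≤ M) (hMN : M ≤ N)
    (hD : N ≤ 3 ^ D) {Z : F[X]} (hZ : Z.Monic) (hZN : Z.natDegree ≤ N - 1)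
    {Q : Finset (F[X] × F[X])}
    (hQ : ∀ w ∈ Q, w.1 ∈ monicOfDegree F N ∧ w.2 ∈ monicOfDegree F N ∧ w.1 ≠ w.2 ∧
      Irreducible (w.1 - Z) ∧ Irreducible (w.2 - Z) ∧
      ∃ d : F[X], d ∣ w.1 ∧ d ∣ w.2 ∧ M ≤ d.natDegree) :
    (crossEnergy Q : ℝ) ≤
      N * (((Nat.card F : ℝ) ^ N) ^ 2 * (8 * Real.exp (3 * (5 + Real.log D)) / M ^ 2) ^ 2) := by
  classical
  set S := Real.exp (3 * (5 + Real.log D)) with hS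
  have hS0 : 0 < S := Real.exp_pos _
  have hM0 : (0 : ℝ) < M := by exact_mod_cast hM
  have h1 : (crossEnergy Q : ℝ) ≤ ∑ k ∈ Finset.range (N - M + 1), ∑ w ∈ distinctMonicPairs F k,
      ((pairCofactors Z (N - k) w).card : ℝ) ^ 2 := by exact_mod_cast crossEnergy_le_sum hQ
  refine h1.trans ?_
  have h2 : ∀ k ∈ Finset.range (N - M + 1), ∑ w ∈ distinctMonicPairs F k,
      ((pairCofactors Z (N - k) w).card : ℝ) ^ 2 ≤
        ((Nat.card F : ℝ) ^ N) ^ 2 * (8 * S / M ^ 2) ^ 2 := by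
    intro k hk
    have hk' := Finset.mem_range.1 hk
    have hnM : (M : ℝ) ≤ (N - k : ℕ) := by exact_mod_cast (by omega : M ≤ N - k)
    have h3 : ∀ w ∈ distinctMonicPairs F k, ((pairCofactors Z (N - k) w).card : ℝ) ^ 2 ≤
        ((Nat.card F : ℝ) ^ (N - k) * (8 * S / M ^ 2)) ^ 2 := by
      intro w hw
      simp only [distinctMonicPairs, Finset.mem_filter, Finset.mem_product,
        mem_monicOfDegree] at hw
      obtain ⟨⟨⟨hx, hxk⟩, hy, hyk⟩, hxy⟩ := hw
      have := card_irreducible_pair_le hq (N := N) (n := N - k) (k := k) (D := D) (by omega)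
        (by omega) hD hx hxk hy hyk hxy hZ hZN
      rw [← hS] at this
      refine pow_le_pow_left₀ (by positivity) (this.trans ?_) 2
      gcongr
    refine (Finset.sum_le_sum h3).trans ?_
    rw [Finset.sum_const, nsmul_eq_mul]
    have h4 : ((distinctMonicPairs F k).card : ℝ) ≤ ((Nat.card F : ℝ) ^ k) ^ 2 := by
      have : (distinctMonicPairs F k).card ≤ (Nat.card F ^ k) ^ 2 := by
        refine (Finset.card_filter_le _ _).trans ?_
        rw [Finset.card_product, card_monicOfDegree, sq]
      exact_mod_cast this
    calc ((distinctMonicPairs F k).card : ℝ) * ((Nat.card F : ℝ) ^ (N - k) * (8 * S / M ^ 2)) ^ 2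
        ≤ ((Nat.card F : ℝ) ^ k) ^ 2 * ((Nat.card F : ℝ) ^ (N - k) * (8 * S / M ^ 2)) ^ 2 := by
          gcongr
      _ = ((Nat.card F : ℝ) ^ (k + (N - k))) ^ 2 * (8 * S / M ^ 2) ^ 2 := by
          rw [pow_add]; ring
      _ = _ := by rw [Nat.add_sub_cancel' (by omega)]
  refine (Finset.sum_le_sum h2).trans ?_
  rw [Finset.sum_const, nsmul_eq_mul, Finset.card_range]
  gcongr
  omega

-- Degree first, ties broken by an enumeration of the countably many primes.
variable (F) in
theorem exists_linearOrder_monicIrred : ∃ _ : LinearOrder (MonicIrred F),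
    ∀ P Q : MonicIrred F, P ≤ Q → P.1.natDegree ≤ Q.1.natDegree := by
  have : Countable (MonicIrred F) := by
    rw [← Set.countable_univ_iff]
    refine (Set.countable_iUnion fun n => (finite_monicIrred_natDegree_le F n).countable).mono
      fun P _ => Set.mem_iUnion.2 ⟨P.1.natDegree, by simp⟩
  obtain ⟨e, he⟩ := exists_injective_nat (MonicIrred F)
  let φ : MonicIrred F → ℕ ×ₗ ℕ := fun P => toLex (P.1.natDegree, e P)
  refine ⟨LinearOrder.lift' φ fun P Q h => he (congrArg (fun x => (ofLex x).2) h), ?_⟩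
  intro P Q h
  rcases Prod.Lex.toLex_le_toLex.1 (show φ P ≤ φ Q from h) with h | h
  exacts [le_of_lt h, h.1.le]

-- The largest prime factor `P` has degree at least `M ≥ J`, so `P^2 ∣ a` is excluded; hence `P`
-- does not divide the cofactor, and all primes there are strictly smaller.
omit [Finite F] in
theorem HasLargePrime.exists_leading [LinearOrder (MonicIrred F)]
    (hmono : ∀ P Q : MonicIrred F, P ≤ Q → P.1.natDegree ≤ Q.1.natDegree) {M J : ℕ} (hJM : J ≤ M)
    {a : F[X]} (ha : a.Monic) (h : HasLargePrime M J a) :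
    ∃ (P : MonicIrred F) (c : F[X]), c.Monic ∧ a = P.1 * c ∧ M ≤ P.1.natDegree ∧
      ∀ Q : MonicIrred F, Q.1 ∣ c → Q < P := by
  obtain ⟨⟨R, hRa, hR⟩, hsq⟩ := h
  have hne : (primeDivisors a).Nonempty := ⟨R, (mem_primeDivisors ha.ne_zero).2 hRa⟩
  set P := (primeDivisors a).max' hne with hP
  have hPmax : ∀ Q : MonicIrred F, Q.1 ∣ a → Q ≤ P := fun Q hQ =>
    Finset.le_max' _ _ ((mem_primeDivisors ha.ne_zero).2 hQ)
  obtain ⟨c, hc⟩ := (mem_primeDivisors ha.ne_zero).1 (Finset.max'_mem _ hne)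
  have hM : M ≤ P.1.natDegree := hR.trans (hmono _ _ (hPmax R hRa))
  refine ⟨P, c, P.2.1.of_mul_monic_left (hc ▸ ha), hc, hM, fun Q hQ => ?_⟩
  refine lt_of_le_of_ne (hPmax Q (hc ▸ hQ.mul_left _)) ?_
  rintro rfl
  refine hsq P.1 P.2.1 (hJM.trans hM) ?_
  rw [hc, sq]
  exact mul_dvd_mul_left _ hQ

end EnergyBound

/-! ### The quantitative theorem for shifted primes with free parameters -/

section ShiftedPrimes

variable {F : Type*} [Field F] [Finite F]

theorem mem_shiftedPrimes {N : ℕ} {Z : F[X]} (hN : 1 ≤ N) (hZN : Z.natDegree ≤ N - 1) {a : F[X]} :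
    a ∈ shiftedPrimes N Z ↔ a ∈ monicOfDegree F N ∧ Irreducible (a - Z) := by
  have key : ∀ {P W : F[X]}, W.natDegree ≤ N - 1 → P.Monic → P.natDegree = N →
      (P + W).Monic ∧ (P + W).natDegree = N := fun {P W} hW hP hPN => by
    have hlt : W.natDegree < P.natDegree := by omega
    exact ⟨hP.add_of_left (degree_lt_degree hlt),
      (natDegree_add_eq_left_of_natDegree_lt hlt).trans hPN⟩
  simp only [shiftedPrimes, Set.Finite.mem_toFinset, shiftedPrimeSet, Set.mem_ofPred_eq,
    mem_monicOfDegree]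
  constructor
  · rintro ⟨P, hP, hI, hPN, rfl⟩
    exact ⟨key hZN hP hPN, by rwa [add_sub_cancel_right]⟩
  · rintro ⟨⟨h1, h2⟩, h3⟩
    have h4 := key (W := -Z) (by rwa [natDegree_neg]) h1 h2
    rw [← sub_eq_add_neg] at h4
    exact ⟨a - Z, h4.1, h3, h4.2, by ring⟩

theorem pow_card_le_card_shiftedPrimes (hq : 3 ≤ Nat.card F) {N : ℕ} (hN : 1 ≤ N) (Z : F[X]) :
    (Nat.card F : ℝ) ^ N / (2 * N) ≤ (shiftedPrimes N Z).card := by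
  have h1 : (primesEq F N).card ≤ (shiftedPrimes N Z).card := by
    refine Finset.card_le_card_of_injOn (fun P => P.1 + Z) (fun P hP => ?_)
      fun P _ Q _ h => Subtype.ext (add_right_cancel h)
    have hP' := mem_primesEq.1 (Finset.mem_coe.1 hP)
    simp only [shiftedPrimes, Set.Finite.coe_toFinset]
    exact ⟨P.1, P.2.1, P.2.2, hP', rfl⟩
  have h2 := card_pow_le_two_mul_card_primesEq (F := F) hN hq
  have hN0 : (0 : ℝ) < N := by exact_mod_cast hN
  rw [div_le_iff₀ (by positivity)]
  have h3 : Nat.card F ^ N ≤ (shiftedPrimes N Z).card * (2 * N) :=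
    h2.trans (by rw [mul_comm]; exact Nat.mul_le_mul_right _ h1)
  exact_mod_cast h3

variable {Ω : Type*} [MeasurableSpace Ω] {μ : Measure Ω} [IsProbabilityMeasure μ]
  {f : F[X] → Ω → ℂ}

theorem IsSteinhaus.norm_charFun_shiftedPrimes_sub_le (hf : IsSteinhaus f μ)
    (hq : 3 ≤ Nat.card F) {N M J R D : ℕ} (hJ : 1 ≤ J) (hJM : J ≤ M) (hR0 : 1 ≤ R)
    (hR : 2 * J + M * R ≤ N) (hD : N ≤ 3 ^ D) {Z : F[X]} (hZ : Z.Monic)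
    (hZN : Z.natDegree ≤ N - 1) (t : ℂ) {δ κ ε : ℝ}
    (hδ : 2 * N * (N + 1) * (1 / 3 ^ J + 1 / 2 ^ R) ≤ δ) (hκ : 2 * N / 3 ^ M ≤ κ)
    (hε : 256 * Real.exp (3 * (5 + Real.log D)) ^ 2 * N ^ 3 / M ^ 4 ≤ ε) :
    ‖charFun (μ.map (normalizedSum f (shiftedPrimes N Z))) t - Real.exp (-(‖t‖ ^ 2 / 4))‖ ≤
      ‖t‖ * √δ + 5 * Real.exp (‖t‖ ^ 2 / 2) * ‖t‖ ^ 4 * (2 * (κ + ε)) +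
      (2 + Real.exp (‖t‖ ^ 2 / 2) * ‖t‖ ^ 2) * (δ + √ε) := by
  classical
  obtain ⟨_, hmono⟩ := exists_linearOrder_monicIrred F
  have hMR : M ≤ M * R := Nat.le_mul_of_pos_right M hR0
  have hMN : M ≤ N := by omega
  have hN : 1 ≤ N := by omega
  have hN0 : (0 : ℝ) < N := by exact_mod_cast hN
  have hM0 : (0 : ℝ) < M := by exact_mod_cast hJ.trans hJM
  have hq3 : (3 : ℝ) ≤ Nat.card F := by exact_mod_cast hq
  have hq0 : (0 : ℝ) < Nat.card F := by linarith
  set A := shiftedPrimes N Z with hA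
  have hAmem : ∀ {a}, a ∈ A ↔ a ∈ monicOfDegree F N ∧ Irreducible (a - Z) :=
    mem_shiftedPrimes hN hZN
  have hAm : ∀ a ∈ A, a.Monic ∧ a.natDegree = N := fun a ha =>
    mem_monicOfDegree.1 (hAmem.1 ha).1
  have hAc := pow_card_le_card_shiftedPrimes hq hN Z
  rw [← hA] at hAc
  have hAc0 : (0 : ℝ) < A.card := lt_of_lt_of_le (by positivity) hAc
  set G := A.filter (HasLargePrime M J) with hG
  have hX : Nonempty (MonicIrred F) := ⟨⟨X, monic_X, irreducible_X⟩⟩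
  have hex : ∀ a : F[X], ∃ (P : MonicIrred F) (c : F[X]), a ∈ G → c.Monic ∧ a = P.1 * c ∧
      M ≤ P.1.natDegree ∧ ∀ Q : MonicIrred F, Q.1 ∣ c → Q < P := by
    intro a
    by_cases ha : a ∈ G
    · obtain ⟨P, c, h⟩ := HasLargePrime.exists_leading hmono hJM
        (hAm a (Finset.mem_filter.1 ha).1).1 (Finset.mem_filter.1 ha).2
      exact ⟨P, c, fun _ => h⟩
    -- Arbitrary values outside `G`; the fibres and pairs formed later contain only elements of `G`.
    · exact ⟨hX.some, 0, fun h => absurd h ha⟩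
  choose lead cof hlc using hex
  have hGA : G ⊆ A := Finset.filter_subset _ _
  -- Within a fibre `a` is determined by its cofactor, a monic polynomial of degree `N - deg P ≤ N -
  -- M`.
  have hk : ∀ P, (leadFiber G lead P).card ≤ Nat.card F ^ (N - M) := by
    intro P
    by_cases hP : M ≤ P.1.natDegree
    · refine le_trans (Finset.card_le_card_of_injOn cof
        (t := monicOfDegree F (N - P.1.natDegree)) (fun a ha => ?_) fun a ha b hb hab => ?_) ?_
      · obtain ⟨haG, hla⟩ := mem_leadFiber.1 (Finset.mem_coe.1 ha)
        obtain ⟨h1, h2, -, -⟩ := hlc a haG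
        refine Finset.mem_coe.2 (mem_monicOfDegree.2 ⟨h1, ?_⟩)
        have h3 := (lead a).2.1.natDegree_mul h1
        rw [← h2, (hAm a (hGA haG)).2, hla] at h3
        omega
      · obtain ⟨haG, hla⟩ := mem_leadFiber.1 (Finset.mem_coe.1 ha)
        obtain ⟨hbG, hlb⟩ := mem_leadFiber.1 (Finset.mem_coe.1 hb)
        rw [(hlc a haG).2.1, (hlc b hbG).2.1, hla, hlb, hab]
      · rw [card_monicOfDegree]
        exact Nat.pow_le_pow_right (by omega) (by omega)
    · rw [Finset.card_eq_zero.2 (Finset.eq_empty_of_forall_notMem fun a ha => hP ?_)]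
      · exact Nat.zero_le _
      · obtain ⟨haG, hla⟩ := mem_leadFiber.1 ha
        exact hla ▸ (hlc a haG).2.2.1
  have hmain := hf.norm_charFun_sub_le hGA (fun a ha => (hAm a ha).1)
    (Finset.card_pos.1 (by exact_mod_cast hAc0)) lead cof (fun a ha => (hlc a ha).1)
    (fun a ha => (hlc a ha).2.1) (fun a ha => (hlc a ha).2.2.2) hk t
  have hE := crossEnergy_le hq (hJ.trans hJM) hMN hD hZ hZN (Q := leadPairs G lead) (by
    rintro ⟨a, c⟩ hw
    obtain ⟨⟨ha, hc⟩, hac, hl⟩ := mem_leadPairs.1 hw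
    have ha' := hAmem.1 (hGA ha)
    have hc' := hAmem.1 (hGA hc)
    refine ⟨ha'.1, hc'.1, hac, ha'.2, hc'.2, (lead a).1, ?_, ?_, (hlc a ha).2.2.1⟩
    · exact Dvd.intro _ (hlc a ha).2.1.symm
    · simp only at hl
      rw [hl]
      exact Dvd.intro _ (hlc c hc).2.1.symm)
  set E : ℝ := (crossEnergy (leadPairs G lead) : ℝ) with hEdef
  -- The constant 256 is `8^2` from the squared sieve bound times `2^2` from `|A| ≥ q^N / (2 N)`.
  have hE' : E / (A.card : ℝ) ^ 2 ≤ ε := by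
    refine le_trans ?_ hε
    set S := Real.exp (3 * (5 + Real.log D)) with hS
    calc E / (A.card : ℝ) ^ 2
        ≤ N * (((Nat.card F : ℝ) ^ N) ^ 2 * (8 * S / M ^ 2) ^ 2) /
          ((Nat.card F : ℝ) ^ N / (2 * N)) ^ 2 := by gcongr
      _ = _ := by field_simp; ring
  have hEs : √E / A.card ≤ √ε := by
    rw [← Real.sqrt_sq hAc0.le, ← Real.sqrt_div (by positivity)]
    exact Real.sqrt_le_sqrt hE'
  have hκ' : ((Nat.card F ^ (N - M) : ℕ) : ℝ) / A.card ≤ κ := by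
    refine le_trans ?_ hκ
    calc ((Nat.card F ^ (N - M) : ℕ) : ℝ) / A.card
        ≤ (Nat.card F : ℝ) ^ (N - M) / ((Nat.card F : ℝ) ^ (N - M + M) / (2 * N)) := by
          rw [Nat.cast_pow, Nat.sub_add_cancel hMN]; gcongr
      _ = 2 * N / (Nat.card F : ℝ) ^ M := by rw [pow_add]; field_simp
      _ ≤ _ := by gcongr
  have hδ' : ((A \ G).card : ℝ) / A.card ≤ δ := by
    refine le_trans ?_ hδ
    have h1 : ((A \ G).card : ℝ) ≤ (N + 1) * (Nat.card F : ℝ) ^ N * (1 / 3 ^ J + 1 / 2 ^ R) := by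
      refine le_trans ?_ (card_not_hasLargePrime_le hq (hJ.trans hJM) hR)
      refine Nat.cast_le.2 (Finset.card_le_card fun a ha => ?_)
      obtain ⟨h2, h3⟩ := Finset.mem_sdiff.1 ha
      exact Finset.mem_filter.2 ⟨(hAmem.1 h2).1, fun h => h3 (Finset.mem_filter.2 ⟨h2, h⟩)⟩
    calc ((A \ G).card : ℝ) / A.card
        ≤ (N + 1) * (Nat.card F : ℝ) ^ N * (1 / 3 ^ J + 1 / 2 ^ R) /
          ((Nat.card F : ℝ) ^ N / (2 * N)) := by gcongr
      _ = _ := by field_simp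
  refine hmain.trans ?_
  have hexp := Real.exp_pos (‖t‖ ^ 2 / 2)
  refine add_le_add (add_le_add ?_ ?_) ?_
  · exact mul_le_mul_of_nonneg_left (Real.sqrt_le_sqrt hδ') (norm_nonneg t)
  · exact mul_le_mul_of_nonneg_left (by linarith) (by positivity)
  · exact mul_le_mul_of_nonneg_left (by linarith) (by positivity)

end ShiftedPrimes

/-! ### Choice of parameters and passage to the limit -/

section Limit

open Topology

/-- With `D = clog 3 N` one has `3^D ≤ 3 * N`, so the quotient is at most `3 * D^10 / 3^D`. -/
theorem tendsto_clog_pow_div :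
    Tendsto (fun N : ℕ => (Nat.clog 3 N : ℝ) ^ 10 / N) atTop (𝓝 0) := by
  have hD : Tendsto (fun N : ℕ => Nat.clog 3 N) atTop atTop := by
    refine tendsto_atTop.2 fun b => ?_
    filter_upwards [eventually_ge_atTop (3 ^ b)] with N hN
    exact (Nat.pow_le_pow_iff_right (by norm_num : 1 < 3)).1
      (hN.trans (Nat.le_pow_clog (by norm_num) N))
  have h1 := ((tendsto_pow_const_div_const_pow_of_one_lt 10
    (by norm_num : (1 : ℝ) < 3)).comp hD).const_mul 3
  rw [mul_zero] at h1
  refine squeeze_zero' (Eventually.of_forall fun N => by positivity) ?_ h1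
  filter_upwards [eventually_ge_atTop 2] with N hN
  have h2 : 3 ^ Nat.clog 3 N ≤ 3 * N := by
    have h3 := Nat.pow_pred_clog_lt_self (b := 3) (by norm_num) (x := N) (by omega)
    have h4 := Nat.clog_pos (b := 3) (by norm_num) hN
    calc 3 ^ Nat.clog 3 N = 3 ^ (Nat.clog 3 N).pred * 3 := by
          rw [← pow_succ, Nat.pred_eq_sub_one, Nat.sub_add_cancel h4]
      _ ≤ 3 * N := by omega
  have h5 : (3 : ℝ) ^ Nat.clog 3 N ≤ 3 * N := by exact_mod_cast h2
  have hN0 : (0 : ℝ) < N := by exact_mod_cast (by omega : 0 < N)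
  simp only [Function.comp_apply]
  rw [mul_div_assoc', div_le_div_iff₀ hN0 (by positivity)]
  calc (Nat.clog 3 N : ℝ) ^ 10 * 3 ^ Nat.clog 3 N ≤ (Nat.clog 3 N : ℝ) ^ 10 * (3 * N) := by gcongr
    _ = _ := by ring

/-- The rate `C (log N) ^ 10 / N` in the central limit theorem for shifted primes. -/
noncomputable def shiftedPrimesRate (N : ℕ) : ℝ :=
  256 * 24 ^ 4 * Real.exp 30 * ((Nat.clog 3 N : ℝ) ^ 10 / N)

theorem tendsto_shiftedPrimesRate : Tendsto shiftedPrimesRate atTop (𝓝 0) := by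
  have h := tendsto_clog_pow_div.const_mul (256 * 24 ^ 4 * Real.exp 30)
  rwa [mul_zero] at h

theorem IsSteinhaus.norm_charFun_shiftedPrimes_sub_le_rate {F : Type*} [Field F] [Finite F]
    {Ω : Type*} [MeasurableSpace Ω] {μ : Measure Ω} [IsProbabilityMeasure μ] {f : F[X] → Ω → ℂ}
    (hf : IsSteinhaus f μ) (hq : 3 ≤ Nat.card F) {N : ℕ} (hN : 2 ≤ N)
    (hlog : 36 * Nat.clog 3 N ^ 2 ≤ N) {Z : F[X]} (hZ : Z.Monic)
    (hZN : Z.natDegree ≤ N - 1) (t : ℂ) :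
    ‖charFun (μ.map (normalizedSum f (shiftedPrimes N Z))) t - Real.exp (-(‖t‖ ^ 2 / 4))‖ ≤
      ‖t‖ * √(shiftedPrimesRate N) + 5 * Real.exp (‖t‖ ^ 2 / 2) * ‖t‖ ^ 4 *
        (2 * (shiftedPrimesRate N + shiftedPrimesRate N)) +
      (2 + Real.exp (‖t‖ ^ 2 / 2) * ‖t‖ ^ 2) * (shiftedPrimesRate N + √(shiftedPrimesRate N)) := by
  set D := Nat.clog 3 N with hDdef
  have hD1 : 1 ≤ D := Nat.clog_pos (by norm_num) hN
  have hND : N ≤ 3 ^ D := Nat.le_pow_clog (by norm_num) N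
  -- With `J = 3 * D` and `R = 6 * D`, both `3^J` and `2^R = 64^D` are at least `27^D ≥ N^3`. The
  -- product `M * R` is at most `N / 2`, leaving room for `2 * J = 6 * D`; the hypothesis `36 * D^2
  -- ≤ N` ensures `J ≤ M`. Rounding down loses at most a factor 2, whence `N ≤ 24 * D * M`.
  set M := N / (12 * D) with hM
  have hMl : 3 * D ≤ M := (Nat.le_div_iff_mul_le (by omega)).2 (by nlinarith)
  have hMu : 12 * D * M ≤ N := Nat.mul_div_le N _
  have hM2 : N ≤ 24 * D * M := by
    have h1 : N < 12 * D * (M + 1) := Nat.lt_mul_div_succ N (by omega)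
    have h2 : 12 * D * 1 ≤ 12 * D * M := Nat.mul_le_mul_left _ (by omega)
    linarith
  have hN0 : (1 : ℝ) ≤ N := by exact_mod_cast (by omega : 1 ≤ N)
  have hDr : (1 : ℝ) ≤ D := by exact_mod_cast hD1
  have hM0 : (0 : ℝ) < M := by exact_mod_cast (by omega : 0 < M)
  have hNDr : (N : ℝ) ≤ 3 ^ D := by exact_mod_cast hND
  have h27 : (N : ℝ) ^ 3 ≤ 27 ^ D := by
    calc (N : ℝ) ^ 3 ≤ (3 ^ D) ^ 3 := by gcongr
      _ = 27 ^ D := by rw [← pow_mul, mul_comm, pow_mul]; norm_num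
  have hrate : 8 * (1 / (N : ℝ)) ≤ shiftedPrimesRate N := by
    have h1 : (1 : ℝ) ≤ Real.exp 30 := Real.one_le_exp (by norm_num)
    have h2 : 1 / (N : ℝ) ≤ (D : ℝ) ^ 10 / N := by gcongr; exact one_le_pow₀ hDr
    have h3 : (0 : ℝ) < 1 / N := by positivity
    rw [shiftedPrimesRate, ← hDdef]
    refine mul_le_mul ?_ h2 h3.le (by positivity)
    nlinarith
  refine hf.norm_charFun_shiftedPrimes_sub_le hq (M := M) (J := 3 * D) (R := 6 * D) (D := D)
    (by omega) hMl (by omega) (by nlinarith) hND hZ hZN t ?_ ?_ ?_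
  · refine le_trans ?_ hrate
    have h1 : (1 : ℝ) / 3 ^ (3 * D) ≤ 1 / N ^ 3 := by
      rw [pow_mul]; norm_num only; gcongr
    have h2 : (1 : ℝ) / 2 ^ (6 * D) ≤ 1 / N ^ 3 := by
      rw [pow_mul]; norm_num only
      refine one_div_le_one_div_of_le (by positivity) (h27.trans ?_)
      gcongr; norm_num
    calc 2 * (N : ℝ) * (N + 1) * (1 / 3 ^ (3 * D) + 1 / 2 ^ (6 * D))
        ≤ 2 * (N : ℝ) * (N + N) * (1 / N ^ 3 + 1 / N ^ 3) := by gcongr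
      _ = _ := by field_simp; ring
  · refine le_trans ?_ hrate
    have h1 : (N : ℝ) ^ 3 ≤ 3 ^ M := by
      refine h27.trans ?_
      calc (27 : ℝ) ^ D = 3 ^ (3 * D) := by rw [pow_mul]; norm_num
        _ ≤ 3 ^ M := pow_le_pow_right₀ (by norm_num) hMl
    calc 2 * (N : ℝ) / 3 ^ M ≤ 2 * N / N ^ 3 := by gcongr
      _ = 2 / N * (1 / N) := by field_simp
      _ ≤ 8 * (1 / N) := by
        gcongr
        rw [div_le_iff₀ (by linarith)]; linarith
  -- The exponent 10 in the rate is 6 from the sieve loss plus 4 from `M^(-4)`.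
  · have h1 : Real.exp (3 * (5 + Real.log D)) ^ 2 = Real.exp 30 * (D : ℝ) ^ 6 := by
      rw [← Real.exp_nat_mul, ← Real.exp_log (show (0 : ℝ) < D by linarith), ← Real.exp_nat_mul,
        ← Real.exp_add, Real.exp_log (by linarith)]
      congr 1
      push_cast; ring
    have h2 : (N : ℝ) ≤ 24 * D * M := by exact_mod_cast hM2
    rw [h1, shiftedPrimesRate, ← hDdef, mul_div_assoc', div_le_div_iff₀ (by positivity)
      (by linarith)]
    calc 256 * (Real.exp 30 * (D : ℝ) ^ 6) * N ^ 3 * N = 256 * Real.exp 30 * D ^ 6 * N ^ 4 := by ring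
      _ ≤ 256 * Real.exp 30 * D ^ 6 * (24 * D * M) ^ 4 := by gcongr
      _ = _ := by ring

theorem charFun_stdComplexNormal (t : ℂ) :
    charFun stdComplexNormal t = Real.exp (-(‖t‖ ^ 2 / 4)) := by
  have hm : Measurable fun p : ℝ × ℝ => (p.1 : ℂ) + (p.2 : ℂ) * Complex.I := by fun_prop
  have h1 : ∀ p : ℝ × ℝ, Complex.exp ((inner ℝ ((p.1 : ℂ) + (p.2 : ℂ) * Complex.I) t : ℝ) *
      Complex.I) = Complex.exp (t.re * p.1 * Complex.I) * Complex.exp (t.im * p.2 * Complex.I) := by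
    intro p
    rw [← Complex.exp_add, Complex.inner]
    congr 1
    simp
    ring
  rw [charFun_apply, stdComplexNormal, integral_map hm.aemeasurable (by fun_prop)]
  simp_rw [h1]
  rw [integral_prod_mul (fun x : ℝ => Complex.exp (t.re * x * Complex.I))
    (fun y : ℝ => Complex.exp (t.im * y * Complex.I)), ← charFun_apply_real, ← charFun_apply_real,
    charFun_gaussianReal, charFun_gaussianReal, ← Complex.exp_add, Complex.ofReal_exp,
    ← Complex.normSq_eq_norm_sq, Complex.normSq_apply]
  congr 1
  push_cast
  ring

end Limit

theorem mainTheorem5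
    (F : ℕ → Type*) [∀ n, Field (F n)] [∀ n, Finite (F n)]
    (hq : ∀ n, 3 ≤ Nat.card (F n))
    (N : ℕ → ℕ) (hN : ∀ n, 1 ≤ N n) (hN_lim : Tendsto N atTop atTop)
    (Z : (n : ℕ) → (F n)[X]) (hZ : ∀ n, (Z n).Monic) (hZ_deg : ∀ n, (Z n).natDegree ≤ N n - 1)
    (Ω : ℕ → Type*) [∀ n, MeasurableSpace (Ω n)]
    (μ : (n : ℕ) → Measure (Ω n)) [∀ n, IsProbabilityMeasure (μ n)]
    (f : (n : ℕ) → (F n)[X] → Ω n → ℂ) (hf : ∀ n, IsSteinhaus (f n) (μ n)) :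
    TendstoInDistribution
      (fun n => normalizedSum (f n) (shiftedPrimes (N n) (Z n))) atTop
      (id : ℂ → ℂ) μ stdComplexNormal := by
  have hmeas : ∀ n, AEMeasurable (normalizedSum (f n) (shiftedPrimes (N n) (Z n))) (μ n) :=
    fun n => ((Finset.measurable_fun_sum _ fun a ha => (hf n).measurable_monic
      (mem_monicOfDegree.1 ((mem_shiftedPrimes (hN n) (hZ_deg n)).1 ha).1).1).const_mul
        _).aemeasurable
  refine ⟨hmeas, aemeasurable_id, ?_⟩
  -- Lévy's continuity theorem. For fixed `t` the bound on the characteristic function depends only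
  -- on `N n`, so the variation of the field, the shift and the probability space is harmless.
  refine ProbabilityMeasure.tendsto_iff_tendsto_charFun.2 fun t => ?_
  simp only [ProbabilityMeasure.coe_mk, Measure.map_id]
  rw [charFun_stdComplexNormal, tendsto_iff_norm_sub_tendsto_zero]
  have hr := tendsto_shiftedPrimesRate.comp hN_lim
  have hs : Tendsto (fun n => √(shiftedPrimesRate (N n))) atTop (nhds 0) := by
    simpa using hr.sqrt
  have hbound := ((hs.const_mul ‖t‖).add (((hr.add hr).const_mul 2).const_mul
    (5 * Real.exp (‖t‖ ^ 2 / 2) * ‖t‖ ^ 4))).add ((hr.add hs).const_mul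
      (2 + Real.exp (‖t‖ ^ 2 / 2) * ‖t‖ ^ 2))
  simp only [add_zero, mul_zero] at hbound
  refine squeeze_zero' (Eventually.of_forall fun n => norm_nonneg _) ?_ hbound
  have hlog : ∀ᶠ m : ℕ in atTop, 36 * Nat.clog 3 m ^ 2 ≤ m := by
    filter_upwards [tendsto_clog_pow_div.eventually (gt_mem_nhds (by norm_num : (0 : ℝ) < 1 / 36)),
      eventually_ge_atTop 2] with m hm hm2
    have hm0 : (0 : ℝ) < m := by exact_mod_cast (by omega : 0 < m)
    rw [div_lt_iff₀ hm0] at hm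
    have h1 : (1 : ℝ) ≤ Nat.clog 3 m := by exact_mod_cast Nat.clog_pos (by norm_num) hm2
    have h2 : (Nat.clog 3 m : ℝ) ^ 2 ≤ (Nat.clog 3 m : ℝ) ^ 10 :=
      pow_le_pow_right₀ h1 (by norm_num)
    have h3 : (36 : ℝ) * (Nat.clog 3 m : ℝ) ^ 2 ≤ m := by linarith
    exact_mod_cast h3
  filter_upwards [hN_lim.eventually hlog, hN_lim.eventually (eventually_ge_atTop 2)] with n h1 h2
  exact (hf n).norm_charFun_shiftedPrimes_sub_le_rate (hq n) h2 h1 (hZ n) (hZ_deg n) t
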